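/- All conventions used are as follows. An $\omega$-Stone space is a second countable, locally compact, totally disconnected Hausdorff space $W$ (equivalently, the Stone space of a countable Boolean ring, possibly without $1$). A PO system is a set $P$ with an antisymmetric transitive relation $<$; $p\leqslant q$ means $p<q$ or $p=q$; $P^d=\{p: p\not< p\}$; $p_\uparrow=\{q: q\geqslant p\}$; for $S\subseteq P$, $S_\downarrow=\{p: p\leqslant q\text{ for some }q\in S\}$ and $S_{\min}$ is the set of $\leqslant$-minimal elements of $S$. A finite foundation of $S$ is a finite $F\subseteq S_\downarrow$ such that every $r\in S_\downarrow$ has some $p\in F$ with $p\leqslant r$; $P_\Delta$ is the set of $p$ for which $\{p\}$ has a finite foundation. A morphism $\alpha\colon Q\to P$ is a map with $\alpha(\{r: r>q\})=\{p: p>\alpha(q)\}$ for all $q\in Q$. An extended PO system $(P,L,f)$ is a PO system $P$ with a lower subset $L$ of $P$ contained in $P_\Delta$ and a map $f\colon L^d_{\min}\to\{1,2,\dots\}$, where $L^d_{\min}=L_{\min}\cap P^d$; an isomorphism $(P,L,f)\to(Q,M,g)$ is a PO system isomorphism taking $L$ onto $M$ and $f$ to $g$. A $P$-partition of $W$ is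 a family $\mathscr X=\{X_p\}_{p\in P}$ of nonempty, pairwise disjoint subsets of $W$ such that, with $X=\bigcup_p X_p$ and $X_p'$ the derived set of $X_p$, $X_p'\cap X=\bigcup_{q<p}X_q$ for all $p$. For $A\subseteq W$ let $T_{\mathscr X}(A)=\{p: A\cap X_p\ne\emptyset\}$. A compact open $A$ is $p$-trim if $T_{\mathscr X}(A)=p_\uparrow$ and, if $p\in P^d$, $|A\cap X_p|=1$. A $P$-partition is trim if (T1) every point of $W$ has a neighbourhood base of trim sets; (T2) for each $p$ for which there is a $p$-trim set, every point with a neighbourhood base of $p$-trim sets lies in $X_p$; (T3) every point of each $X_p$ has a $p$-trim neighbourhood. It is a trim $(P,L,f)$-partition if moreover $\overline{X_p}$ is compact precisely when $p\in L$, and $|X_p|=f(p)$ for $p\in L^d_{\min}$; it is bounded if the closure of the union of all relatively compact $X_p$ is compact. A $Q$-partition $\mathscr Y$ regularly refines a $P$-partition $\mathscr Z$, both satisfying T1, if there is a map $\alpha\colon Q\to P$ with $Y_q\subseteq Z_{\alpha(q)}$ for all $q$ and $p\in\alpha(T_{\mathscr Y}(A))$ for every $p$ and every $p$-trim set $A$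 of $\mathscr Z$. A nonempty compact open $A\subseteq W$ is pseudo-indecomposable (PI) if for each compact open $B\subseteq A$ either $B$ or $A\setminus B$ is homeomorphic to $A$. $W$ is primitive if each compact open set is a disjoint union of finitely many PI sets. $\mathscr S(W)$ is the PO system of homeomorphism classes $[A]$ of PI sets, where $[A]<[B]$ iff the disjoint sum of $A$ and $B$ is homeomorphic to $A$. The canonical partition is $\mathscr X(W)=\{X_p\}_{p\in\mathscr S(W)}$, where $X_p$ is the set of points with a neighbourhood base of sets of class $p$; $L_W=\{p:\overline{X_p}\text{ is compact}\}$ and $f_W(p)=|X_p|$ for $p\in(L_W)^d_{\min}$. $W$ is bounded if it is primitive and $\bigcup_{p\in L_W}X_p$ is relatively compact. Let $\mathscr T(W)$ be the set of equivalence classes of bounded trim partitions of $W$, two being equivalent if they agree up to a homeomorphism of $W$ and a relabelling (an isomorphism of PO systems); $[\mathscr Y]\prec[\mathscr Z]$ means that some element of $[\mathscr Y]$ regularly refines some element of $[\mathscr Z]$. Let $\mathscr P(W)$ be the set of isomorphism classes of extended PO systems $(P,L,f)$ for which $W$ has a bounded trim $(P,L,f)$-partition; $[(Q,M,g)]\prec[(P,L,f)]$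 means that there is a surjective morphism $\alpha\colon Q\to P$ with $L=\{p:\alpha^{-1}(p)\subseteq M\}$ and $f(p)=\sum_{q\in\alpha^{-1}(p)}g(q)$ for $p\in L^d_{\min}$. **Theorem.** Let $W$ be a bounded $\omega$-Stone space. Then $\prec$ is a quasi-order (reflexive and transitive) on $\mathscr T(W)$ and on $\mathscr P(W)$. Each bounded trim partition $\mathscr Y$ of $W$ is a bounded trim $(Q,M,g)$-partition for some extended PO system $(Q,M,g)$ on its PO system $Q$ of labels, and $[\mathscr Y]\mapsto[(Q,M,g)]$ is a bijection $\theta\colon\mathscr T(W)\to\mathscr P(W)$ such that $s\prec t$ iff $\theta(s)\prec\theta(t)$ for all $s,t$; so $(\mathscr T(W),\prec)$ and $(\mathscr P(W),\prec)$ are isomorphic as quasi-ordered systems. Moreover $\mathscr X(W)$ is a bounded trim $(\mathscr S(W),L_W,f_W)$-partition of $W$, and $[\mathscr X(W)]$ and $[(\mathscr S(W),L_W,f_W)]$ correspond under $\theta$ and are the greatest elements (hence maximal elements) of $\mathscr T(W)$ and $\mathscr P(W)$: $t\prec[\mathscr X(W)]$ for all $t\in\mathscr T(W)$ and $e\prec[(\mathscr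 S(W),L_W,f_W)]$ for all $e\in\mathscr P(W)$. -/

import Mathlib

open Set Topology

universe u v w

/-- A PO system: a set with an antisymmetric, transitive relation `<`
(which need be neither reflexive nor irreflexive). -/
class POSystem (P : Type u) extends LT P where
  antisymm_lt : ∀ p q : P, p < q → q < p → p = q
  trans_lt : ∀ p q r : P, p < q → q < r → p < r

namespace POSystem

/-- `p ⩽ q` means `p < q` or `p = q`. -/
def Le {P : Type u} [POSystem P] (p q : P) : Prop := p < q ∨ p = q

/-- `P^d`, the set of all `p` with `p ≮ p`. -/
def discretePart (P : Type u) [POSystem P] : Set P := {p | ¬ p < p}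

/-- `p_↑`. -/
def up {P : Type u} [POSystem P] (p : P) : Set P := {q | Le p q}

/-- `S_↓`. -/
def down {P : Type u} [POSystem P] (S : Set P) : Set P := {p | ∃ q ∈ S, Le p q}

/-- `S_min`, the minimal elements of `S` with respect to `⩽`. -/
def minimals {P : Type u} [POSystem P] (S : Set P) : Set P :=
  {p | p ∈ S ∧ ∀ q ∈ S, Le q p → q = p}

/-- Lower subsets of a PO system. -/
def IsLower {P : Type u} [POSystem P] (S : Set P) : Prop :=
  ∀ q ∈ S, ∀ r : P, Le r q → r ∈ S

/-- `F` is a finite foundation of `S`. -/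
def IsFiniteFoundation {P : Type u} [POSystem P] (F S : Set P) : Prop :=
  F.Finite ∧ F ⊆ down S ∧ ∀ r ∈ down S, ∃ p ∈ F, Le p r

/-- `P_Δ`, the set of all `p` such that `{p}` has a finite foundation. -/
def founded (P : Type u) [POSystem P] : Set P := {p | ∃ F : Set P, IsFiniteFoundation F {p}}

/-- Morphisms of PO systems: `{r | r > q} α = {p | p > q α}` for all `q`. -/
def IsMorphism {Q : Type u} {P : Type v} [POSystem Q] [POSystem P] (α : Q → P) : Prop :=
  ∀ q : Q, α '' {r | q < r} = {p | α q < p}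

/-- Isomorphisms of PO systems. -/
def IsIso {Q : Type u} {P : Type v} [POSystem Q] [POSystem P] (α : Q ≃ P) : Prop :=
  ∀ q r : Q, q < r ↔ α q < α r

theorem IsIso.le_iff {Q : Type u} {P : Type v} [POSystem Q] [POSystem P] {α : Q ≃ P}
    (h : IsIso α) (q r : Q) : Le q r ↔ Le (α q) (α r) := by
  unfold Le
  rw [h q r, α.injective.eq_iff]

end POSystem

open POSystem

/-- An extended PO system `(P, L, f)` on the PO system `P`. -/
structure ExtPOSystem (P : Type u) [POSystem P] where
  L : Set P
  isLower : IsLower L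
  subset_founded : L ⊆ founded P
  f : ↥(minimals L ∩ discretePart P) → ℕ+

namespace ExtPOSystem

/-- `L_min^d`. -/
def Lmd {P : Type u} [POSystem P] (E : ExtPOSystem P) : Set P :=
  minimals E.L ∩ discretePart P

open Classical in
/-- The function `f`, extended by `0` outside its domain `L_min^d`. -/
noncomputable def size {P : Type u} [POSystem P] (E : ExtPOSystem P) (p : P) : ℕ :=
  if h : p ∈ E.Lmd then (E.f ⟨p, h⟩ : ℕ) else 0

/-- `α` is an isomorphism of extended PO systems. -/
def IsExtIso {P : Type u} {Q : Type v} [POSystem P] [POSystem Q]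
    (E : ExtPOSystem P) (F : ExtPOSystem Q) (α : P ≃ Q) : Prop :=
  IsIso α ∧ α '' E.L = F.L ∧ ∀ p ∈ E.Lmd, F.size (α p) = E.size p

/-- `(Q, M, g) ≺ (P, L, f)`: there is a surjective morphism `α : Q → P` such that
`L = {p | Q(p) ⊆ M}` and `f p = ∑_{q ∈ Q(p)} g q` for `p ∈ L_min^d`, where `Q(p) = α⁻¹ {p}`.
For such `p` one has `Q(p) ⊆ M_min^d` (see `fibre_subset_Lmd`), so that the sum is over values of
`g` itself; as these are positive, the equation of natural numbers requires `Q(p)` to be finite. -/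
def Below {Q : Type u} {P : Type v} [POSystem Q] [POSystem P]
    (G : ExtPOSystem Q) (E : ExtPOSystem P) : Prop :=
  ∃ α : Q → P, Function.Surjective α ∧ IsMorphism α ∧
    E.L = {p | α ⁻¹' {p} ⊆ G.L} ∧
    ∀ p ∈ E.Lmd, ∃ h : (α ⁻¹' {p}).Finite, E.size p = ∑ q ∈ h.toFinset, G.size q

theorem fibre_subset_Lmd {Q : Type u} {P : Type v} [POSystem Q] [POSystem P]
    (G : ExtPOSystem Q) (E : ExtPOSystem P) (α : Q → P) (hα : IsMorphism α)
    (hL : E.L = {p | α ⁻¹' {p} ⊆ G.L}) (p : P) (hp : p ∈ E.Lmd) :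
    α ⁻¹' {p} ⊆ G.Lmd := by
  have mono : ∀ q r : Q, q < r → α q < α r := by
    intro q r h
    have : α r ∈ α '' {r | q < r} := ⟨r, h, rfl⟩
    rw [hα q] at this
    exact this
  rintro q rfl
  obtain ⟨⟨hpL, hmin⟩, hd⟩ := hp
  refine ⟨⟨?_, ?_⟩, fun h => hd (mono q q h)⟩
  · have h1 := hpL
    rw [hL] at h1
    exact h1 rfl
  · rintro r - (h | h)
    · exfalso
      have h2 : α r < α q := mono r q h
      have h3 := hmin (α r) (E.isLower _ hpL _ (Or.inl h2)) (Or.inl h2)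
      rw [h3] at h2
      exact hd h2
    · exact h

theorem IsExtIso.mem_Lmd {P : Type u} {Q : Type v} [POSystem P] [POSystem Q]
    {E : ExtPOSystem P} {F : ExtPOSystem Q} {α : P ≃ Q} (h : IsExtIso E F α) (p : P) :
    p ∈ E.Lmd ↔ α p ∈ F.Lmd := by
  obtain ⟨hi, hL, -⟩ := h
  have hm : ∀ q, q ∈ E.L ↔ α q ∈ F.L := by
    intro q
    rw [← hL]
    simp
  unfold Lmd minimals discretePart
  simp only [mem_inter_iff, mem_ofPred_eq, ← hm, ← hi p p]
  refine and_congr_left fun _ => and_congr_right fun _ => ⟨fun H q hq hle => ?_, fun H q hq hle => ?_⟩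
  · obtain ⟨q, rfl⟩ := α.surjective q
    rw [H q ((hm q).2 hq) ((hi.le_iff q p).2 hle)]
  · exact α.injective (H (α q) ((hm q).1 hq) ((hi.le_iff q p).1 hle))

end ExtPOSystem

/-- An extended PO system together with its underlying PO system. -/
structure BundledExtPOSystem : Type (u + 1) where
  carrier : Type u
  [inst : POSystem carrier]
  ext : ExtPOSystem carrier

attribute [instance] BundledExtPOSystem.inst

/-- Isomorphism of extended PO systems. -/
instance extPOSetoid : Setoid BundledExtPOSystem.{u} where
  r E F := ∃ α : E.carrier ≃ F.carrier, ExtPOSystem.IsExtIso E.ext F.ext α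
  iseqv := by
    refine ⟨fun E => ⟨Equiv.refl _, fun _ _ => Iff.rfl, by simp, fun _ _ => rfl⟩, ?_, ?_⟩
    · rintro E F ⟨α, h⟩
      refine ⟨α.symm, fun q r => ?_, ?_, fun p hp => ?_⟩
      · rw [h.1]; simp
      · rw [← h.2.1, Equiv.symm_image_image]
      · have h1 := h.2.2 (α.symm p) ((h.mem_Lmd _).2 (by simpa using hp))
        simpa using h1.symm
    · rintro E F G ⟨α, h⟩ ⟨β, k⟩
      refine ⟨α.trans β, fun q r => (h.1 q r).trans (k.1 _ _), ?_, fun p hp => ?_⟩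
      · rw [← k.2.1, ← h.2.1, image_image]; rfl
      · exact (k.2.2 (α p) ((h.mem_Lmd p).1 hp)).trans (h.2.2 p hp)

section Partitions

/-- `{X_p | p ∈ P}^*` is a `P`-partition of `W`. -/
structure IsPPartition {W : Type u} [TopologicalSpace W] {P : Type v} [POSystem P]
    (X : P → Set W) : Prop where
  nonempty : ∀ p, (X p).Nonempty
  disjoint : ∀ p q, p ≠ q → Disjoint (X p) (X q)
  derived : ∀ p, derivedSet (X p) ∩ (⋃ q, X q) = ⋃ q ∈ {q | q < p}, X q

/-- The type `T(A) = {p | A ∩ X_p ≠ ∅}` of a subset `A` of `W`. -/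
def typeOf {W : Type u} {P : Type v} (X : P → Set W) (A : Set W) : Set P :=
  {p | (A ∩ X p).Nonempty}

/-- `A` is a `p`-trim set: it is compact open with `T(A) = p_↑`, and `|A ∩ X_p| = 1`
if `p ∈ P^d`. -/
def IsTrimSet {W : Type u} [TopologicalSpace W] {P : Type v} [POSystem P]
    (X : P → Set W) (p : P) (A : Set W) : Prop :=
  IsCompact A ∧ IsOpen A ∧ typeOf X A = up p ∧
    (p ∈ discretePart P → (A ∩ X p).encard = 1)

/-- T1: every point has a neighbourhood base of trim sets. -/
def TrimBase {W : Type u} [TopologicalSpace W] {P : Type v} [POSystem P]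
    (X : P → Set W) : Prop :=
  ∀ x : W, ∀ U ∈ 𝓝 x, ∃ (p : P) (A : Set W), IsTrimSet X p A ∧ x ∈ A ∧ A ⊆ U

/-- Trim `P`-partitions, with the axioms T1, T2 (fullness) and T3 (all points of `X` are clean). -/
structure IsTrimPartition {W : Type u} [TopologicalSpace W] {P : Type v} [POSystem P]
    (X : P → Set W) : Prop where
  isPPartition : IsPPartition X
  base : TrimBase X
  full : ∀ p, (∃ A, IsTrimSet X p A) → ∀ x : W,
    (∀ U ∈ 𝓝 x, ∃ A, IsTrimSet X p A ∧ x ∈ A ∧ A ⊆ U) → x ∈ X p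
  clean : ∀ p, ∀ x ∈ X p, ∃ A, IsTrimSet X p A ∧ x ∈ A

/-- The set of all `p` such that `X_p` is relatively compact. -/
def compactLabels {W : Type u} [TopologicalSpace W] {P : Type v} (X : P → Set W) : Set P :=
  {p | IsCompact (closure (X p))}

/-- A trim partition is bounded if the union of its relatively compact elements is
relatively compact. -/
structure IsBoundedTrimPartition {W : Type u} [TopologicalSpace W] {P : Type v} [POSystem P]
    (X : P → Set W) : Prop where
  isTrim : IsTrimPartition X
  bounded : IsCompact (closure (⋃ p ∈ compactLabels X, X p))

/-- `X` is a bounded trim `(P, L, f)`-partition of `W`. -/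
structure IsBoundedTrimExtPartition {W : Type u} [TopologicalSpace W] {P : Type v} [POSystem P]
    (E : ExtPOSystem P) (X : P → Set W) : Prop where
  isTrim : IsTrimPartition X
  compact_iff : ∀ p, IsCompact (closure (X p)) ↔ p ∈ E.L
  card_eq : ∀ p ∈ E.Lmd, (X p).encard = E.size p
  bounded : IsCompact (closure (⋃ p ∈ E.L, X p))

/-- `Y` regularly refines `Z` via `α`. -/
def RegularlyRefinesVia {W : Type u} [TopologicalSpace W] {Q : Type v} {P : Type w}
    [POSystem Q] [POSystem P] (Y : Q → Set W) (Z : P → Set W) (α : Q → P) : Prop :=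
  (∀ q, Y q ⊆ Z (α q)) ∧ TrimBase Y ∧ TrimBase Z ∧
    ∀ (p : P) (A : Set W), IsTrimSet Z p A → p ∈ α '' typeOf Y A

end Partitions

/-- Bounded trim partitions of `W`, with their PO systems of labels. -/
structure BoundedTrimPartition (W : Type u) [TopologicalSpace W] : Type (u + 1) where
  carrier : Type u
  [inst : POSystem carrier]
  part : carrier → Set W
  isBoundedTrim : IsBoundedTrimPartition part

attribute [instance] BoundedTrimPartition.inst

/-- Two trim partitions of `W` are equivalent if they are the same up to a homeomorphism of `W`
and a relabelling. -/
instance trimSetoid (W : Type u) [TopologicalSpace W] : Setoid (BoundedTrimPartition W) where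
  r Y Z := ∃ (h : W ≃ₜ W) (σ : Y.carrier ≃ Z.carrier), IsIso σ ∧
    ∀ q, h '' Y.part q = Z.part (σ q)
  iseqv := by
    refine ⟨fun Y => ⟨Homeomorph.refl W, Equiv.refl _, fun _ _ => Iff.rfl, by simp⟩, ?_, ?_⟩
    · rintro Y Z ⟨h, σ, hσ, hh⟩
      refine ⟨h.symm, σ.symm, fun q r => by rw [hσ]; simp, fun q => ?_⟩
      have h1 := hh (σ.symm q)
      rw [Equiv.apply_symm_apply] at h1
      rw [← h1, ← image_comp]
      simp
    · rintro Y Z V ⟨h, σ, hσ, hh⟩ ⟨k, τ, hτ, kk⟩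
      refine ⟨h.trans k, σ.trans τ, fun q r => (hσ q r).trans (hτ _ _), fun q => ?_⟩
      rw [Equiv.trans_apply, ← kk, ← hh, image_image]
      rfl

/-- `𝒯(W)`: the equivalence classes of bounded trim partitions of `W`. -/
def TrimClasses (W : Type u) [TopologicalSpace W] : Type (u + 1) :=
  Quotient (trimSetoid W)

/-- The equivalence class of a bounded trim partition. -/
def TrimClasses.mk {W : Type u} [TopologicalSpace W] (Y : BoundedTrimPartition W) :
    TrimClasses W := Quotient.mk (trimSetoid W) Y

/-- `s ≺ t` if some element of `s` regularly refines some element of `t`. -/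
def TrimClasses.Prec {W : Type u} [TopologicalSpace W] (s t : TrimClasses W) : Prop :=
  ∃ Y Z : BoundedTrimPartition W, TrimClasses.mk Y = s ∧ TrimClasses.mk Z = t ∧
    ∃ α : Y.carrier → Z.carrier, RegularlyRefinesVia Y.part Z.part α

/-- The isomorphism class `[(P, L, f)]`. -/
def extClass {P : Type u} [POSystem P] (E : ExtPOSystem P) : Quotient extPOSetoid.{u} :=
  Quotient.mk extPOSetoid ⟨P, E⟩

/-- `𝒫(W)`: the isomorphism classes of extended PO systems `(P, L, f)` for which there is a bounded
trim `(P, L, f)`-partition of `W`. -/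
def ExtClasses (W : Type u) [TopologicalSpace W] : Type (u + 1) :=
  {e : Quotient extPOSetoid.{u} // ∃ F : BundledExtPOSystem.{u}, extClass F.ext = e ∧
    ∃ X : F.carrier → Set W, IsBoundedTrimExtPartition F.ext X}

/-- The class in `𝒫(W)` of an extended PO system `(P, L, f)` that is realised on `W`. -/
def ExtClasses.mk {W : Type u} [TopologicalSpace W] {P : Type u} [POSystem P]
    (E : ExtPOSystem P) (h : ∃ X : P → Set W, IsBoundedTrimExtPartition E X) : ExtClasses W :=
  ⟨extClass E, ⟨P, E⟩, rfl, h⟩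

/-- The relation `≺` on `𝒫(W)`. -/
def ExtClasses.Prec {W : Type u} [TopologicalSpace W] (d e : ExtClasses W) : Prop :=
  ∃ G E : BundledExtPOSystem.{u}, extClass G.ext = d.1 ∧ extClass E.ext = e.1 ∧
    G.ext.Below E.ext

section Canonical

/-- Pseudo-indecomposable (nonempty) compact open sets. By Stone duality an isomorphism between the
ideals `(A)` and `(B)` of the ring of compact open sets is the same as a homeomorphism between
`A` and `B`. -/
def IsPI {W : Type u} [TopologicalSpace W] (A : Set W) : Prop :=
  IsCompact A ∧ IsOpen A ∧ A.Nonempty ∧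
    ∀ B : Set W, IsCompact B → IsOpen B → B ⊆ A →
      Nonempty (↥B ≃ₜ ↥A) ∨ Nonempty (↥(A \ B) ≃ₜ ↥A)

/-- `W` is primitive: each compact open set is a disjoint union of finitely many PI sets. -/
def IsPrimitive (W : Type u) [TopologicalSpace W] : Prop :=
  ∀ A : Set W, IsCompact A → IsOpen A →
    ∃ S : Set (Set W), S.Finite ∧ (∀ B ∈ S, IsPI B) ∧ S.PairwiseDisjoint id ∧ ⋃₀ S = A

/-- PI sets up to homeomorphism. -/
instance pseudoIndecSetoid (W : Type u) [TopologicalSpace W] : Setoid {A : Set W // IsPI A} where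
  r A B := Nonempty (↥A.1 ≃ₜ ↥B.1)
  iseqv := ⟨fun _ => ⟨Homeomorph.refl _⟩, fun ⟨h⟩ => ⟨h.symm⟩, fun ⟨h⟩ ⟨k⟩ => ⟨h.trans k⟩⟩

/-- `𝒮(W)`: the classes `[A]` of PI sets. -/
def StructureDiagram (W : Type u) [TopologicalSpace W] : Type u := Quotient (pseudoIndecSetoid W)

/-- The class `[A]` of a PI set. -/
def StructureDiagram.mk {W : Type u} [TopologicalSpace W] (A : {A : Set W // IsPI A}) :
    StructureDiagram W := Quotient.mk (pseudoIndecSetoid W) A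

/-- The relation on `𝒮(W)`: `[A] < [B]` iff `[A] × [B] ≅ [A]`. The product of the rings `(A)` and
`(B)` is the ring of compact open sets of the disjoint sum of the spaces `A` and `B`. -/
def StructureDiagram.Lt {W : Type u} [TopologicalSpace W] :
    StructureDiagram W → StructureDiagram W → Prop :=
  Quotient.lift₂ (fun A B => Nonempty ((↥A.1 ⊕ ↥B.1) ≃ₜ ↥A.1)) (by
    rintro A B C D ⟨h⟩ ⟨k⟩
    exact propext
      ⟨fun ⟨g⟩ => ⟨((h.symm.sumCongr k.symm).trans g).trans h⟩,
        fun ⟨g⟩ => ⟨((h.sumCongr k).trans g).trans h.symm⟩⟩)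

instance structureDiagramPOSystem (W : Type u) [TopologicalSpace W] :
    POSystem (StructureDiagram W) where
  lt := StructureDiagram.Lt
  antisymm_lt := by
    intro p q
    refine Quotient.inductionOn₂ p q ?_
    rintro A B ⟨g⟩ ⟨h⟩
    exact Quotient.sound ⟨(g.symm.trans (Homeomorph.sumComm _ _)).trans h⟩
  trans_lt := by
    intro p q r
    refine Quotient.inductionOn₃ p q r ?_
    rintro A B C ⟨g⟩ ⟨h⟩
    exact ⟨((((g.symm.sumCongr (Homeomorph.refl _)).trans (Homeomorph.sumAssoc _ _ _)).trans
      ((Homeomorph.refl _).sumCongr h)).trans g)⟩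

/-- The canonical partition `𝒳(W)`: `X_p` is the set of all points with a neighbourhood base of
sets isomorphic to `p`. -/
def canonicalPart (W : Type u) [TopologicalSpace W] (p : StructureDiagram W) : Set W :=
  {x | ∀ U ∈ 𝓝 x, ∃ A : {A : Set W // IsPI A}, StructureDiagram.mk A = p ∧ x ∈ A.1 ∧ A.1 ⊆ U}

/-- `W` is bounded: `W` is primitive, and the union of the relatively compact elements of the
canonical partition is relatively compact. (That the canonical partition of a primitive space is a
trim partition is not part of this definition.) -/
def IsBoundedStoneSpace (W : Type u) [TopologicalSpace W] : Prop :=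
  IsPrimitive W ∧
    IsCompact (closure (⋃ p ∈ compactLabels (canonicalPart W), canonicalPart W p))

end Canonical

/-! The extended PO system of a bounded trim partition is read off from the topology: `L` consists
of the labels with relatively compact class, and `f` counts the points of the classes of minimal
discrete labels in `L`, which are finite. That it determines the partition up to a homeomorphism of
`W` is `IsBoundedTrimExtPartition.exists_homeomorph`, which makes `θ` injective. For its proof a
point at infinity is adjoined as a further class, whose label lies below exactly the labels outside
`L`; boundedness gives this point trim neighbourhoods, so the compactification carries a trim
partition. Vaught's back-and-forth argument then applies to the relation `TrimEquiv`: two compact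
open sets have the same type and equally many points for each minimal discrete label. The extension
property `TrimEquiv.forth` holds because a compact open set splits into disjoint trim neighbourhoods
of a suitable finite set of points, and labels that are not minimal discrete occur infinitely often,
so that there is always room for such points.

A regular refinement induces a surjective morphism of labels with the required behaviour on `L` and
`f` (`RegularlyRefinesVia.below`). Conversely, the unions of classes along the fibres of such a
morphism satisfy everything but T2, and adding all points that T2 demands gives a bounded trim
partition with the prescribed extended PO system (`IsBoundedTrimExtPartition.exists_coarser`). By
uniqueness it is equivalent to any other partition with that system, so `θ` preserves and reflects
`≺`. Morphisms compose, so `≺` is a quasi-order on extended classes, and `θ` carries this back to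
partitions.

For the canonical partition, each PI set contains a point with arbitrarily small copies of the set
around it (`IsPI.mem_typeOf`), and copies of a set that accumulate at a point can be absorbed by
shifting (`absorbs_of_accumulate`). Hence PI sets are trim; in a primitive space trim sets are
conversely PI, which yields T2. In an arbitrary trim partition, trim sets with the same label are
homeomorphic by back-and-forth, hence PI, and sending a label to the class of its trim sets gives
the regular refinement of the canonical partition. -/

set_option linter.unusedSectionVars false

/-! ### Order facts for PO systems -/

namespace POSystem

variable {P : Type u} [POSystem P]

theorem Le.refl (p : P) : Le p p := Or.inr rfl

theorem lt_of_le_of_lt {p q r : P} (h : Le p q) (k : q < r) : p < r := by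
  rcases h with h | rfl
  · exact trans_lt _ _ _ h k
  · exact k

theorem lt_of_lt_of_le {p q r : P} (h : p < q) (k : Le q r) : p < r := by
  rcases k with k | rfl
  · exact trans_lt _ _ _ h k
  · exact h

theorem Le.trans {p q r : P} (h : Le p q) (k : Le q r) : Le p r := by
  rcases k with k | rfl
  · exact Or.inl (lt_of_le_of_lt h k)
  · exact h

theorem Le.antisymm {p q : P} (h : Le p q) (k : Le q p) : p = q := by
  rcases h with h | h
  · rcases k with k | k
    · exact antisymm_lt _ _ h k
    · exact k.symm
  · exact h

theorem mem_up_self (p : P) : p ∈ up p := Le.refl p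

theorem mem_minimals_up (p : P) : p ∈ minimals (up p) :=
  ⟨mem_up_self p, fun _ hq h => h.antisymm hq⟩

/-- A finite family of labels has a minimal member below each of its members. -/
theorem exists_minimal_le {ι : Type*} [Finite ι] (p : ι → P) (i : ι) :
    ∃ j, Le (p j) (p i) ∧ ∀ k, Le (p k) (p j) → p k = p j := by
  let _ : Preorder ι :=
    { le := fun a b => Le (p a) (p b)
      lt := fun a b => Le (p a) (p b) ∧ ¬ Le (p b) (p a)
      le_refl := fun a => Le.refl _
      le_trans := fun a b c h k => Le.trans h k
      lt_iff_le_not_ge := fun _ _ => Iff.rfl }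
  obtain ⟨j, hj, hm⟩ := (Set.toFinite (Set.univ : Set ι)).exists_le_minimal (Set.mem_univ i)
  refine ⟨j, hj, fun k hk => ?_⟩
  exact Le.antisymm hk (hm.2 (Set.mem_univ k) hk)

end POSystem

/-! ### Compact open sets, types and trim sets -/

/-- Compact open sets. -/
def IsCompactOpen {W : Type u} [TopologicalSpace W] (A : Set W) : Prop := IsCompact A ∧ IsOpen A

namespace IsCompactOpen

variable {W : Type u} [TopologicalSpace W] {A B : Set W}

theorem empty : IsCompactOpen (∅ : Set W) := ⟨isCompact_empty, isOpen_empty⟩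

theorem isClosed [T2Space W] (h : IsCompactOpen A) : IsClosed A := h.1.isClosed

theorem union (h : IsCompactOpen A) (k : IsCompactOpen B) : IsCompactOpen (A ∪ B) :=
  ⟨h.1.union k.1, h.2.union k.2⟩

theorem diff [T2Space W] (h : IsCompactOpen A) (k : IsCompactOpen B) : IsCompactOpen (A \ B) :=
  ⟨h.1.diff k.2, h.2.sdiff k.isClosed⟩

theorem inter [T2Space W] (h : IsCompactOpen A) (k : IsCompactOpen B) : IsCompactOpen (A ∩ B) :=
  ⟨h.1.inter k.1, h.2.inter k.2⟩

theorem iUnion {ι : Type*} [Finite ι] {C : ι → Set W} (h : ∀ i, IsCompactOpen (C i)) :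
    IsCompactOpen (⋃ i, C i) :=
  ⟨isCompact_iUnion fun i => (h i).1, isOpen_iUnion fun i => (h i).2⟩

theorem mem_nhds (h : IsCompactOpen A) {x : W} (hx : x ∈ A) : A ∈ 𝓝 x := h.2.mem_nhds hx

end IsCompactOpen

section TypeOf

variable {W : Type u} {P : Type v} {X : P → Set W}

theorem typeOf_mono {A B : Set W} (h : A ⊆ B) : typeOf X A ⊆ typeOf X B :=
  fun _ ⟨x, hx, hp⟩ => ⟨x, h hx, hp⟩

theorem typeOf_union (A B : Set W) : typeOf X (A ∪ B) = typeOf X A ∪ typeOf X B := by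
  ext p
  simp only [typeOf, mem_ofPred_eq, mem_union, union_inter_distrib_right, union_nonempty]

end TypeOf

section TrimBasics

variable {W : Type u} [TopologicalSpace W] {P : Type v} [POSystem P] {X : P → Set W}

theorem IsTrimSet.isCompactOpen {p : P} {A : Set W} (h : IsTrimSet X p A) : IsCompactOpen A :=
  ⟨h.1, h.2.1⟩

theorem IsTrimSet.typeOf_eq {p : P} {A : Set W} (h : IsTrimSet X p A) : typeOf X A = up p :=
  h.2.2.1

theorem IsTrimSet.nonempty {p : P} {A : Set W} (h : IsTrimSet X p A) : (A ∩ X p).Nonempty := by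
  have : p ∈ typeOf X A := h.typeOf_eq ▸ mem_up_self p
  exact this

theorem IsTrimSet.le {p q : P} {A : Set W} (h : IsTrimSet X p A) {x : W} (hx : x ∈ A)
    (hq : x ∈ X q) : Le p q := by
  have : q ∈ typeOf X A := ⟨x, hx, hq⟩
  rwa [h.typeOf_eq] at this

theorem IsTrimSet.eq_of_mem {p : P} {A : Set W} (h : IsTrimSet X p A) (hp : p ∈ discretePart P)
    {x y : W} (hx : x ∈ A) (hx' : x ∈ X p) (hy : y ∈ A) (hy' : y ∈ X p) : x = y := by
  obtain ⟨z, hz⟩ := encard_eq_one.1 (h.2.2.2 hp)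
  have h1 : x ∈ A ∩ X p := ⟨hx, hx'⟩
  have h2 : y ∈ A ∩ X p := ⟨hy, hy'⟩
  rw [hz] at h1 h2
  rw [h1, h2]

theorem isTrimSet_of {p : P} {A : Set W} (hA : IsCompactOpen A) (ht : typeOf X A = up p)
    (h : p ∈ discretePart P → ∀ x ∈ A, x ∈ X p → ∀ y ∈ A, y ∈ X p → x = y) :
    IsTrimSet X p A := by
  refine ⟨hA.1, hA.2, ht, fun hp => ?_⟩
  have hne : p ∈ typeOf X A := ht ▸ mem_up_self p
  obtain ⟨x, hx, hx'⟩ := hne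
  refine encard_eq_one.2 ⟨x, ?_⟩
  ext y
  simp only [mem_inter_iff, mem_singleton_iff]
  exact ⟨fun ⟨hy, hy'⟩ => h hp y hy hy' x hx hx', by rintro rfl; exact ⟨hx, hx'⟩⟩

theorem IsPPartition.eq_of_mem (h : IsPPartition X) {p q : P} {x : W} (hp : x ∈ X p)
    (hq : x ∈ X q) : p = q := by
  by_contra hne
  exact disjoint_left.1 (h.disjoint p q hne) hp hq

theorem IsPPartition.mem_derivedSet_iff (h : IsPPartition X) {p q : P} {x : W} (hq : x ∈ X q) :
    x ∈ derivedSet (X p) ↔ q < p := by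
  have h1 := Set.ext_iff.1 (h.derived p) x
  simp only [mem_inter_iff, mem_iUnion, mem_ofPred_eq, exists_prop] at h1
  constructor
  · intro hx
    obtain ⟨r, hr, hxr⟩ := h1.1 ⟨hx, q, hq⟩
    rwa [h.eq_of_mem hq hxr]
  · intro hqp
    exact (h1.2 ⟨q, hqp, hq⟩).1

theorem isPPartition_of (hne : ∀ p, (X p).Nonempty) (hd : ∀ p q x, x ∈ X p → x ∈ X q → p = q)
    (h : ∀ p q x, x ∈ X q → (x ∈ derivedSet (X p) ↔ q < p)) : IsPPartition X := by
  refine ⟨hne, fun p q hpq => disjoint_left.2 fun x hp hq => hpq (hd p q x hp hq), fun p => ?_⟩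
  ext x
  simp only [mem_inter_iff, mem_iUnion, mem_ofPred_eq, exists_prop]
  constructor
  · rintro ⟨hx, q, hq⟩
    exact ⟨q, (h p q x hq).1 hx, hq⟩
  · rintro ⟨q, hqp, hq⟩
    exact ⟨(h p q x hq).2 hqp, q, hq⟩

theorem IsPPartition.exists_ne (h : IsPPartition X) {p q : P} {x : W} (hq : x ∈ X q)
    (hlt : q < p) {U : Set W} (hU : U ∈ 𝓝 x) : ∃ y ∈ U, y ∈ X p ∧ y ≠ x := by
  obtain ⟨y, ⟨hy, hy'⟩, hne⟩ := accPt_iff_nhds.1 ((h.mem_derivedSet_iff hq).2 hlt) U hU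
  exact ⟨y, hy, hy', hne⟩

theorem IsPPartition.infinite (h : IsPPartition X) [T1Space W] {p q : P} {x : W} (hq : x ∈ X q)
    (hlt : q < p) {U : Set W} (hU : U ∈ 𝓝 x) : (U ∩ X p).Infinite := by
  have h1 : AccPt x (Filter.principal (U ∩ X p)) :=
    ((h.mem_derivedSet_iff hq).2 hlt).nhds_inter hU
  exact Set.Infinite.of_accPt h1

/-- Each point of `X q` is a limit of `X p` when `q < p`, so types of open sets are upward closed.
-/
theorem IsPPartition.mem_typeOf_of_le (h : IsPPartition X) {A : Set W} (hA : IsOpen A) {p q : P}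
    (hq : q ∈ typeOf X A) (hle : Le q p) : p ∈ typeOf X A := by
  rcases hle with hlt | rfl
  · obtain ⟨x, hx, hxq⟩ := hq
    obtain ⟨y, hy, hy', -⟩ := h.exists_ne hxq hlt (hA.mem_nhds hx)
    exact ⟨y, hy, hy'⟩
  · exact hq

/-- One point of `X p` forces all labels above `p` into the type of an open set, while extra labels
and extra points of `X p` cannot appear on shrinking. -/
theorem IsPPartition.isTrimSet_of_subset (h : IsPPartition X) {p : P} {A B : Set W}
    (hA : IsTrimSet X p A) (hB : IsCompactOpen B) (hBA : B ⊆ A) {x : W} (hx : x ∈ B)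
    (hxp : x ∈ X p) : IsTrimSet X p B := by
  refine isTrimSet_of hB (Subset.antisymm ?_ fun q hq => ?_) fun hp y hy hy' z hz hz' => ?_
  · rw [← hA.typeOf_eq]
    exact typeOf_mono hBA
  · exact h.mem_typeOf_of_le hB.2 ⟨x, hx, hxp⟩ hq
  · exact hA.eq_of_mem hp (hBA hy) hy' (hBA hz) hz'

/-- Partitions satisfying all the axioms of trim partitions with the possible exception of T2. -/
structure IsCleanPartition (X : P → Set W) : Prop where
  isPPartition : IsPPartition X
  base : TrimBase X
  clean : ∀ p, ∀ x ∈ X p, ∃ A, IsTrimSet X p A ∧ x ∈ A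

theorem IsTrimPartition.isClean (h : IsTrimPartition X) : IsCleanPartition X :=
  ⟨h.isPPartition, h.base, h.clean⟩

theorem TrimBase.exists_compactOpen (h : TrimBase X) {x : W} {U : Set W} (hU : U ∈ 𝓝 x) :
    ∃ A, IsCompactOpen A ∧ x ∈ A ∧ A ⊆ U := by
  obtain ⟨p, A, hA, hx, hAU⟩ := h x U hU
  exact ⟨A, hA.isCompactOpen, hx, hAU⟩

theorem IsCleanPartition.exists_trimSet [T2Space W] (h : IsCleanPartition X) {p : P} {x : W}
    (hx : x ∈ X p) {U : Set W} (hU : U ∈ 𝓝 x) : ∃ A, IsTrimSet X p A ∧ x ∈ A ∧ A ⊆ U := by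
  obtain ⟨A, hA, hxA⟩ := h.clean p x hx
  obtain ⟨B, hB, hxB, hBU⟩ := h.base.exists_compactOpen hU
  exact ⟨B ∩ A, h.isPPartition.isTrimSet_of_subset hA (hB.inter hA.isCompactOpen)
    inter_subset_right ⟨hxB, hxA⟩ hx, ⟨hxB, hxA⟩, inter_subset_left.trans hBU⟩

/-- A compact set has a cover by finitely many trim sets that meet it and lie in a given open
neighbourhood of it. -/
theorem TrimBase.exists_finite_cover (h : TrimBase X) {K U : Set W} (hK : IsCompact K)
    (hU : IsOpen U) (hKU : K ⊆ U) :
    ∃ (n : ℕ) (p : Fin n → P) (A : Fin n → Set W), (∀ i, IsTrimSet X (p i) (A i)) ∧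
      (∀ i, A i ⊆ U) ∧ (∀ i, (A i ∩ K).Nonempty) ∧ K ⊆ ⋃ i, A i := by
  choose p A hA hxA hAU using fun x : K => h x U (hU.mem_nhds (hKU x.2))
  obtain ⟨t, htK⟩ := hK.elim_nhds_subcover' (fun x hx => A ⟨x, hx⟩)
    (fun x hx => (hA ⟨x, hx⟩).isCompactOpen.mem_nhds (hxA ⟨x, hx⟩))
  obtain ⟨e⟩ : Nonempty (t ≃ Fin t.card) := ⟨t.equivFin⟩
  refine ⟨t.card, fun i => p (e.symm i), fun i => A (e.symm i), fun i => hA _, fun i => hAU _,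
    fun i => ⟨_, hxA _, Subtype.prop _⟩, fun x hx => ?_⟩
  obtain ⟨y, hy, hxy⟩ := mem_iUnion₂.1 (htK hx)
  exact mem_iUnion.2 ⟨e ⟨y, hy⟩, by simpa using hxy⟩

end TrimBasics

/-! ### Back-and-forth construction of homeomorphisms -/

/-- A matching of a partition of `A` with a partition of `B`, all matched cells being in the
relation `R`. -/
structure IsMatching {V : Type u} {W : Type v} (R : Set V → Set W → Prop) (A : Set V) (B : Set W)
    (S : Set V → Set W → Prop) : Prop where
  rel : ∀ C D, S C D → R C D
  subset_left : ∀ C D, S C D → C ⊆ A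
  subset_right : ∀ C D, S C D → D ⊆ B
  cover_left : ∀ x ∈ A, ∃ C D, S C D ∧ x ∈ C
  cover_right : ∀ y ∈ B, ∃ C D, S C D ∧ y ∈ D
  unique_left : ∀ C D C' D' x, S C D → S C' D' → x ∈ C → x ∈ C' → C = C' ∧ D = D'
  unique_right : ∀ C D C' D' y, S C D → S C' D' → y ∈ D → y ∈ D' → C = C' ∧ D = D'

/-- The matching `T` refines the matching `S`. -/
def Refines {V : Type u} {W : Type v} (T S : Set V → Set W → Prop) : Prop :=
  ∀ C D, T C D → ∃ C' D', S C' D' ∧ C ⊆ C' ∧ D ⊆ D'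

/-- The set `E` does not cut the left-hand cells of `S`. -/
def Decides {V : Type u} {W : Type v} (S : Set V → Set W → Prop) (E : Set V) : Prop :=
  ∀ C D, S C D → C ⊆ E ∨ Disjoint C E

/-- The points `x` and `y` are in matched cells. -/
def Linked {V : Type u} {W : Type v} (S : Set V → Set W → Prop) (x : V) (y : W) : Prop :=
  ∃ C D, S C D ∧ x ∈ C ∧ y ∈ D

section Matching

variable {V : Type u} {W : Type v} {R S T : Set V → Set W → Prop} {A : Set V} {B : Set W}

theorem IsMatching.flip (h : IsMatching R A B S) : IsMatching (flip R) B A (flip S) where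
  rel C D := h.rel D C
  subset_left C D := h.subset_right D C
  subset_right C D := h.subset_left D C
  cover_left y hy := by
    obtain ⟨C, D, hS, hD⟩ := h.cover_right y hy
    exact ⟨D, C, hS, hD⟩
  cover_right x hx := by
    obtain ⟨C, D, hS, hC⟩ := h.cover_left x hx
    exact ⟨D, C, hS, hC⟩
  unique_left C D C' D' y k k' hy hy' := (h.unique_right D C D' C' y k k' hy hy').symm
  unique_right C D C' D' x k k' hx hx' := (h.unique_left D C D' C' x k k' hx hx').symm

theorem Refines.refl (S : Set V → Set W → Prop) : Refines S S :=
  fun C D h => ⟨C, D, h, Subset.rfl, Subset.rfl⟩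

theorem Refines.trans {U : Set V → Set W → Prop} (h : Refines U T) (k : Refines T S) :
    Refines U S := by
  intro C D hU
  obtain ⟨C', D', hT, hC, hD⟩ := h C D hU
  obtain ⟨C'', D'', hS, hC', hD'⟩ := k C' D' hT
  exact ⟨C'', D'', hS, hC.trans hC', hD.trans hD'⟩

theorem Refines.flip (h : Refines T S) : Refines (flip T) (flip S) := by
  intro D C hT
  obtain ⟨C', D', hS, hC, hD⟩ := h C D hT
  exact ⟨D', C', hS, hD, hC⟩

theorem Refines.decides (h : Refines T S) {E : Set V} (k : Decides S E) : Decides T E := by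
  intro C D hT
  obtain ⟨C', D', hS, hC, -⟩ := h C D hT
  exact (k C' D' hS).imp hC.trans (Disjoint.mono_left hC)

theorem Refines.linked (h : Refines T S) {x : V} {y : W} (k : Linked T x y) : Linked S x y := by
  obtain ⟨C, D, hT, hx, hy⟩ := k
  obtain ⟨C', D', hS, hC, hD⟩ := h C D hT
  exact ⟨C', D', hS, hC hx, hD hy⟩

theorem linked_flip {x : V} {y : W} : Linked (flip S) y x ↔ Linked S x y :=
  ⟨fun ⟨D, C, h, hy, hx⟩ => ⟨C, D, h, hx, hy⟩, fun ⟨C, D, h, hx, hy⟩ => ⟨D, C, h, hy, hx⟩⟩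

/-- Half a round of back-and-forth: each left cell is cut by `E` and its partner is cut to match.
Empty cells may arise; they are harmless because uniqueness of cells is only required at common
points. -/
theorem IsMatching.exists_refinement (h : IsMatching R A B S) (E : Set V)
    (forth : ∀ C D, R C D → ∃ D₁, D₁ ⊆ D ∧ R (C ∩ E) D₁ ∧ R (C \ E) (D \ D₁)) :
    ∃ T, IsMatching R A B T ∧ Refines T S ∧ Decides T E := by
  choose! f hf h1 h2 using forth
  refine ⟨fun C D => ∃ C' D', S C' D' ∧
    ((C = C' ∩ E ∧ D = f C' D') ∨ (C = C' \ E ∧ D = D' \ f C' D')), ?_, ?_, ?_⟩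
  · constructor
    · rintro C D ⟨C', D', hS, ⟨rfl, rfl⟩ | ⟨rfl, rfl⟩⟩
      exacts [h1 _ _ (h.rel _ _ hS), h2 _ _ (h.rel _ _ hS)]
    · rintro C D ⟨C', D', hS, ⟨rfl, rfl⟩ | ⟨rfl, rfl⟩⟩
      exacts [inter_subset_left.trans (h.subset_left _ _ hS),
        sdiff_subset.trans (h.subset_left _ _ hS)]
    · rintro C D ⟨C', D', hS, ⟨rfl, rfl⟩ | ⟨rfl, rfl⟩⟩
      exacts [(hf _ _ (h.rel _ _ hS)).trans (h.subset_right _ _ hS),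
        sdiff_subset.trans (h.subset_right _ _ hS)]
    · intro x hx
      obtain ⟨C, D, hS, hC⟩ := h.cover_left x hx
      by_cases hE : x ∈ E
      · exact ⟨_, _, ⟨C, D, hS, Or.inl ⟨rfl, rfl⟩⟩, hC, hE⟩
      · exact ⟨_, _, ⟨C, D, hS, Or.inr ⟨rfl, rfl⟩⟩, hC, hE⟩
    · intro y hy
      obtain ⟨C, D, hS, hD⟩ := h.cover_right y hy
      by_cases hE : y ∈ f C D
      · exact ⟨_, _, ⟨C, D, hS, Or.inl ⟨rfl, rfl⟩⟩, hE⟩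
      · exact ⟨_, _, ⟨C, D, hS, Or.inr ⟨rfl, rfl⟩⟩, hD, hE⟩
    · rintro _ _ _ _ x ⟨C, D, hS, ⟨rfl, rfl⟩ | ⟨rfl, rfl⟩⟩ ⟨C', D', hS', ⟨rfl, rfl⟩ | ⟨rfl, rfl⟩⟩
        hx hx'
      · obtain ⟨rfl, rfl⟩ := h.unique_left _ _ _ _ x hS hS' hx.1 hx'.1
        exact ⟨rfl, rfl⟩
      · exact absurd hx.2 hx'.2
      · exact absurd hx'.2 hx.2
      · obtain ⟨rfl, rfl⟩ := h.unique_left _ _ _ _ x hS hS' hx.1 hx'.1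
        exact ⟨rfl, rfl⟩
    · rintro _ _ _ _ x ⟨C, D, hS, ⟨rfl, rfl⟩ | ⟨rfl, rfl⟩⟩ ⟨C', D', hS', ⟨rfl, rfl⟩ | ⟨rfl, rfl⟩⟩
        hx hx'
      · obtain ⟨rfl, rfl⟩ := h.unique_right _ _ _ _ x hS hS' (hf _ _ (h.rel _ _ hS) hx)
          (hf _ _ (h.rel _ _ hS') hx')
        exact ⟨rfl, rfl⟩
      · obtain ⟨rfl, rfl⟩ := h.unique_right _ _ _ _ x hS hS' (hf _ _ (h.rel _ _ hS) hx) hx'.1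
        exact absurd hx hx'.2
      · obtain ⟨rfl, rfl⟩ := h.unique_right _ _ _ _ x hS hS' hx.1 (hf _ _ (h.rel _ _ hS') hx')
        exact absurd hx' hx.2
      · obtain ⟨rfl, rfl⟩ := h.unique_right _ _ _ _ x hS hS' hx.1 hx'.1
        exact ⟨rfl, rfl⟩
  · rintro C D ⟨C', D', hS, ⟨rfl, rfl⟩ | ⟨rfl, rfl⟩⟩
    exacts [⟨C', D', hS, inter_subset_left, hf _ _ (h.rel _ _ hS)⟩,
      ⟨C', D', hS, sdiff_subset, sdiff_subset⟩]
  · rintro C D ⟨C', D', hS, ⟨rfl, rfl⟩ | ⟨rfl, rfl⟩⟩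
    exacts [Or.inl inter_subset_right, Or.inr disjoint_sdiff_left]

/-- A decreasing sequence of matchings that separates the points on the right determines a map. -/
theorem exists_unique_linked [TopologicalSpace W] [T2Space W] {S : ℕ → Set V → Set W → Prop}
    (hS : ∀ n, IsMatching R A B (S n)) (hmono : ∀ m n, m ≤ n → Refines (S n) (S m))
    (hR : ∀ C D, R C D → IsCompact D ∧ (C.Nonempty → D.Nonempty))
    (hsep : ∀ y ∈ B, ∀ z ∈ B, y ≠ z → ∃ (n : ℕ) (E : Set W), y ∈ E ∧ z ∉ E ∧
      Decides (flip (S n)) E)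
    {x : V} (hx : x ∈ A) : ∃ y ∈ B, (∀ n, Linked (S n) x y) ∧
      ∀ z ∈ B, (∀ n, Linked (S n) x z) → z = y := by
  choose C D hCD hxC using fun n => (hS n).cover_left x hx
  have hcomp : ∀ n, IsCompact (D n) := fun n => (hR _ _ ((hS n).rel _ _ (hCD n))).1
  have hlink : ∀ n y, Linked (S n) x y ↔ y ∈ D n := by
    intro n y
    constructor
    · rintro ⟨C', D', h, hx', hy⟩
      obtain ⟨-, rfl⟩ := (hS n).unique_left _ _ _ _ x h (hCD n) hx' (hxC n)
      exact hy
    · exact fun hy => ⟨_, _, hCD n, hxC n, hy⟩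
  -- The right-hand cells matched with those containing `x` form a decreasing sequence of nonempty
  -- compact sets.
  obtain ⟨y, hy⟩ : (⋂ n, D n).Nonempty := by
    refine IsCompact.nonempty_iInter_of_sequence_nonempty_isCompact_isClosed D (fun n y hy => ?_)
      (fun n => (hR _ _ ((hS n).rel _ _ (hCD n))).2 ⟨x, hxC n⟩) (hcomp 0)
      (fun n => (hcomp n).isClosed)
    rw [← hlink] at hy ⊢
    exact (hmono n (n + 1) n.le_succ).linked hy
  rw [mem_iInter] at hy
  have hDB : ∀ n, D n ⊆ B := fun n => (hS n).subset_right _ _ (hCD n)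
  refine ⟨y, hDB 0 (hy 0), fun n => (hlink n y).2 (hy n), fun z hz hzl => ?_⟩
  by_contra hne
  obtain ⟨n, E, hyE, hzE, hdec⟩ := hsep y (hDB 0 (hy 0)) z hz (Ne.symm hne)
  rcases hdec (D n) (C n) (hCD n) with h | h
  · exact hzE (h ((hlink n z).1 (hzl n)))
  · exact disjoint_left.1 h (hy n) hyE

end Matching

section BackAndForth

/-- An enumeration of the compact open subsets of a space. -/
theorem exists_enumeration {V : Type u} [TopologicalSpace V]
    (hc : {C : Set V | IsCompactOpen C}.Countable) :
    ∃ E : ℕ → Set V, (∀ n, IsCompactOpen (E n)) ∧ ∀ C, IsCompactOpen C → ∃ n, E n = C := by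
  obtain ⟨E, hE⟩ := hc.exists_eq_range ⟨∅, IsCompactOpen.empty⟩
  refine ⟨E, fun n => ?_, fun C hC => ?_⟩
  · have : E n ∈ {C : Set V | IsCompactOpen C} := hE ▸ mem_range_self n
    exact this
  · have : C ∈ range E := hE ▸ hC
    exact this

variable {V : Type u} {W : Type v} [TopologicalSpace V] [TopologicalSpace W]
  [T2Space V] [T2Space W]

/-- Vaught's theorem: a relation between compact open sets with the back-and-forth property is
realised by homeomorphisms. -/
theorem exists_homeomorph_of_backAndForth
    (hV : {C : Set V | IsCompactOpen C}.Countable) (hW : {C : Set W | IsCompactOpen C}.Countable)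
    (bV : ∀ x : V, ∀ U ∈ 𝓝 x, ∃ C, IsCompactOpen C ∧ x ∈ C ∧ C ⊆ U)
    (bW : ∀ y : W, ∀ U ∈ 𝓝 y, ∃ C, IsCompactOpen C ∧ y ∈ C ∧ C ⊆ U)
    (R : Set V → Set W → Prop) (hR : ∀ C D, R C D → IsCompactOpen C ∧ IsCompactOpen D)
    (hne : ∀ C D, R C D → (C.Nonempty ↔ D.Nonempty))
    (forth : ∀ C D, R C D → ∀ E, IsCompactOpen E → E ⊆ C → ∃ F ⊆ D, R E F ∧ R (C \ E) (D \ F))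
    (back : ∀ C D, R C D → ∀ F, IsCompactOpen F → F ⊆ D → ∃ E ⊆ C, R E F ∧ R (C \ E) (D \ F))
    {A : Set V} {B : Set W} (hAB : R A B) :
    ∃ h : A ≃ₜ B, ∀ x : A, ∀ M ∈ 𝓝 (x : V), ∀ N ∈ 𝓝 (h x : W),
      ∃ C D, R C D ∧ ↑x ∈ C ∧ C ⊆ M ∧ ↑(h x) ∈ D ∧ D ⊆ N := by
  obtain ⟨E, hE, hE'⟩ := exists_enumeration hV
  obtain ⟨F, hF, hF'⟩ := exists_enumeration hW
  let St := {S : Set V → Set W → Prop // IsMatching R A B S}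
  -- One full round: cut the left cells by `E n` using `forth`, then the right cells by `F n` using
  -- `back`.
  have step : ∀ (S : St) (n : ℕ), ∃ T : St, Refines T.1 S.1 ∧ Decides T.1 (E n) ∧
      Decides (flip T.1) (F n) := by
    rintro ⟨S, hS⟩ n
    obtain ⟨T, hT, hTS, hTE⟩ := hS.exists_refinement (E n) (fun C D hCD => by
      obtain ⟨F', h1, h2, h3⟩ := forth C D hCD (C ∩ E n) ((hR C D hCD).1.inter (hE n))
        inter_subset_left
      exact ⟨F', h1, h2, by rwa [sdiff_self_inter] at h3⟩)
    obtain ⟨U, hU, hUT, hUF⟩ := hT.flip.exists_refinement (F n) (fun D C hCD => by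
      obtain ⟨E', h1, h2, h3⟩ := back C D hCD (D ∩ F n) ((hR C D hCD).2.inter (hF n))
        inter_subset_left
      exact ⟨E', h1, h2, by rwa [sdiff_self_inter] at h3⟩)
    have hUT' : Refines (flip U) T := hUT.flip
    exact ⟨⟨flip U, hU.flip⟩, hUT'.trans hTS, hUT'.decides hTE, hUF⟩
  choose next hnext hnextE hnextF using step
  have h0 : IsMatching R A B (fun C D => C = A ∧ D = B) := by
    constructor
    · rintro C D ⟨rfl, rfl⟩; exact hAB
    · rintro C D ⟨rfl, rfl⟩; exact Subset.rfl
    · rintro C D ⟨rfl, rfl⟩; exact Subset.rfl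
    · exact fun x hx => ⟨A, B, ⟨rfl, rfl⟩, hx⟩
    · exact fun x hx => ⟨A, B, ⟨rfl, rfl⟩, hx⟩
    · rintro C D C' D' x ⟨rfl, rfl⟩ ⟨rfl, rfl⟩ - -; exact ⟨rfl, rfl⟩
    · rintro C D C' D' x ⟨rfl, rfl⟩ ⟨rfl, rfl⟩ - -; exact ⟨rfl, rfl⟩
  let Q : ℕ → St := fun n => Nat.rec ⟨_, h0⟩ (fun n S => next S n) n
  have hQ : ∀ n, IsMatching R A B (Q n).1 := fun n => (Q n).2
  have hmono : ∀ m n, m ≤ n → Refines (Q n).1 (Q m).1 := by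
    intro m n hmn
    induction hmn with
    | refl => exact Refines.refl _
    | step _ ih => exact (hnext _ _).trans ih
  have hQE : ∀ n, Decides (Q (n + 1)).1 (E n) := fun n => hnextE (Q n) n
  have hQF : ∀ n, Decides (flip (Q (n + 1)).1) (F n) := fun n => hnextF (Q n) n
  have smallE : ∀ x : V, ∀ M ∈ 𝓝 x, ∃ n, x ∈ E n ∧ E n ⊆ M := by
    intro x M hM
    obtain ⟨C, hC, hxC, hCM⟩ := bV x M hM
    obtain ⟨n, rfl⟩ := hE' C hC
    exact ⟨n, hxC, hCM⟩
  have smallF : ∀ y : W, ∀ M ∈ 𝓝 y, ∃ n, y ∈ F n ∧ F n ⊆ M := by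
    intro x M hM
    obtain ⟨C, hC, hxC, hCM⟩ := bW x M hM
    obtain ⟨n, rfl⟩ := hF' C hC
    exact ⟨n, hxC, hCM⟩
  have toR : ∀ x : A, ∃ y ∈ B, (∀ n, Linked (Q n).1 x y) ∧
      ∀ z ∈ B, (∀ n, Linked (Q n).1 x z) → z = y := fun x =>
    exists_unique_linked hQ hmono (fun C D h => ⟨(hR C D h).2.1, (hne C D h).1⟩)
      (fun y _ z _ hyz => by
        obtain ⟨n, hy, hn⟩ := smallF y {z}ᶜ (isOpen_compl_singleton.mem_nhds hyz)
        exact ⟨n + 1, F n, hy, fun h => hn h rfl, hQF n⟩) x.2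
  have toL : ∀ y : B, ∃ x ∈ A, (∀ n, Linked (flip (Q n).1) y x) ∧
      ∀ z ∈ A, (∀ n, Linked (flip (Q n).1) y z) → z = x := fun y =>
    exists_unique_linked (fun n => (hQ n).flip) (fun m n h => (hmono m n h).flip)
      (fun C D h => ⟨(hR D C h).1.1, (hne D C h).2⟩)
      (fun y _ z _ hyz => by
        obtain ⟨n, hy, hn⟩ := smallE y {z}ᶜ (isOpen_compl_singleton.mem_nhds hyz)
        exact ⟨n + 1, E n, hy, fun h => hn h rfl, hQE n⟩) y.2
  choose f hfB hfl hfu using toR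
  choose g hgA hgl hgu using toL
  -- At a late stage the matched cells of `x` and `f x` lie in `M` and `N`, and `f` and `g` respect
  -- these cells. This gives continuity in both directions as well as the final clause.
  have key : ∀ (x : A) (M : Set V) (N : Set W), M ∈ 𝓝 (x : V) → N ∈ 𝓝 (f x) →
      ∃ C D, R C D ∧ ↑x ∈ C ∧ C ⊆ M ∧ f x ∈ D ∧ D ⊆ N ∧ (∀ x' : A, ↑x' ∈ C → f x' ∈ D) ∧
        ∀ y : B, ↑y ∈ D → g y ∈ C := by
    intro x M N hM hN
    obtain ⟨m, hxm, hmM⟩ := smallE x M hM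
    obtain ⟨n, hyn, hnN⟩ := smallF (f x) N hN
    -- `E m` and `F n` are decided only from stages `m + 1` and `n + 1` on.
    obtain ⟨k, hmk, hnk⟩ : ∃ k, m + 1 ≤ k ∧ n + 1 ≤ k := ⟨max m n + 1, by omega, by omega⟩
    have hdE : Decides (Q k).1 (E m) :=
      (hmono (m + 1) k hmk).decides (hQE m)
    have hdF : Decides (flip (Q k).1) (F n) :=
      (hmono (n + 1) k hnk).flip.decides (hQF n)
    obtain ⟨C, D, hCD, hxC, hyD⟩ := hfl x k
    refine ⟨C, D, (hQ k).rel _ _ hCD, hxC, ?_, hyD, ?_, ?_, ?_⟩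
    · exact ((hdE C D hCD).resolve_right fun h => disjoint_left.1 h hxC hxm).trans hmM
    · exact ((hdF D C hCD).resolve_right fun h => disjoint_left.1 h hyD hyn).trans hnN
    · intro x' hx'
      obtain ⟨C', D', hCD', hxC', hyD'⟩ := hfl x' k
      obtain ⟨-, rfl⟩ := (hQ k).unique_left _ _ _ _ _ hCD hCD' hx' hxC'
      exact hyD'
    · intro y hy
      obtain ⟨D', C', hCD', hyD', hxC'⟩ := hgl y k
      obtain ⟨rfl, -⟩ := (hQ k).unique_right _ _ _ _ _ hCD hCD' hy hyD'
      exact hxC'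
  have hgf : ∀ x : A, g ⟨f x, hfB x⟩ = x := fun x =>
    (hgu ⟨f x, hfB x⟩ x x.2 fun n => linked_flip.2 (hfl x n)).symm
  have hfg : ∀ y : B, f ⟨g y, hgA y⟩ = y := fun y =>
    (hfu ⟨g y, hgA y⟩ y y.2 fun n => linked_flip.1 (hgl y n)).symm
  refine ⟨{ toFun := fun x => ⟨f x, hfB x⟩, invFun := fun y => ⟨g y, hgA y⟩,
            left_inv := fun x => Subtype.ext (hgf x), right_inv := fun y => Subtype.ext (hfg y),
            continuous_toFun := ?_, continuous_invFun := ?_ }, ?_⟩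
  · refine Continuous.subtype_mk (continuous_iff_continuousAt.2 fun x => ?_) _
    rw [ContinuousAt, Filter.tendsto_def]
    intro N hN
    obtain ⟨C, D, hCD, hxC, -, -, hDN, hC, -⟩ := key x univ N Filter.univ_mem hN
    filter_upwards [continuous_subtype_val.continuousAt.preimage_mem_nhds
      ((hR C D hCD).1.mem_nhds hxC)] with x' hx'
    exact hDN (hC x' hx')
  · refine Continuous.subtype_mk (continuous_iff_continuousAt.2 fun y => ?_) _
    rw [ContinuousAt, Filter.tendsto_def]
    intro M hM
    obtain ⟨C, D, hCD, -, hCM, hyD, -, -, hD⟩ := key ⟨g y, hgA y⟩ M univ hM Filter.univ_mem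
    rw [hfg] at hyD
    filter_upwards [continuous_subtype_val.continuousAt.preimage_mem_nhds
      ((hR C D hCD).2.mem_nhds hyD)] with y' hy'
    exact hCM (hD y' hy')
  · intro x M hM N hN
    obtain ⟨C, D, hCD, hxC, hCM, hyD, hDN, -⟩ := key x M N hM hN
    exact ⟨C, D, hCD, hxC, hCM, hyD, hDN⟩

end BackAndForth

/-! ### Trim decompositions and trim-equivalent sets -/

section Decomposition

variable {W : Type u} [TopologicalSpace W] [T2Space W]

/-- Local inclusions in members of a family of sets come from a partition into compact open
subsets of the members of the family. -/
theorem IsCompactOpen.exists_partition {K : Set W} (hK : IsCompactOpen K) {ι : Type*}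
    (G : ι → Set W) (hG : ∀ x ∈ K, ∃ i D, IsCompactOpen D ∧ x ∈ D ∧ D ∩ K ⊆ G i) :
    ∃ E : ι → Set W, (∀ i, IsCompactOpen (E i)) ∧ (∀ i j, i ≠ j → Disjoint (E i) (E j)) ∧
      ⋃ i, E i = K ∧ ∀ i, E i ⊆ G i := by
  classical
  choose i D hD hxD hDG using fun x : K => hG x x.2
  obtain ⟨t, ht⟩ := hK.1.elim_nhds_subcover' (fun x hx => D ⟨x, hx⟩)
    (fun x hx => (hD ⟨x, hx⟩).mem_nhds (hxD ⟨x, hx⟩))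
  -- Induction on the subcover with the covered set `L` varying: `D a` is removed from `L`, and `L ∩
  -- D a` is afterwards added to the piece with index `i a`.
  have main : ∀ (t : Finset K) (L : Set W), IsCompactOpen L → L ⊆ K → (L ⊆ ⋃ x ∈ t, D x) →
      ∃ E : ι → Set W, (∀ i, IsCompactOpen (E i)) ∧ (∀ i j, i ≠ j → Disjoint (E i) (E j)) ∧
        ⋃ i, E i = L ∧ ∀ i, E i ⊆ G i := by
    intro t
    induction t using Finset.induction_on with
    | empty =>
      intro L _ _ hL
      refine ⟨fun _ => ∅, fun _ => IsCompactOpen.empty, by simp, ?_, by simp⟩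
      simpa using (subset_empty_iff.1 (by simpa using hL)).symm
    | insert a t _ ih =>
      intro L hL hLK hLt
      obtain ⟨E, hE, hd, hu, hEG⟩ := ih (L \ D a) (hL.diff (hD a)) (sdiff_subset.trans hLK) (by
        rintro x ⟨hx, hxa⟩
        have := hLt hx
        rw [Finset.set_biUnion_insert] at this
        exact this.resolve_left hxa)
      have hEL : ∀ j, E j ⊆ L \ D a := fun j => hu ▸ subset_iUnion E j
      refine ⟨fun j => E j ∪ if j = i a then L ∩ D a else ∅, fun j => ?_, fun j k hjk => ?_, ?_,
        fun j => ?_⟩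
      · refine (hE j).union ?_
        split_ifs
        exacts [hL.inter (hD a), IsCompactOpen.empty]
      · rw [Set.disjoint_left]
        rintro x (hx | hx) (hx' | hx')
        · exact disjoint_left.1 (hd j k hjk) hx hx'
        · split_ifs at hx'
          · exact (hEL j hx).2 hx'.2
          · exact hx'
        · split_ifs at hx
          · exact (hEL k hx').2 hx.2
          · exact hx
        · split_ifs at hx hx' with h1 h2
          · exact hjk (h1.trans h2.symm)
          all_goals first | exact hx | exact hx'
      · ext x
        simp only [mem_iUnion, mem_union]
        constructor
        · rintro ⟨j, hx | hx⟩
          · exact (hEL j hx).1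
          · split_ifs at hx
            · exact hx.1
            · exact hx.elim
        · intro hx
          by_cases hxa : x ∈ D a
          · exact ⟨i a, Or.inr (by rw [if_pos rfl]; exact ⟨hx, hxa⟩)⟩
          · have : x ∈ ⋃ i, E i := hu ▸ ⟨hx, hxa⟩
            obtain ⟨j, hj⟩ := mem_iUnion.1 this
            exact ⟨j, Or.inl hj⟩
      · refine union_subset (hEG j) ?_
        split_ifs with h
        · rintro x ⟨hx, hxa⟩
          exact h ▸ hDG a ⟨hxa, hLK hx⟩
        · exact empty_subset _
  exact main t K hK Subset.rfl ht

variable {P : Type v} [POSystem P] {X : P → Set W}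

theorem TrimBase.typeOf_nonempty (h : TrimBase X) {A : Set W} (hA : IsOpen A) {x : W}
    (hx : x ∈ A) : (typeOf X A).Nonempty := by
  obtain ⟨p, B, hB, -, hBA⟩ := h x A (hA.mem_nhds hx)
  obtain ⟨y, hy, hyp⟩ := hB.nonempty
  exact ⟨p, y, hBA hy, hyp⟩

/-- A finite family of points, such that a compact open set decomposes as a disjoint union of trim
neighbourhoods of these points. -/
theorem IsCleanPartition.exists_decomposition (h : IsCleanPartition X) {B : Set W}
    (hB : IsCompactOpen B) {ι : Type*} [Finite ι] (s : ι → W) (hs : Function.Injective s)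
    (p : ι → P) (hsB : ∀ i, s i ∈ B) (hsp : ∀ i, s i ∈ X (p i))
    (hle : ∀ r ∈ typeOf X B, ∃ i, p i ∈ minimals (typeOf X B) ∧ Le (p i) r)
    (hmin : ∀ r ∈ minimals (typeOf X B), r ∈ discretePart P → B ∩ X r ⊆ range s) :
    ∃ C : ι → Set W, (∀ i, IsTrimSet X (p i) (C i)) ∧ (∀ i, s i ∈ C i) ∧
      (∀ i j, i ≠ j → Disjoint (C i) (C j)) ∧ ⋃ i, C i = B := by
  obtain ⟨U, hU, hUd⟩ := (Set.finite_range s).t2_separation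
  choose N hN hsN hNU using fun i => h.exists_trimSet (hsp i)
    (((hU (s i)).2.inter hB.2).mem_nhds ⟨(hU (s i)).1, hsB i⟩)
  have hNd : ∀ i j, i ≠ j → Disjoint (N i) (N j) := fun i j hij =>
    (hUd (mem_range_self i) (mem_range_self j) (hs.ne hij)).mono
      ((hNU i).trans inter_subset_left) ((hNU j).trans inter_subset_left)
  have hNB : ∀ i, N i ⊆ B := fun i => (hNU i).trans inter_subset_right
  have hK : IsCompactOpen (B \ ⋃ i, N i) :=
    hB.diff (IsCompactOpen.iUnion fun i => (hN i).isCompactOpen)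
  -- The remainder of `B` is distributed among the neighbourhoods `N i`. A piece may join `N i` if
  -- its labels are all above `p i` and, for discrete `p i`, it brings no second point labelled `p
  -- i`; the latter is automatic for minimal `p i`, as all such points of `B` are among the `s j`.
  obtain ⟨E, hE, hEd, hEu, hEG⟩ := hK.exists_partition
    (fun i => {y | ∀ r, y ∈ X r → Le (p i) r ∧ (p i ∈ discretePart P → y ∉ X (p i))}) (by
      intro x hx
      obtain ⟨r, D, hD, hxD, hDK⟩ := h.base x _ (hK.mem_nhds hx)
      obtain ⟨z, hzD, hzr⟩ := hD.nonempty
      obtain ⟨i, him, hir⟩ := hle r ⟨z, (hDK hzD).1, hzr⟩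
      refine ⟨i, D, hD.isCompactOpen, hxD, ?_⟩
      rintro y ⟨hyD, hyK⟩ q hyq
      refine ⟨hir.trans (hD.le hyD hyq), fun hd hyp => ?_⟩
      obtain ⟨j, rfl⟩ := hmin _ him hd ⟨hyK.1, hyp⟩
      exact hyK.2 (mem_iUnion.2 ⟨j, hsN j⟩))
  have hEK : ∀ i, E i ⊆ B \ ⋃ i, N i := fun i => hEu ▸ subset_iUnion E i
  have hEN : ∀ i j, Disjoint (E i) (N j) := fun i j =>
    disjoint_left.2 fun x hx hx' => (hEK i hx).2 (mem_iUnion.2 ⟨j, hx'⟩)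
  refine ⟨fun i => N i ∪ E i, fun i => ?_, fun i => Or.inl (hsN i), fun i j hij => ?_, ?_⟩
  · refine isTrimSet_of ((hN i).isCompactOpen.union (hE i)) ?_ ?_
    · rw [typeOf_union, (hN i).typeOf_eq, union_eq_left]
      rintro r ⟨y, hy, hyr⟩
      exact (hEG i hy r hyr).1
    · rintro hd x (hx | hx) hxp y (hy | hy) hyp
      · exact (hN i).eq_of_mem hd hx hxp hy hyp
      · exact absurd hyp ((hEG i hy _ hyp).2 hd)
      · exact absurd hxp ((hEG i hx _ hxp).2 hd)
      · exact absurd hyp ((hEG i hy _ hyp).2 hd)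
  · exact disjoint_union_left.2 ⟨disjoint_union_right.2 ⟨hNd i j hij, (hEN j i).symm⟩,
      disjoint_union_right.2 ⟨hEN i j, hEd i j hij⟩⟩
  · rw [iUnion_union_distrib, hEu, union_sdiff_self]
    exact union_eq_right.2 (iUnion_subset hNB)

/-- A finite set of points which generates the type of `A`, and which contains all the points of
`A` with minimal discrete labels. -/
structure IsFrame (X : P → Set W) (A S : Set W) : Prop where
  finite : S.Finite
  subset : S ⊆ A
  labelled : ∀ x ∈ S, ∃ p, x ∈ X p
  below : ∀ r ∈ typeOf X A, ∃ x ∈ S, ∃ p ∈ minimals (typeOf X A), x ∈ X p ∧ Le p r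
  minimal : ∀ r ∈ minimals (typeOf X A), r ∈ discretePart P → A ∩ X r ⊆ S

/-- Choose one point of the defining label in each member of a finite trim cover. Every label of `A`
is above one of the chosen labels, and a point with a minimal discrete label is the only such point
of the trim set covering it, hence was chosen. -/
theorem IsCleanPartition.exists_frame (h : IsCleanPartition X) {A : Set W}
    (hA : IsCompactOpen A) : ∃ S, IsFrame X A S := by
  obtain ⟨n, p, C, hC, hCA, -, hcov⟩ := h.base.exists_finite_cover hA.1 hA.2 Subset.rfl
  choose s hs using fun i => (hC i).nonempty
  have hlow : ∀ r ∈ typeOf X A, ∃ i, Le (p i) r := by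
    rintro r ⟨x, hx, hxr⟩
    obtain ⟨i, hi⟩ := mem_iUnion.1 (hcov hx)
    exact ⟨i, (hC i).le hi hxr⟩
  refine ⟨range s, finite_range s, range_subset_iff.2 fun i => hCA i (hs i).1, ?_, ?_, ?_⟩
  · rintro _ ⟨i, rfl⟩
    exact ⟨p i, (hs i).2⟩
  · intro r hr
    obtain ⟨i, hi⟩ := hlow r hr
    obtain ⟨j, hji, hj⟩ := exists_minimal_le p i
    refine ⟨s j, mem_range_self j, p j, ⟨⟨s j, hCA j (hs j).1, (hs j).2⟩, fun q hq hqj => ?_⟩,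
      (hs j).2, hji.trans hi⟩
    obtain ⟨k, hk⟩ := hlow q hq
    exact hqj.antisymm (hj k (hk.trans hqj) ▸ hk)
  · rintro r ⟨-, hr⟩ hd y ⟨hy, hyr⟩
    obtain ⟨k, hk⟩ := mem_iUnion.1 (hcov hy)
    have hkr : p k = r := hr _ ⟨s k, hCA k (hs k).1, (hs k).2⟩ ((hC k).le hk hyr)
    subst hkr
    exact ⟨k, (hC k).eq_of_mem hd (hs k).1 (hs k).2 hk hyr⟩

/-- A minimal label of `A` can cease to be minimal in the union only because of a smaller label of
`B`; a minimal label of `B` below that one is then minimal in the union. -/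
theorem IsFrame.exists_minimal_of_left {A B S T : Set W} (hA : IsFrame X A S)
    (hB : IsFrame X B T) {r : P} (hr : r ∈ typeOf X A) :
    ∃ x ∈ S ∪ T, ∃ p ∈ minimals (typeOf X (A ∪ B)), x ∈ X p ∧ Le p r := by
  obtain ⟨x, hxS, p, hp, hxp, hpr⟩ := hA.below r hr
  by_cases hm : p ∈ minimals (typeOf X (A ∪ B))
  · exact ⟨x, Or.inl hxS, p, hm, hxp, hpr⟩
  obtain ⟨q, hq, hqp, hne⟩ : ∃ q ∈ typeOf X (A ∪ B), Le q p ∧ q ≠ p := by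
    by_contra! hcon
    exact hm ⟨typeOf_mono subset_union_left hp.1, hcon⟩
  rw [typeOf_union] at hq ⊢
  have hqB : q ∈ typeOf X B := hq.resolve_left fun hqA => hne (hp.2 q hqA hqp)
  obtain ⟨y, hyT, m, hmB, hym, hmq⟩ := hB.below q hqB
  refine ⟨y, Or.inr hyT, m, ⟨Or.inr hmB.1, ?_⟩, hym, (hmq.trans hqp).trans hpr⟩
  rintro k (hk | hk) hkm
  -- A label `k` of `A` below `m` is below `p`, so it equals `p`; this squeezes `q` between `p` and
  -- itself.
  · have := hp.2 k hk ((hkm.trans hmq).trans hqp)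
    subst this
    exact absurd (hqp.antisymm (hkm.trans hmq)) hne
  · exact hmB.2 k hk hkm

theorem IsFrame.union {A B S T : Set W} (hA : IsFrame X A S) (hB : IsFrame X B T) :
    IsFrame X (A ∪ B) (S ∪ T) where
  finite := hA.finite.union hB.finite
  subset := union_subset_union hA.subset hB.subset
  labelled x hx := hx.elim (hA.labelled x) (hB.labelled x)
  below r hr := by
    rw [typeOf_union] at hr
    rcases hr with hr | hr
    · exact hA.exists_minimal_of_left hB hr
    · rw [union_comm A, union_comm S]
      exact hB.exists_minimal_of_left hA hr
  minimal := by
    rintro r ⟨-, hr⟩ hd x ⟨hx | hx, hxr⟩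
    · exact Or.inl (hA.minimal r ⟨⟨x, hx, hxr⟩, fun q hq =>
        hr q (typeOf_mono subset_union_left hq)⟩ hd ⟨hx, hxr⟩)
    · exact Or.inr (hB.minimal r ⟨⟨x, hx, hxr⟩, fun q hq =>
        hr q (typeOf_mono subset_union_right hq)⟩ hd ⟨hx, hxr⟩)

end Decomposition

section TrimEquiv

variable {V : Type u} {W : Type w} [TopologicalSpace V] [TopologicalSpace W]
  {P : Type v} [POSystem P] {X : P → Set V} {Y : P → Set W}

/-- Compact open sets of the same type, with equally many points for each minimal discrete
label. -/
structure TrimEquiv (X : P → Set V) (Y : P → Set W) (A : Set V) (B : Set W) : Prop where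
  left : IsCompactOpen A
  right : IsCompactOpen B
  typeOf_eq : typeOf X A = typeOf Y B
  encard_eq : ∀ p ∈ minimals (typeOf X A), p ∈ discretePart P →
    (A ∩ X p).encard = (B ∩ Y p).encard

theorem TrimEquiv.symm {A : Set V} {B : Set W} (h : TrimEquiv X Y A B) : TrimEquiv Y X B A :=
  ⟨h.right, h.left, h.typeOf_eq.symm, fun p hp hd =>
    (h.encard_eq p (h.typeOf_eq ▸ hp) hd).symm⟩

theorem IsTrimSet.trimEquiv {A : Set V} {B : Set W} {p : P} (hA : IsTrimSet X p A)
    (hB : IsTrimSet Y p B) : TrimEquiv X Y A B := by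
  refine ⟨hA.isCompactOpen, hB.isCompactOpen, hA.typeOf_eq.trans hB.typeOf_eq.symm, ?_⟩
  rintro q hq hd
  rw [hA.typeOf_eq] at hq
  obtain rfl : p = q := hq.2 p (mem_up_self p) hq.1
  rw [hA.2.2.2 hd, hB.2.2.2 hd]

/-- Trimness is determined by the data that the relation records; this is why the homeomorphisms
built from it preserve labels. -/
theorem TrimEquiv.isTrimSet {A : Set V} {B : Set W} {p : P} (h : TrimEquiv X Y A B)
    (hA : IsTrimSet X p A) : IsTrimSet Y p B := by
  refine ⟨h.right.1, h.right.2, h.typeOf_eq.symm.trans hA.typeOf_eq, fun hd => ?_⟩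
  rw [← h.encard_eq p (hA.typeOf_eq ▸ mem_minimals_up p) hd, hA.2.2.2 hd]

variable [T2Space V] [T2Space W]

/-- A frame carries all the data of a trim-equivalence class: its labels generate the type, and the
points with a given minimal discrete label are exactly the frame points so labelled, one for each
trim set `D i`. -/
theorem IsFrame.trimEquiv_iUnion (hX : IsPPartition X) {A S : Set V}
    (hA : IsCompactOpen A) (hS : IsFrame X A S) {ι : Type*} [Finite ι] (s : ι → V)
    (hs : Function.Injective s) (hsS : range s = S) (p : ι → P) (hsp : ∀ i, s i ∈ X (p i))
    (D : ι → Set W) (hD : ∀ i, IsTrimSet Y (p i) (D i))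
    (hdis : ∀ i j, i ≠ j → Disjoint (D i) (D j)) : TrimEquiv X Y A (⋃ i, D i) := by
  have hlow : ∀ r, r ∈ typeOf X A ↔ ∃ i, Le (p i) r := by
    intro r
    constructor
    · intro hr
      obtain ⟨x, hx, q, -, hxq, hqr⟩ := hS.below r hr
      rw [← hsS] at hx
      obtain ⟨i, rfl⟩ := hx
      exact ⟨i, hX.eq_of_mem (hsp i) hxq ▸ hqr⟩
    · rintro ⟨i, hi⟩
      exact hX.mem_typeOf_of_le hA.2
        ⟨s i, hS.subset (hsS ▸ mem_range_self i), hsp i⟩ hi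
  refine ⟨hA, IsCompactOpen.iUnion fun i => (hD i).isCompactOpen, ?_, ?_⟩
  · ext r
    rw [hlow]
    constructor
    · rintro ⟨i, hi⟩
      have : r ∈ typeOf Y (D i) := (hD i).typeOf_eq ▸ hi
      exact typeOf_mono (subset_iUnion D i) this
    · rintro ⟨y, hy, hyr⟩
      obtain ⟨i, hi⟩ := mem_iUnion.1 hy
      exact ⟨i, (hD i).le hi hyr⟩
  · intro r hr hd
    choose t ht htp using fun i => (hD i).nonempty
    have htinj : Function.Injective t := by
      intro i j hij
      by_contra hne
      exact disjoint_left.1 (hdis i j hne) (ht i) (hij ▸ ht j)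
    have h1 : A ∩ X r = s '' {i | p i = r} := by
      ext x
      constructor
      · intro hx
        have hxS := hS.minimal r hr hd hx
        rw [← hsS] at hxS
        obtain ⟨i, rfl⟩ := hxS
        exact ⟨i, hX.eq_of_mem (hsp i) hx.2, rfl⟩
      · rintro ⟨i, rfl, rfl⟩
        exact ⟨hS.subset (hsS ▸ mem_range_self i), hsp i⟩
    have h2 : (⋃ i, D i) ∩ Y r = t '' {i | p i = r} := by
      ext y
      constructor
      · rintro ⟨hy, hyr⟩
        obtain ⟨i, hi⟩ := mem_iUnion.1 hy
        have hir : p i = r := hr.2 _ ((hlow _).2 ⟨i, Le.refl _⟩) ((hD i).le hi hyr)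
        refine ⟨i, hir, ?_⟩
        subst hir
        exact (hD i).eq_of_mem hd (ht i) (htp i) hi hyr
      · rintro ⟨i, rfl, rfl⟩
        exact ⟨mem_iUnion.2 ⟨i, ht i⟩, htp i⟩
    rw [h1, h2, hs.encard_image, htinj.encard_image]

/-- For minimal discrete `p` the counts in `A` and `B` agree. Any other label of `A` has some `q <
p` in the type (with `q = p` if `p` is minimal but not discrete), and then `B` contains infinitely
many points labelled `p`. -/
theorem TrimEquiv.encard_le (hY : IsPPartition Y) {A S : Set V} {B : Set W}
    (h : TrimEquiv X Y A B) (hSA : S ⊆ A) (p : P) :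
    (S ∩ X p).encard ≤ (B ∩ Y p).encard := by
  rcases (S ∩ X p).eq_empty_or_nonempty with he | ⟨x, hx⟩
  · rw [he, encard_empty]
    exact zero_le
  have hpA : p ∈ typeOf X A := ⟨x, hSA hx.1, hx.2⟩
  by_cases hp : p ∈ minimals (typeOf X A) ∧ p ∈ discretePart P
  · rw [← h.encard_eq p hp.1 hp.2]
    exact encard_le_encard (inter_subset_inter_left _ hSA)
  · obtain ⟨q, hq, hqp⟩ : ∃ q ∈ typeOf X A, q < p := by
      by_contra! hcon
      exact hp ⟨⟨hpA, fun q hq hle => hle.resolve_left (hcon q hq)⟩, hcon p hpA⟩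
    rw [h.typeOf_eq] at hq
    obtain ⟨y, hy, hyq⟩ := hq
    rw [(hY.infinite hyq hqp (h.right.mem_nhds hy)).encard_eq]
    exact le_top

/-- Frames of `C` and of `A \ C` together frame `A`. Their points are injected into `B` with labels
preserved, `B` is decomposed into trim neighbourhoods of the images, and `F` collects the
neighbourhoods that belong to the frame of `C`. -/
theorem TrimEquiv.forth (hX : IsCleanPartition X) (hY : IsCleanPartition Y) {A C : Set V}
    {B : Set W} (h : TrimEquiv X Y A B) (hC : IsCompactOpen C) (hCA : C ⊆ A) :
    ∃ F ⊆ B, TrimEquiv X Y C F ∧ TrimEquiv X Y (A \ C) (B \ F) := by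
  rcases C.eq_empty_or_nonempty with rfl | ⟨x₀, hx₀⟩
  · refine ⟨∅, empty_subset _, ⟨hC, IsCompactOpen.empty, ?_, ?_⟩, by simpa using h⟩
    · ext p
      simp [typeOf]
    · rintro p ⟨⟨x, hx, -⟩, -⟩
      exact hx.elim
  -- The injections chosen below are total functions from `V` to `W`, so a point of `W` is needed;
  -- this is why empty `C` is treated separately.
  have hWne : Nonempty W := by
    have h1 := hX.base.typeOf_nonempty h.left.2 (hCA hx₀)
    rw [h.typeOf_eq] at h1
    obtain ⟨p, y, -⟩ := h1
    exact ⟨y⟩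
  have hAC : IsCompactOpen (A \ C) := h.left.diff hC
  obtain ⟨S, hS⟩ := hX.exists_frame hC
  obtain ⟨T, hT⟩ := hX.exists_frame hAC
  have hST : IsFrame X A (S ∪ T) := by
    have := hS.union hT
    rwa [union_sdiff_cancel hCA] at this
  choose f hfm hfi using fun p =>
    (hST.finite.inter_of_left (X p)).exists_injOn_of_encard_le
      (h.encard_le hY.isPPartition hST.subset p)
  choose p hp using fun x : ↥(S ∪ T) => hST.labelled x x.2
  have hfin : Finite ↥(S ∪ T) := hST.finite
  let φ : ↥(S ∪ T) → W := fun x => f (p x) x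
  have hφ : ∀ x, φ x ∈ B ∩ Y (p x) := fun x => hfm (p x) ⟨x.2, hp x⟩
  have hφi : Function.Injective φ := by
    intro x y hxy
    have hpxy : p x = p y := hY.isPPartition.eq_of_mem (hφ x).2 (hxy ▸ (hφ y).2)
    refine Subtype.ext (hfi (p x) ⟨x.2, hp x⟩ ⟨y.2, hpxy ▸ hp y⟩ ?_)
    have : f (p x) x = f (p y) y := hxy
    rw [this, hpxy]
  obtain ⟨D, hD, hφD, hDd, hDu⟩ := hY.exists_decomposition h.right φ hφi p (fun x => (hφ x).1)
    (fun x => (hφ x).2) (by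
      intro r hr
      rw [← h.typeOf_eq] at hr ⊢
      obtain ⟨x, hx, q, hq, hxq, hqr⟩ := hST.below r hr
      obtain rfl := hX.isPPartition.eq_of_mem (hp ⟨x, hx⟩) hxq
      exact ⟨⟨x, hx⟩, hq, hqr⟩) (by
      intro r hr hd
      rw [← h.typeOf_eq] at hr
      have hsub : A ∩ X r ⊆ S ∪ T := hST.minimal r hr hd
      -- For a minimal discrete label the two sets are finite of equal size, so the injection is
      -- onto and no such point of `B` is missed.
      have himg : f r '' (A ∩ X r) = B ∩ Y r := by
        have hST' : (S ∪ T) ∩ X r = A ∩ X r :=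
          Subset.antisymm (inter_subset_inter_left _ hST.subset)
            fun x hx => ⟨hsub hx, hx.2⟩
        have hfinA : (A ∩ X r).Finite := hST.finite.subset hsub
        refine Set.Finite.eq_of_subset_of_encard_le (hfinA.image _) ?_ ?_
        · rw [← hST', image_subset_iff]
          exact hfm r
        · rw [InjOn.encard_image (hST' ▸ hfi r), h.encard_eq r hr hd]
      rw [← himg]
      rintro _ ⟨x, hx, rfl⟩
      have hpr := hX.isPPartition.eq_of_mem (hp ⟨x, hsub hx⟩) hx.2
      exact ⟨⟨x, hsub hx⟩, congrArg (f · x) hpr⟩)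
  have hdis : ∀ x ∈ S, x ∉ T := fun x hx hx' => (hT.subset hx').2 (hS.subset hx)
  have hFc : B \ (⋃ x : S, D ⟨x, Or.inl x.2⟩) = ⋃ x : T, D ⟨x, Or.inr x.2⟩ := by
    ext y
    simp only [mem_sdiff, mem_iUnion, not_exists]
    constructor
    · rintro ⟨hy, hyS⟩
      rw [← hDu] at hy
      obtain ⟨⟨x, hx⟩, hyx⟩ := mem_iUnion.1 hy
      rcases hx with hx | hx
      · exact absurd hyx (hyS ⟨x, hx⟩)
      · exact ⟨⟨x, hx⟩, hyx⟩
    · rintro ⟨x, hyx⟩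
      refine ⟨hDu ▸ mem_iUnion.2 ⟨_, hyx⟩, fun z hz => ?_⟩
      refine disjoint_left.1 (hDd ⟨x, Or.inr x.2⟩ ⟨z, Or.inl z.2⟩ fun heq => ?_) hyx hz
      exact hdis z z.2 (congrArg Subtype.val heq ▸ x.2)
  have hfS : Finite S := hS.finite
  have hfT : Finite T := hT.finite
  refine ⟨⋃ x : S, D ⟨x, Or.inl x.2⟩, ?_, ?_, ?_⟩
  · rw [← hDu]
    exact iUnion_subset fun x => subset_iUnion D _
  · exact hS.trimEquiv_iUnion hX.isPPartition hC Subtype.val Subtype.val_injective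
      Subtype.range_val (fun x => p ⟨x, Or.inl x.2⟩) (fun x => hp _) _ (fun x => hD _)
      fun x y hxy => hDd _ _ fun heq => hxy (Subtype.ext (by injection heq))
  · rw [hFc]
    exact hT.trimEquiv_iUnion hX.isPPartition hAC Subtype.val Subtype.val_injective
      Subtype.range_val (fun x => p ⟨x, Or.inr x.2⟩) (fun x => hp _) _ (fun x => hD _)
      fun x y hxy => hDd _ _ fun heq => hxy (Subtype.ext (by injection heq))

/-- Trim-equivalent compact open sets are homeomorphic, with preservation of labels. -/
theorem TrimEquiv.exists_homeomorph
    (hV : {C : Set V | IsCompactOpen C}.Countable) (hW : {C : Set W | IsCompactOpen C}.Countable)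
    (hX : IsTrimPartition X) (hY : IsTrimPartition Y) {A : Set V} {B : Set W}
    (hAB : TrimEquiv X Y A B) :
    ∃ h : A ≃ₜ B, ∀ (x : A) (p : P), ↑x ∈ X p ↔ ↑(h x) ∈ Y p := by
  obtain ⟨h, hh⟩ := exists_homeomorph_of_backAndForth hV hW
    (fun x U hU => hX.base.exists_compactOpen hU) (fun x U hU => hY.base.exists_compactOpen hU)
    (TrimEquiv X Y) (fun C D h => ⟨h.left, h.right⟩)
    (fun C D h => by
      constructor
      · rintro ⟨x, hx⟩
        obtain ⟨p, hp⟩ := hX.base.typeOf_nonempty h.left.2 hx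
        rw [h.typeOf_eq] at hp
        exact hp.mono inter_subset_left
      · rintro ⟨x, hx⟩
        obtain ⟨p, hp⟩ := hY.base.typeOf_nonempty h.right.2 hx
        rw [← h.typeOf_eq] at hp
        exact hp.mono inter_subset_left)
    (fun C D h E hE hEC => h.forth hX.isClean hY.isClean hE hEC)
    (fun C D h F hF hFD => by
      obtain ⟨E, hE, h1, h2⟩ := h.symm.forth hY.isClean hX.isClean hF hFD
      exact ⟨E, hE, h1.symm, h2.symm⟩) hAB
  refine ⟨h, fun x p => ⟨fun hxp => ?_, fun hxp => ?_⟩⟩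
  · obtain ⟨C, hC, hxC⟩ := hX.clean p x hxp
    -- Small matched sets around `x` inside a `p`-trim set are `p`-trim, so their partners are too;
    -- T2 then gives `h x` the label `p`.
    have key : ∀ U ∈ 𝓝 (h x : W), ∃ D, IsTrimSet Y p D ∧ ↑(h x) ∈ D ∧ D ⊆ U := by
      intro U hU
      obtain ⟨C', D, hCD, hx, hCC, hhx, hDU⟩ := hh x C (hC.isCompactOpen.mem_nhds hxC) U hU
      exact ⟨D, hCD.isTrimSet (hX.isPPartition.isTrimSet_of_subset hC hCD.left hCC hx hxp),
        hhx, hDU⟩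
    obtain ⟨D, hD, -⟩ := key univ Filter.univ_mem
    exact hY.full p ⟨D, hD⟩ _ key
  · obtain ⟨D, hD, hxD⟩ := hY.clean p _ hxp
    have key : ∀ U ∈ 𝓝 (x : V), ∃ C, IsTrimSet X p C ∧ ↑x ∈ C ∧ C ⊆ U := by
      intro U hU
      obtain ⟨C, D', hCD, hx, hCU, hhx, hDD⟩ := hh x U hU D (hD.isCompactOpen.mem_nhds hxD)
      exact ⟨C, hCD.symm.isTrimSet
        (hY.isPPartition.isTrimSet_of_subset hD hCD.right hDD hhx hxp), hx, hCU⟩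
    obtain ⟨C, hC, -⟩ := key univ Filter.univ_mem
    exact hX.full p ⟨C, hC⟩ _ key

end TrimEquiv

/-! ### One-point compactifications and the uniqueness of bounded trim partitions -/

section OnePointPartition

open OnePoint

variable {P : Type v} [POSystem P]

/-- The labels `P` together with a label of the point at infinity. -/
inductive WithInfinity (E : ExtPOSystem P) : Type v
  | infty : WithInfinity E
  | label : P → WithInfinity E

namespace WithInfinity

/-- The order on `WithInfinity E`: the new label lies below the labels outside `L`. -/
def Lt {E : ExtPOSystem P} : WithInfinity E → WithInfinity E → Prop
  | _, infty => False
  | infty, label p => p ∉ E.L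
  | label p, label q => p < q

instance (E : ExtPOSystem P) : POSystem (WithInfinity E) where
  lt := Lt
  antisymm_lt := by
    rintro (_ | p) (_ | q) h k
    · rfl
    · exact k.elim
    · exact h.elim
    · exact congrArg label (antisymm_lt p q h k)
  trans_lt := by
    rintro (_ | p) (_ | q) (_ | r) h k
    · exact k
    · exact h.elim
    · exact k
    · exact fun hr => h (E.isLower r hr q (Or.inl k))
    · exact k
    · exact h.elim
    · exact k
    · exact trans_lt p q r h k

variable {E : ExtPOSystem P}

theorem not_lt_infty {p : WithInfinity E} : ¬ p < infty := by
  rcases p with _ | p <;> exact fun h => h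

theorem infty_lt {p : P} : (infty : WithInfinity E) < label p ↔ p ∉ E.L := Iff.rfl

theorem label_lt {p q : P} : (label p : WithInfinity E) < label q ↔ p < q := Iff.rfl

theorem label_le {p q : P} : Le (label p : WithInfinity E) (label q) ↔ Le p q :=
  or_congr Iff.rfl (by rw [label.injEq])

theorem not_label_le_infty {p : P} : ¬ Le (label p : WithInfinity E) infty := by
  rintro (h | h)
  · exact h
  · exact nomatch h

end WithInfinity

variable {W : Type u} {E : ExtPOSystem P} {X : P → Set W}

/-- The partition of the one-point compactification, where the point at infinity is an additional
element of the partition. -/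
def onePointPart (E : ExtPOSystem P) (X : P → Set W) : WithInfinity E → Set (OnePoint W) :=
  fun
  | .infty => {∞}
  | .label p => (↑) '' X p

theorem coe_mem_onePointPart {x : W} {p : P} :
    (x : OnePoint W) ∈ onePointPart E X (.label p) ↔ x ∈ X p :=
  coe_injective.mem_set_image

theorem mem_onePointPart_infty {x : OnePoint W} :
    x ∈ onePointPart E X .infty ↔ x = ∞ := Iff.rfl

theorem onePointPart_label (p : P) :
    onePointPart E X (.label p) = ((↑) '' X p : Set (OnePoint W)) := rfl

variable [TopologicalSpace W]

theorem coe_mem_derivedSet_image {S : Set W} {x : W} :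
    (x : OnePoint W) ∈ derivedSet ((↑) '' S : Set (OnePoint W)) ↔ x ∈ derivedSet S := by
  rw [mem_derivedSet, mem_derivedSet, accPt_iff_nhds, accPt_iff_nhds]
  constructor
  · intro h U hU
    obtain ⟨_, ⟨⟨y, hy, rfl⟩, hyS⟩, hne⟩ := h ((↑) '' U)
      (by rw [nhds_coe_eq]; exact Filter.image_mem_map hU)
    exact ⟨y, ⟨hy, coe_injective.mem_set_image.1 hyS⟩, fun h => hne (congrArg _ h)⟩
  · intro h U hU
    rw [nhds_coe_eq, Filter.mem_map] at hU
    obtain ⟨y, ⟨hy, hyS⟩, hne⟩ := h _ hU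
    exact ⟨y, ⟨hy, mem_image_of_mem _ hyS⟩, fun h => hne (coe_injective h)⟩

/-- Basic neighbourhoods of `∞` are complements of closed compact sets. This is the reason for
placing the label at infinity below exactly the labels outside `L`. -/
theorem infty_mem_derivedSet_image {S : Set W} [R1Space W] :
    ∞ ∈ derivedSet ((↑) '' S : Set (OnePoint W)) ↔ ¬ IsCompact (closure S) := by
  rw [mem_derivedSet, accPt_iff_nhds]
  constructor
  · intro h hc
    obtain ⟨_, ⟨hy, ⟨y, hyS, rfl⟩⟩, -⟩ := h ((↑) '' (closure S)ᶜ ∪ {∞})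
      (hasBasis_nhds_infty.mem_of_mem ⟨isClosed_closure, hc⟩)
    rcases hy with ⟨z, hz, hzy⟩ | hy
    · exact hz (coe_injective hzy ▸ subset_closure hyS)
    · exact coe_ne_infty y hy
  · intro h U hU
    obtain ⟨s, ⟨hs, hsc⟩, hsU⟩ := hasBasis_nhds_infty.mem_iff.1 hU
    obtain ⟨y, hy, hys⟩ : ∃ y ∈ S, y ∉ s := by
      by_contra! hcon
      exact h (hsc.closure_of_subset hcon)
    exact ⟨y, ⟨hsU (Or.inl ⟨y, hys, rfl⟩), mem_image_of_mem _ hy⟩, coe_ne_infty y⟩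

/-- A clopen set of the compactification, or its complement if it contains `∞`, is a compact open
subset of `W`. -/
theorem countable_compactOpen_onePoint [T2Space W] [LocallyCompactSpace W]
    (h : {C : Set W | IsCompactOpen C}.Countable) :
    {C : Set (OnePoint W) | IsCompactOpen C}.Countable := by
  refine ((h.image fun C => ((↑) '' C : Set (OnePoint W))).union
    (h.image fun C => ((↑) '' C : Set (OnePoint W))ᶜ)).mono ?_
  rintro C ⟨hC, hCo⟩
  by_cases hi : ∞ ∈ C
  · refine Or.inr ⟨(↑) ⁻¹' Cᶜ, ⟨?_, ?_⟩, ?_⟩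
    · exact ((isOpen_iff_of_mem hi).1 hCo).2
    · rw [preimage_compl]
      exact (hC.isClosed.preimage continuous_coe).isOpen_compl
    · refine (congrArg _ (image_preimage_eq_of_subset ?_)).trans (compl_compl C)
      rw [← compl_infty, compl_subset_compl]
      exact singleton_subset_iff.2 hi
  · have hr : C ⊆ range ((↑) : W → OnePoint W) := by
      rw [← compl_infty, subset_compl_singleton_iff]
      exact hi
    refine Or.inl ⟨(↑) ⁻¹' C, ⟨?_, hCo.preimage continuous_coe⟩, image_preimage_eq_of_subset hr⟩
    rw [isOpenEmbedding_coe.isInducing.isCompact_iff, image_preimage_eq_of_subset hr]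
    exact hC

theorem IsTrimSet.image_coe {p : P} {A : Set W} (h : IsTrimSet X p A) :
    IsTrimSet (onePointPart E X) (.label p) ((↑) '' A : Set (OnePoint W)) := by
  refine isTrimSet_of ⟨h.1.image continuous_coe, isOpen_image_coe.2 h.2.1⟩ ?_ ?_
  · ext q
    rcases q with _ | q
    · refine iff_of_false ?_ WithInfinity.not_label_le_infty
      rintro ⟨_, ⟨x, -, rfl⟩, hx⟩
      exact coe_ne_infty x hx
    · refine Iff.trans ?_ (WithInfinity.label_le (E := E)).symm
      have h1 := Set.ext_iff.1 h.typeOf_eq q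
      refine Iff.trans ⟨?_, ?_⟩ h1
      · rintro ⟨_, ⟨x, hx, rfl⟩, hxq⟩
        exact ⟨x, hx, coe_mem_onePointPart.1 hxq⟩
      · rintro ⟨x, hx, hxq⟩
        exact ⟨x, ⟨x, hx, rfl⟩, coe_mem_onePointPart.2 hxq⟩
  · rintro hd _ ⟨x, hx, rfl⟩ hxp _ ⟨y, hy, rfl⟩ hyp
    exact congrArg _
      (h.eq_of_mem hd hx (coe_mem_onePointPart.1 hxp) hy (coe_mem_onePointPart.1 hyp))

theorem IsTrimSet.infty_notMem {p : P} {A : Set (OnePoint W)}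
    (h : IsTrimSet (onePointPart E X) (.label p) A) : ∞ ∉ A := fun hi =>
  WithInfinity.not_label_le_infty (h.le hi (q := .infty) (mem_onePointPart_infty.2 rfl))

theorem IsTrimSet.preimage_coe {p : P} {A : Set (OnePoint W)}
    (h : IsTrimSet (onePointPart E X) (.label p) A) :
    IsTrimSet X p ((↑) ⁻¹' A : Set W) := by
  have hr : A ⊆ range ((↑) : W → OnePoint W) := by
    rw [← compl_infty, subset_compl_singleton_iff]
    exact h.infty_notMem
  refine isTrimSet_of ⟨?_, h.2.1.preimage continuous_coe⟩ ?_ ?_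
  · rw [isOpenEmbedding_coe.isInducing.isCompact_iff, image_preimage_eq_of_subset hr]
    exact h.1
  · ext q
    refine Iff.trans ?_ (WithInfinity.label_le (E := E))
    have h1 := Set.ext_iff.1 h.typeOf_eq (.label q)
    refine Iff.trans ⟨?_, ?_⟩ h1
    · rintro ⟨x, hx, hxq⟩
      exact ⟨x, hx, coe_mem_onePointPart.2 hxq⟩
    · rintro ⟨y, hy, hyq⟩
      obtain ⟨x, rfl⟩ := hr hy
      exact ⟨x, hy, coe_mem_onePointPart.1 hyq⟩
  · intro hd x hx hxp y hy hyp
    exact coe_injective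
      (h.eq_of_mem hd hx (coe_mem_onePointPart.2 hxp) hy (coe_mem_onePointPart.2 hyp))

/-- Boundedness enters here: finitely many trim sets cover the given compact set together with all
classes labelled in `L`. The complement of their union meets every class that is not relatively
compact and none of the others. -/
theorem IsBoundedTrimExtPartition.exists_trimSet_infty [T2Space W]
    (h : IsBoundedTrimExtPartition E X) {U : Set (OnePoint W)} (hU : U ∈ 𝓝 ∞) :
    ∃ A, IsTrimSet (onePointPart E X) .infty A ∧ ∞ ∈ A ∧ A ⊆ U := by
  obtain ⟨s, ⟨hs, hsc⟩, hsU⟩ := hasBasis_nhds_infty.mem_iff.1 hU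
  obtain ⟨n, q, A, hA, -, -, hcov⟩ :=
    h.isTrim.base.exists_finite_cover (hsc.union h.bounded) isOpen_univ (subset_univ _)
  have hK : IsCompactOpen (⋃ i, A i) := IsCompactOpen.iUnion fun i => (hA i).isCompactOpen
  have hsub : ((↑) '' (⋃ i, A i) : Set (OnePoint W))ᶜ ⊆ U := by
    refine Subset.trans ?_ hsU
    rw [compl_image_coe]
    exact union_subset_union_left _
      (image_mono (compl_subset_compl.2 (subset_union_left.trans hcov)))
  refine ⟨((↑) '' (⋃ i, A i))ᶜ, isTrimSet_of ⟨?_, ?_⟩ ?_ ?_,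
    mem_compl infty_notMem_image_coe, hsub⟩
  · exact (isOpen_image_coe.2 hK.2).isClosed_compl.isCompact
  · exact isOpen_compl_image_coe.2 ⟨hK.isClosed, hK.1⟩
  · ext p
    rcases p with _ | p
    · exact iff_of_true ⟨∞, mem_compl infty_notMem_image_coe, rfl⟩ (Le.refl _)
    · have h1 : (.label p) ∈ up (.infty : WithInfinity E) ↔ p ∉ E.L :=
        ⟨fun h => h.elim id fun h => (nomatch h), fun h => Or.inl h⟩
      rw [h1, ← h.compact_iff]
      constructor
      · rintro ⟨_, hx, ⟨x, hxp, rfl⟩⟩ hc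
        refine hx ⟨x, hcov (Or.inr (subset_closure ?_)), rfl⟩
        exact mem_iUnion₂.2 ⟨p, (h.compact_iff p).1 hc, hxp⟩
      · intro hc
        obtain ⟨x, hxp, hx⟩ : ∃ x ∈ X p, x ∉ ⋃ i, A i := by
          by_contra! hcon
          exact hc (hK.1.closure_of_subset hcon)
        exact ⟨x, fun hx' => hx (coe_injective.mem_set_image.1 hx'), ⟨x, hxp, rfl⟩⟩
  · rintro - x - rfl y - rfl
    rfl

theorem IsBoundedTrimExtPartition.isTrimPartition_onePointPart [T2Space W] [LocallyCompactSpace W]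
    (h : IsBoundedTrimExtPartition E X) : IsTrimPartition (onePointPart E X) := by
  have hP := h.isTrim.isPPartition
  constructor
  · refine isPPartition_of ?_ ?_ ?_
    · rintro (_ | p)
      · exact ⟨∞, rfl⟩
      · exact (hP.nonempty p).image _
    · rintro (_ | p) (_ | q) x hp hq
      · rfl
      · obtain ⟨y, -, rfl⟩ := hq
        exact absurd hp (coe_ne_infty y)
      · obtain ⟨y, -, rfl⟩ := hp
        exact absurd hq (coe_ne_infty y)
      · obtain ⟨y, hy, rfl⟩ := hp
        exact congrArg WithInfinity.label (hP.eq_of_mem hy (coe_mem_onePointPart.1 hq))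
    · rintro (_ | p) q x hq
      · refine iff_of_false (fun hx => ?_) WithInfinity.not_lt_infty
        exact Set.Infinite.of_accPt hx (finite_singleton ∞)
      · rcases q with _ | q
        · obtain rfl : x = ∞ := hq
          rw [onePointPart_label, infty_mem_derivedSet_image, h.compact_iff]
          exact WithInfinity.infty_lt.symm
        · obtain ⟨y, hy, rfl⟩ := hq
          rw [onePointPart_label, coe_mem_derivedSet_image, hP.mem_derivedSet_iff hy]
          exact WithInfinity.label_lt.symm
  · intro x U hU
    induction x using OnePoint.rec with
    | infty =>
      obtain ⟨A, hA, hi, hAU⟩ := h.exists_trimSet_infty hU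
      exact ⟨_, A, hA, hi, hAU⟩
    | coe x =>
      rw [nhds_coe_eq, Filter.mem_map] at hU
      obtain ⟨p, A, hA, hxA, hAU⟩ := h.isTrim.base x _ hU
      exact ⟨(.label p), _, hA.image_coe, ⟨x, hxA, rfl⟩, image_subset_iff.2 hAU⟩
  · rintro (_ | p) ⟨A, hA⟩ x hx
    · by_contra hne
      obtain ⟨B, hB, -, hBU⟩ := hx {∞}ᶜ (isOpen_compl_singleton.mem_nhds hne)
      obtain ⟨y, hyB, hy⟩ := hB.nonempty
      exact hBU hyB hy
    · obtain ⟨B, hB, hxB, -⟩ := hx univ Filter.univ_mem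
      induction x using OnePoint.rec with
      | infty => exact absurd hxB hB.infty_notMem
      | coe x =>
        refine coe_mem_onePointPart.2 (h.isTrim.full p ⟨_, hA.preimage_coe⟩ x fun U hU => ?_)
        obtain ⟨C, hC, hxC, hCU⟩ := hx ((↑) '' U)
          (by rw [nhds_coe_eq]; exact Filter.image_mem_map hU)
        refine ⟨_, hC.preimage_coe, hxC, fun y hy => ?_⟩
        exact coe_injective.mem_set_image.1 (hCU hy)
  · rintro (_ | p) x hx
    · obtain rfl : x = ∞ := hx
      obtain ⟨A, hA, hi, -⟩ := h.exists_trimSet_infty Filter.univ_mem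
      exact ⟨A, hA, hi⟩
    · obtain ⟨y, hy, rfl⟩ := hx
      obtain ⟨A, hA, hyA⟩ := h.isTrim.clean p y hy
      exact ⟨_, hA.image_coe, ⟨y, hyA, rfl⟩⟩

theorem ExtPOSystem.size_def (p : P) (hp : p ∈ E.Lmd) : E.size p = E.f ⟨p, hp⟩ := dif_pos hp

/-- Bounded trim `(P, L, f)`-partitions are unique up to homeomorphism. -/
theorem IsBoundedTrimExtPartition.exists_homeomorph {V : Type w} [TopologicalSpace V]
    [T2Space V] [T2Space W] [LocallyCompactSpace V] [LocallyCompactSpace W]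
    (hV : {C : Set V | IsCompactOpen C}.Countable) (hW : {C : Set W | IsCompactOpen C}.Countable)
    {Y : P → Set V} (hX : IsBoundedTrimExtPartition E X) (hY : IsBoundedTrimExtPartition E Y) :
    ∃ h : W ≃ₜ V, ∀ p, h '' X p = Y p := by
  have hX' := hX.isTrimPartition_onePointPart
  have hY' := hY.isTrimPartition_onePointPart
  -- All labels occur on both sides. A label outside `L` is above that of `∞`, so apart from the
  -- latter the minimal discrete labels come from `L_min^d`, where `f` prescribes the number of
  -- points.
  have huniv : TrimEquiv (onePointPart E X) (onePointPart E Y) univ univ := by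
    refine ⟨⟨isCompact_univ, isOpen_univ⟩, ⟨isCompact_univ, isOpen_univ⟩, ?_, ?_⟩
    · ext p
      obtain ⟨x, hx⟩ := hX'.isPPartition.nonempty p
      obtain ⟨y, hy⟩ := hY'.isPPartition.nonempty p
      exact iff_of_true ⟨x, mem_univ x, hx⟩ ⟨y, mem_univ y, hy⟩
    · have hall : ∀ q, q ∈ typeOf (onePointPart E X) univ := fun q => by
        obtain ⟨x, hx⟩ := hX'.isPPartition.nonempty q
        exact ⟨x, mem_univ x, hx⟩
      rintro (_ | p) ⟨-, hp⟩ hd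
      · exact (congrArg encard (univ_inter _)).trans
          ((encard_singleton _).trans ((encard_singleton (∞ : OnePoint V)).symm.trans
            (congrArg encard (univ_inter _).symm)))
      · have hpL : p ∈ E.L := by
          by_contra hpL
          exact nomatch hp .infty (hall _) (Or.inl (WithInfinity.infty_lt.2 hpL))
        have hpm : p ∈ E.Lmd := by
          refine ⟨⟨hpL, fun q _ hqp => ?_⟩, hd⟩
          have := hp (.label q) (hall _) (WithInfinity.label_le.2 hqp)
          exact WithInfinity.label.inj this
        rw [univ_inter, univ_inter, onePointPart_label, onePointPart_label,
          coe_injective.encard_image, coe_injective.encard_image, hX.card_eq p hpm,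
          hY.card_eq p hpm]
  obtain ⟨g, hg⟩ := huniv.exists_homeomorph (countable_compactOpen_onePoint hW)
    (countable_compactOpen_onePoint hV) hX' hY'
  let k : OnePoint W ≃ₜ OnePoint V :=
    (Homeomorph.Set.univ _).symm.trans (g.trans (Homeomorph.Set.univ _))
  have hk : ∀ x p, x ∈ onePointPart E X p ↔ k x ∈ onePointPart E Y p :=
    fun x p => hg ⟨x, mem_univ x⟩ p
  -- `∞` is the only point with its label, so the homeomorphism fixes it and restricts to the
  -- original spaces.
  have hki : k ∞ = ∞ := (hk ∞ .infty).1 rfl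
  have hks : k.symm ∞ = ∞ := k.symm_apply_eq.2 hki.symm
  have h1 : ∀ x : W, ∃ y : V, (y : OnePoint V) = k x := fun x =>
    ne_infty_iff_exists.1 fun h => coe_ne_infty x (k.injective (h.trans hki.symm))
  have h2 : ∀ y : V, ∃ x : W, (x : OnePoint W) = k.symm y := fun y =>
    ne_infty_iff_exists.1 fun h => coe_ne_infty y (k.symm.injective (h.trans hks.symm))
  choose a ha using h1
  choose b hb using h2
  have hab : ∀ y, a (b y) = y := fun y =>
    coe_injective (by rw [ha, hb, k.apply_symm_apply])
  refine ⟨{ toFun := a, invFun := b,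
            left_inv := fun x => coe_injective (by rw [hb, ha, k.symm_apply_apply]),
            right_inv := hab,
            continuous_toFun := ?_, continuous_invFun := ?_ }, fun p => ?_⟩
  · rw [isOpenEmbedding_coe.isInducing.continuous_iff]
    exact (k.continuous.comp continuous_coe).congr fun x => (ha x).symm
  · rw [isOpenEmbedding_coe.isInducing.continuous_iff]
    exact (k.symm.continuous.comp continuous_coe).congr fun x => (hb x).symm
  · have hap : ∀ x, x ∈ X p ↔ a x ∈ Y p := fun x => by
      rw [← coe_mem_onePointPart (E := E), hk, ← ha, coe_mem_onePointPart]
    ext y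
    constructor
    · rintro ⟨x, hx, rfl⟩
      exact (hap x).1 hx
    · intro hy
      exact ⟨b y, (hap _).2 ((hab y).symm ▸ hy), hab y⟩

end OnePointPartition

/-- A second countable space has countably many compact open subsets. -/
theorem countable_compactOpen (W : Type u) [TopologicalSpace W] [SecondCountableTopology W] :
    {C : Set W | IsCompactOpen C}.Countable := by
  have hb := TopologicalSpace.isBasis_countableBasis W
  have : Countable (TopologicalSpace.countableBasis W) :=
    (TopologicalSpace.countable_countableBasis W).to_subtype
  refine (countable_range fun t : Finset (TopologicalSpace.countableBasis W) =>
    ⋃₀ (Subtype.val '' (t : Set (TopologicalSpace.countableBasis W)))).mono ?_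
  rintro C ⟨hC, hCo⟩
  obtain ⟨t, ht⟩ := eq_sUnion_finset_of_isTopologicalBasis_of_isCompact_open _
    hb C hC hCo
  exact ⟨t, ht.symm⟩

/-! ### Morphisms of PO systems and of extended PO systems -/

section Morphisms

variable {Q : Type u} {P : Type v} {R : Type w} [POSystem Q] [POSystem P] [POSystem R]

theorem POSystem.IsMorphism.lt {α : Q → P} (h : IsMorphism α) {q r : Q} (hqr : q < r) :
    α q < α r := by
  have h1 : α r ∈ α '' {r | q < r} := ⟨r, hqr, rfl⟩
  rwa [h q] at h1

theorem POSystem.IsMorphism.exists_lt {α : Q → P} (h : IsMorphism α) {q : Q} {p : P}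
    (hp : α q < p) : ∃ r, q < r ∧ α r = p := by
  have h1 : p ∈ {p | α q < p} := hp
  rw [← h q] at h1
  exact h1

theorem POSystem.IsMorphism.image_up {α : Q → P} (h : IsMorphism α) (q : Q) :
    α '' up q = up (α q) := by
  ext p
  constructor
  · rintro ⟨r, hr | rfl, rfl⟩
    · exact Or.inl (h.lt hr)
    · exact Le.refl _
  · rintro (hp | rfl)
    · obtain ⟨r, hr, rfl⟩ := h.exists_lt hp
      exact ⟨r, Or.inl hr, rfl⟩
    · exact ⟨q, Le.refl q, rfl⟩

theorem POSystem.IsMorphism.comp {β : P → R} {α : Q → P} (hβ : IsMorphism β)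
    (hα : IsMorphism α) : IsMorphism (β ∘ α) := by
  intro q
  rw [image_comp, hα q, hβ (α q)]
  rfl

theorem POSystem.IsIso.isMorphism {α : Q ≃ P} (h : IsIso α) : IsMorphism α := by
  intro q
  ext p
  constructor
  · rintro ⟨r, hr, rfl⟩
    exact (h q r).1 hr
  · intro hp
    refine ⟨α.symm p, (h q _).2 ?_, α.apply_symm_apply p⟩
    rw [α.apply_symm_apply]
    exact hp

namespace ExtPOSystem

variable {G : ExtPOSystem Q} {E : ExtPOSystem P} {D : ExtPOSystem R}

/-- Fibres of the composite are unions of fibres over fibres; the size condition for `α` is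
available there because the fibre of `β` over `r` lies in `E.Lmd`. -/
theorem Below.trans (h : Below G E) (k : Below E D) : Below G D := by
  classical
  obtain ⟨α, hα, hαm, hαL, hαs⟩ := h
  obtain ⟨β, hβ, hβm, hβL, hβs⟩ := k
  refine ⟨β ∘ α, hβ.comp hα, hβm.comp hαm, ?_, fun r hr => ?_⟩
  · ext r
    rw [hβL, hαL]
    constructor
    · intro h q hq
      exact h hq rfl
    · rintro h p hp q rfl
      exact h hp
  · obtain ⟨hfin, hsum⟩ := hβs r hr
    have hsub := fibre_subset_Lmd E D β hβm hβL r hr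
    have hfin' : (β ∘ α ⁻¹' {r}).Finite := by
      refine (hfin.biUnion fun p hp => (hαs p (hsub hp)).choose).subset ?_
      intro q hq
      exact mem_biUnion (show α q ∈ β ⁻¹' {r} from hq) rfl
    refine ⟨hfin', ?_⟩
    rw [hsum, ← Finset.sum_fiberwise_of_maps_to (g := α) (t := hfin.toFinset)
      (fun q hq => by simpa using hq)]
    refine Finset.sum_congr rfl fun p hp => ?_
    have hp' : β p = r := by simpa using hp
    obtain ⟨hf, hs⟩ := hαs p (hsub hp')
    rw [hs]
    refine Finset.sum_congr ?_ fun _ _ => rfl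
    ext q
    simp only [Finite.mem_toFinset, mem_preimage, mem_singleton_iff, Finset.mem_filter,
      Function.comp_apply]
    exact ⟨fun h => ⟨h ▸ hp', h⟩, fun h => h.2⟩

theorem IsExtIso.below {σ : Q ≃ P} (h : IsExtIso G E σ) : Below G E := by
  refine ⟨σ, σ.surjective, h.1.isMorphism, ?_, fun p hp => ?_⟩
  · ext p
    rw [← h.2.1]
    constructor
    · rintro ⟨q, hq, rfl⟩ q' hq'
      exact σ.injective hq' ▸ hq
    · intro hp
      exact ⟨σ.symm p, hp (σ.apply_symm_apply p), σ.apply_symm_apply p⟩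
  · obtain ⟨q, rfl⟩ := σ.surjective p
    have hpre : σ ⁻¹' {σ q} = {q} := by
      ext r
      simp
    have hfin : (σ ⁻¹' {σ q}).Finite := hpre ▸ finite_singleton q
    refine ⟨hfin, ?_⟩
    have h1 : hfin.toFinset = {q} := by
      ext r
      simp
    rw [h1, Finset.sum_singleton, h.2.2 q ((h.mem_Lmd q).2 hp)]

theorem mem_Lmd_iff_of_isIso {σ : Q ≃ P} (h : IsIso σ) (hL : ∀ q, q ∈ G.L ↔ σ q ∈ E.L) (q : Q) :
    q ∈ G.Lmd ↔ σ q ∈ E.Lmd := by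
  refine and_congr (and_congr (hL q) ⟨fun H p hp hle => ?_, fun H p hp hle => ?_⟩)
    (not_congr (h q q))
  · obtain ⟨p, rfl⟩ := σ.surjective p
    rw [H p ((hL p).2 hp) ((h.le_iff p q).2 hle)]
  · exact σ.injective (H (σ p) ((hL p).1 hp) ((h.le_iff p q).1 hle))

end ExtPOSystem

theorem below_of_extClass_eq {P P' : Type u} [POSystem P] [POSystem P'] {E : ExtPOSystem P}
    {F : ExtPOSystem P'} (h : extClass E = extClass F) : ExtPOSystem.Below E F := by
  obtain ⟨σ, hσ⟩ := Quotient.exact h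
  exact hσ.below

end Morphisms

/-! ### The extended PO system of a bounded trim partition -/

theorem encard_biUnion_finset {ι : Type*} {W : Type*} (t : Finset ι) (S : ι → Set W)
    (h : ∀ i j, i ≠ j → Disjoint (S i) (S j)) :
    (⋃ i ∈ t, S i).encard = ∑ i ∈ t, (S i).encard := by
  classical
  induction t using Finset.induction_on with
  | empty => simp
  | insert a t ha ih =>
    rw [Finset.set_biUnion_insert, Finset.sum_insert ha, encard_union_eq, ih]
    rw [disjoint_iUnion₂_right]
    rintro i hi
    exact h a i fun heq => ha (heq ▸ hi)

section Ext

variable {W : Type u} [TopologicalSpace W] {P : Type v} [POSystem P] {X : P → Set W}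

theorem IsPPartition.subset_closure_of_le (h : IsPPartition X) {p q : P} (hqp : Le q p) :
    X q ⊆ closure (X p) := by
  rcases hqp with hlt | rfl
  · intro x hx
    exact derivedSet_subset_closure _ ((h.mem_derivedSet_iff hx).2 hlt)
  · exact subset_closure

theorem IsPPartition.isLower_compactLabels [R1Space W] (h : IsPPartition X) :
    IsLower (compactLabels X) := fun _ hq _ hr =>
  IsCompact.closure_of_subset hq (h.subset_closure_of_le hr)

theorem IsTrimSet.inter_nonempty_of_closure {p q : P} {A : Set W} (h : IsTrimSet X p A)
    (hA : (A ∩ closure (X q)).Nonempty) : Le p q := by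
  obtain ⟨x, hx, hxq⟩ := hA
  obtain ⟨y, hy, hyq⟩ := mem_closure_iff.1 hxq A h.2.1 hx
  exact h.le hy hyq

/-- The labels of a finite trim cover of `closure (X q)` form the foundation: each member meets this
closure, so its label is below `q`, and every class with a label below `q` lies in the closure. -/
theorem IsTrimPartition.compactLabels_subset_founded (h : IsTrimPartition X) :
    compactLabels X ⊆ founded P := by
  intro q hq
  obtain ⟨n, p, A, hA, -, hAq, hcov⟩ := h.base.exists_finite_cover hq isOpen_univ (subset_univ _)
  refine ⟨range p, finite_range p, ?_, ?_⟩
  · rintro _ ⟨i, rfl⟩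
    exact ⟨q, rfl, (hA i).inter_nonempty_of_closure (hAq i)⟩
  · rintro r ⟨_, rfl, hr⟩
    obtain ⟨x, hx⟩ := h.isPPartition.nonempty r
    obtain ⟨i, hi⟩ := mem_iUnion.1 (hcov (h.isPPartition.subset_closure_of_le hr hx))
    exact ⟨p i, mem_range_self i, (hA i).le hi hx⟩

/-- Trim sets meeting `closure (X q)` have labels below `q`, which minimality forces to equal `q`;
finitely many cover the class, and each contains just one of its points. -/
theorem IsTrimPartition.finite_of_minimal [R1Space W] (h : IsTrimPartition X) {q : P}
    (hq : q ∈ minimals (compactLabels X)) (hd : q ∈ discretePart P) : (X q).Finite := by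
  obtain ⟨n, p, A, hA, -, hAq, hcov⟩ :=
    h.base.exists_finite_cover hq.1 isOpen_univ (subset_univ _)
  refine (finite_iUnion fun i => ?_ : (⋃ i, A i ∩ X q).Finite).subset fun x hx => ?_
  · have hle : Le (p i) q := (hA i).inter_nonempty_of_closure (hAq i)
    obtain rfl : p i = q := hq.2 _ (h.isPPartition.isLower_compactLabels q hq.1 _ hle) hle
    exact finite_of_encard_eq_coe ((hA i).2.2.2 hd)
  · obtain ⟨i, hi⟩ := mem_iUnion.1 (hcov (subset_closure hx))
    exact mem_iUnion.2 ⟨i, hi, hx⟩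

/-- The extended PO system `(P, L, f)` of a trim partition. -/
noncomputable def IsTrimPartition.ext [R1Space W] (h : IsTrimPartition X) : ExtPOSystem P where
  L := compactLabels X
  isLower := h.isPPartition.isLower_compactLabels
  subset_founded := h.compactLabels_subset_founded
  f p := ⟨(X p).ncard, (ncard_pos (h.finite_of_minimal p.2.1 p.2.2)).2 (h.isPPartition.nonempty p)⟩

theorem IsBoundedTrimPartition.isBoundedTrimExtPartition [R1Space W]
    (h : IsBoundedTrimPartition X) : IsBoundedTrimExtPartition h.isTrim.ext X := by
  refine ⟨h.isTrim, fun p => Iff.rfl, fun p hp => ?_, h.bounded⟩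
  rw [ExtPOSystem.size_def p hp]
  exact (h.isTrim.finite_of_minimal hp.1 hp.2).cast_ncard_eq.symm

theorem IsBoundedTrimExtPartition.isBoundedTrimPartition {E : ExtPOSystem P}
    (h : IsBoundedTrimExtPartition E X) : IsBoundedTrimPartition X := by
  refine ⟨h.isTrim, ?_⟩
  have : compactLabels X = E.L := Set.ext fun p => h.compact_iff p
  rw [this]
  exact h.bounded

/-- Compactness of closures and numbers of points are topological invariants, so `θ` is well defined
and the extended system on given labels is determined by the partition. -/
theorem IsBoundedTrimExtPartition.isExtIso {V : Type w} [TopologicalSpace V] {Q : Type*}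
    [POSystem Q] {Y : Q → Set V} {E : ExtPOSystem P} {F : ExtPOSystem Q}
    (hX : IsBoundedTrimExtPartition E X) (hY : IsBoundedTrimExtPartition F Y) (g : W ≃ₜ V)
    {σ : P ≃ Q} (hσ : IsIso σ) (h : ∀ p, g '' X p = Y (σ p)) :
    ExtPOSystem.IsExtIso E F σ := by
  have hL : ∀ p, p ∈ E.L ↔ σ p ∈ F.L := fun p => by
    rw [← hX.compact_iff, ← hY.compact_iff, ← h, ← g.image_closure, g.isCompact_image]
  refine ⟨hσ, ?_, fun p hp => ?_⟩
  · ext q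
    constructor
    · rintro ⟨p, hp, rfl⟩
      exact (hL p).1 hp
    · intro hq
      exact ⟨σ.symm q, (hL _).2 (by rwa [σ.apply_symm_apply]), σ.apply_symm_apply q⟩
  · have h1 := hX.card_eq p hp
    have h2 := hY.card_eq (σ p) ((ExtPOSystem.mem_Lmd_iff_of_isIso hσ hL p).1 hp)
    rw [← h, g.injective.encard_image, h1] at h2
    exact_mod_cast h2.symm

end Ext

/-! ### Relabelling along isomorphisms -/

section Relabel

variable {W : Type u} [TopologicalSpace W] {P : Type v} {Q : Type w} [POSystem P] [POSystem Q]
  {X : P → Set W} {σ : Q ≃ P}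

theorem POSystem.IsIso.isTrimSet_iff (hσ : IsIso σ) {q : Q} {A : Set W} :
    IsTrimSet (fun q => X (σ q)) q A ↔ IsTrimSet X (σ q) A := by
  refine and_congr Iff.rfl (and_congr Iff.rfl (and_congr ?_ (imp_congr
    (not_congr (hσ q q)) Iff.rfl)))
  have h1 : typeOf (fun q => X (σ q)) A = σ ⁻¹' typeOf X A := rfl
  have h2 : up q = σ ⁻¹' up (σ q) := Set.ext fun r => hσ.le_iff q r
  rw [h1, h2, σ.surjective.preimage_injective.eq_iff]

theorem IsTrimPartition.relabel (h : IsTrimPartition X) (hσ : IsIso σ) :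
    IsTrimPartition fun q => X (σ q) where
  isPPartition := isPPartition_of (fun q => h.isPPartition.nonempty _)
    (fun p q x hp hq => σ.injective (h.isPPartition.eq_of_mem hp hq))
    fun p q x hx => by rw [h.isPPartition.mem_derivedSet_iff hx, hσ q p]
  base x U hU := by
    obtain ⟨p, A, hA, hxA⟩ := h.base x U hU
    refine ⟨σ.symm p, A, hσ.isTrimSet_iff.2 ?_, hxA⟩
    rwa [σ.apply_symm_apply]
  full q := by
    rintro ⟨A, hA⟩ x hx
    refine h.full (σ q) ⟨A, hσ.isTrimSet_iff.1 hA⟩ x fun U hU => ?_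
    obtain ⟨B, hB, hxB⟩ := hx U hU
    exact ⟨B, hσ.isTrimSet_iff.1 hB, hxB⟩
  clean q x hx := by
    obtain ⟨A, hA, hxA⟩ := h.clean (σ q) x hx
    exact ⟨A, hσ.isTrimSet_iff.2 hA, hxA⟩

theorem IsBoundedTrimExtPartition.relabel {E : ExtPOSystem P} {F : ExtPOSystem Q}
    (h : IsBoundedTrimExtPartition E X) (hσ : ExtPOSystem.IsExtIso F E σ) :
    IsBoundedTrimExtPartition F fun q => X (σ q) where
  isTrim := h.isTrim.relabel hσ.1
  compact_iff q := by
    rw [h.compact_iff, ← hσ.2.1, σ.injective.mem_set_image]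
  card_eq q hq := by
    rw [h.card_eq _ ((hσ.mem_Lmd q).1 hq), hσ.2.2 q hq]
  bounded := by
    have h1 : (⋃ q ∈ F.L, X (σ q)) = ⋃ p ∈ E.L, X p := by
      rw [← hσ.2.1, biUnion_image]
    rw [h1]
    exact h.bounded

end Relabel

/-! ### Regular refinements and morphisms -/

section Refinement

variable {W : Type u} [TopologicalSpace W] [T2Space W] {Q : Type v} {P : Type w} [POSystem Q]
  [POSystem P] {Y : Q → Set W} {Z : P → Set W} {α : Q → P}

theorem RegularlyRefinesVia.surjective (h : RegularlyRefinesVia Y Z α) (hZ : IsTrimPartition Z) :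
    Function.Surjective α := by
  intro p
  obtain ⟨x, hx⟩ := hZ.isPPartition.nonempty p
  obtain ⟨A, hA, -⟩ := hZ.clean p x hx
  obtain ⟨q, -, hq⟩ := h.2.2.2 p A hA
  exact ⟨q, hq⟩

theorem RegularlyRefinesVia.isMorphism (h : RegularlyRefinesVia Y Z α) (hY : IsTrimPartition Y)
    (hZ : IsTrimPartition Z) : IsMorphism α := by
  intro q
  ext p
  constructor
  · rintro ⟨r, hr, rfl⟩
    obtain ⟨y, hy⟩ := hY.isPPartition.nonempty q
    exact (hZ.isPPartition.mem_derivedSet_iff (h.1 q hy)).1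
      (derivedSet_mono _ _ (h.1 r) ((hY.isPPartition.mem_derivedSet_iff hy).2 hr))
  · intro hp
    obtain ⟨y, hy⟩ := hY.isPPartition.nonempty q
    obtain ⟨B, hB, hyB⟩ := hY.clean q y hy
    obtain ⟨z, hzB, hzp, hzy⟩ := hZ.isPPartition.exists_ne (h.1 q hy) hp
      (hB.isCompactOpen.mem_nhds hyB)
    -- The `p`-trim set is chosen inside `B` but away from `y`. Regularity gives it a point with a
    -- label `r` over `p`; if `r = q` were discrete, that point would have to be `y`.
    obtain ⟨A, hA, -, hAB⟩ := hZ.isClean.exists_trimSet hzp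
      ((hB.2.1.sdiff isClosed_singleton).mem_nhds ⟨hzB, hzy⟩)
    obtain ⟨r, ⟨x, hxA, hxr⟩, rfl⟩ := h.2.2.2 p A hA
    refine ⟨r, ?_, rfl⟩
    rcases hB.le (hAB hxA).1 hxr with hqr | rfl
    · exact hqr
    · by_contra hd
      exact (hAB hxA).2 (hB.eq_of_mem hd (hAB hxA).1 hxr hyB hy)

/-- Regularity is a density statement: every small `p`-trim set contains a point of a class over
`p`. -/
theorem RegularlyRefinesVia.subset_closure (h : RegularlyRefinesVia Y Z α)
    (hZ : IsTrimPartition Z) (p : P) : Z p ⊆ closure (⋃ q ∈ α ⁻¹' {p}, Y q) := by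
  intro z hz
  rw [mem_closure_iff]
  intro U hU hzU
  obtain ⟨A, hA, -, hAU⟩ := hZ.isClean.exists_trimSet hz (hU.mem_nhds hzU)
  obtain ⟨q, ⟨x, hxA, hxq⟩, hq⟩ := h.2.2.2 p A hA
  exact ⟨x, hAU hxA, mem_biUnion (show q ∈ α ⁻¹' {p} from hq) hxq⟩

theorem size_eq_sum {G : ExtPOSystem Q} {p : P} {n : ℕ} (hY : IsBoundedTrimExtPartition G Y)
    (hfin : (α ⁻¹' {p}).Finite) (hsub : α ⁻¹' {p} ⊆ G.Lmd) :
    (⋃ q ∈ α ⁻¹' {p}, Y q).encard = n ↔ n = ∑ q ∈ hfin.toFinset, G.size q := by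
  have h1 : (⋃ q ∈ α ⁻¹' {p}, Y q) = ⋃ q ∈ hfin.toFinset, Y q := by simp
  rw [h1, encard_biUnion_finset _ _ hY.isTrim.isPPartition.disjoint, eq_comm,
    Finset.sum_congr rfl fun q hq => hY.card_eq q (hsub (hfin.mem_toFinset.1 hq))]
  norm_cast

theorem RegularlyRefinesVia.below {G : ExtPOSystem Q} {E : ExtPOSystem P}
    (h : RegularlyRefinesVia Y Z α) (hY : IsBoundedTrimExtPartition G Y)
    (hZ : IsBoundedTrimExtPartition E Z) : ExtPOSystem.Below G E := by
  have hm := h.isMorphism hY.isTrim hZ.isTrim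
  have hL : E.L = {p | α ⁻¹' {p} ⊆ G.L} := by
    ext p
    rw [← hZ.compact_iff]
    constructor
    · rintro hp q rfl
      rw [← hY.compact_iff]
      exact hp.closure_of_subset ((h.1 q).trans _root_.subset_closure)
    · intro hp
      -- The fibre over `p` may be infinite, so compactness of the individual closures would not
      -- suffice; boundedness of `Y` handles the whole union.
      refine hY.bounded.closure_of_subset ((h.subset_closure hZ.isTrim p).trans
        (closure_mono (biUnion_mono hp fun _ _ => Subset.rfl)))
  refine ⟨α, h.surjective hZ.isTrim, hm, hL, fun p hp => ?_⟩
  have hsub := ExtPOSystem.fibre_subset_Lmd G E α hm hL p hp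
  have hZfin : (Z p).Finite := finite_of_encard_eq_coe (hZ.card_eq p hp)
  have hYZ : (⋃ q ∈ α ⁻¹' {p}, Y q) ⊆ Z p := iUnion₂_subset fun q hq => hq ▸ h.1 q
  have hfin : (α ⁻¹' {p}).Finite := by
    choose y hy using hY.isTrim.isPPartition.nonempty
    refine Finite.of_finite_image (f := y) (hZfin.subset ?_) ?_
    · rintro _ ⟨q, hq, rfl⟩
      exact hYZ (mem_biUnion hq (hy q))
    · intro q _ r _ hqr
      exact hY.isTrim.isPPartition.eq_of_mem (hy q) (hqr ▸ hy r)
  refine ⟨hfin, (size_eq_sum hY hfin hsub).1 ?_⟩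
  rw [← hZ.card_eq p hp]
  congr 1
  -- The union over the fibre is dense in `Z p` and, being finite, closed.
  refine hYZ.antisymm ((h.subset_closure hZ.isTrim p).trans ?_)
  rw [(hZfin.subset hYZ).isClosed.closure_eq]

end Refinement

/-! ### Fullness and coarser partitions -/

section Completion

variable {W : Type u} [TopologicalSpace W] {P : Type v} [POSystem P] {X : P → Set W}

/-- The points with a neighbourhood base of `p`-trim sets. -/
def trimPoints (X : P → Set W) (p : P) : Set W :=
  {x | ∀ U ∈ 𝓝 x, ∃ A, IsTrimSet X p A ∧ x ∈ A ∧ A ⊆ U}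

theorem inter_nonempty_of_mem_trimPoints {q : P} {A : Set W} (hA : IsOpen A) {x : W}
    (hx : x ∈ A) (hxq : x ∈ trimPoints X q) : (A ∩ X q).Nonempty := by
  obtain ⟨B, hB, -, hBA⟩ := hxq A (hA.mem_nhds hx)
  exact hB.nonempty.mono (inter_subset_inter_left _ hBA)

theorem trimPoints_subset_closure (p : P) : trimPoints X p ⊆ closure (X p) := by
  intro x hx
  rw [mem_closure_iff]
  intro U hU hxU
  exact inter_nonempty_of_mem_trimPoints hU hxU hx

variable [T2Space W]

theorem IsCleanPartition.subset_trimPoints (h : IsCleanPartition X) (p : P) :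
    X p ⊆ trimPoints X p := fun _ hx _ hU => h.exists_trimSet hx hU

/-- A `p`-trim set has a unique point `y` labelled `p`; around any other of its points, a smaller
`p`-trim set avoiding `y` would have no point labelled `p`. -/
theorem trimPoints_subset_of_discrete {p : P} (hp : p ∈ discretePart P) :
    trimPoints X p ⊆ X p := by
  intro x hx
  obtain ⟨A, hA, hxA, -⟩ := hx univ Filter.univ_mem
  obtain ⟨y, hyA, hyp⟩ := hA.nonempty
  by_contra hxp
  obtain ⟨B, hB, hxB, hBA⟩ := hx _ ((hA.2.1.sdiff (isClosed_singleton (x := y))).mem_nhds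
    ⟨hxA, fun hxy => hxp (hxy ▸ hyp)⟩)
  obtain ⟨z, hzB, hzp⟩ := hB.nonempty
  exact (hBA hzB).2 (hA.eq_of_mem hp (hBA hzB).1 hzp hyA hyp)

theorem IsCleanPartition.trimPoints_eq (h : IsCleanPartition X) {p : P}
    (hp : p ∈ discretePart P) : trimPoints X p = X p :=
  (trimPoints_subset_of_discrete hp).antisymm (h.subset_trimPoints p)

theorem IsCleanPartition.typeOf_trimPoints (h : IsCleanPartition X) {A : Set W}
    (hA : IsOpen A) : typeOf (trimPoints X) A = typeOf X A := by
  ext p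
  constructor
  · rintro ⟨x, hx, hxp⟩
    exact inter_nonempty_of_mem_trimPoints hA hx hxp
  · rintro ⟨x, hx, hxp⟩
    exact ⟨x, hx, h.subset_trimPoints p hxp⟩

theorem IsCleanPartition.isTrimSet_trimPoints (h : IsCleanPartition X) {p : P} {A : Set W} :
    IsTrimSet (trimPoints X) p A ↔ IsTrimSet X p A := by
  refine and_congr_right fun _ => and_congr_right fun hA => ?_
  rw [h.typeOf_trimPoints hA]
  refine and_congr_right fun _ => forall_congr' fun hp => ?_
  rw [h.trimPoints_eq hp]

/-- Enlarging the classes changes neither the types of open sets nor, since discrete classes gain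
nothing, the trim sets. One enlargement therefore achieves T2. -/
theorem IsCleanPartition.isTrimPartition_trimPoints (h : IsCleanPartition X) :
    IsTrimPartition (trimPoints X) where
  isPPartition := by
    have hle : ∀ p q x, x ∈ trimPoints X p → x ∈ trimPoints X q → Le p q := by
      intro p q x hp hq
      obtain ⟨A, hA, hxA, -⟩ := hp univ Filter.univ_mem
      obtain ⟨y, hyA, hyq⟩ := inter_nonempty_of_mem_trimPoints hA.2.1 hxA hq
      exact hA.le hyA hyq
    refine isPPartition_of (fun p => (h.isPPartition.nonempty p).mono (h.subset_trimPoints p))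
      (fun p q x hp hq => (hle p q x hp hq).antisymm (hle q p x hq hp)) fun p q x hq => ⟨?_, ?_⟩
    · intro hx
      obtain ⟨A, hA, hxA, -⟩ := hq univ Filter.univ_mem
      obtain ⟨y, ⟨hyA, hyp⟩, hyx⟩ := accPt_iff_nhds.1 hx A (hA.isCompactOpen.mem_nhds hxA)
      obtain ⟨z, hz, hzp⟩ := inter_nonempty_of_mem_trimPoints hA.2.1 hyA hyp
      rcases hA.le hz hzp with hlt | rfl
      · exact hlt
      · by_contra hd
        exact hyx (hA.eq_of_mem hd hyA (trimPoints_subset_of_discrete hd hyp) hxA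
          (trimPoints_subset_of_discrete hd hq))
    · intro hqp
      rw [mem_derivedSet, accPt_iff_nhds]
      intro U hU
      obtain ⟨A, hA, hxA, hAU⟩ := hq U hU
      obtain ⟨y, hyA, hyq⟩ := hA.nonempty
      obtain ⟨z, hzA, hzp, hzy⟩ :=
        h.isPPartition.exists_ne hyq hqp (hA.isCompactOpen.mem_nhds hyA)
      -- If the point found near `y` is `x` itself, then `p = q` and `y` serves instead.
      by_cases hzx : z = x
      · subst hzx
        obtain rfl : p = q := ((hle q p z hq (h.subset_trimPoints p hzp)).antisymm
          (hle p q z (h.subset_trimPoints p hzp) hq)).symm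
        exact ⟨y, ⟨hAU hyA, h.subset_trimPoints p hyq⟩, hzy.symm⟩
      · exact ⟨z, ⟨hAU hzA, h.subset_trimPoints p hzp⟩, hzx⟩
  base x U hU := by
    obtain ⟨p, A, hA, hxA⟩ := h.base x U hU
    exact ⟨p, A, h.isTrimSet_trimPoints.2 hA, hxA⟩
  full p _ x hx U hU := by
    obtain ⟨A, hA, hxA⟩ := hx U hU
    exact ⟨A, h.isTrimSet_trimPoints.1 hA, hxA⟩
  clean p x hx := by
    obtain ⟨A, hA, hxA, -⟩ := hx univ Filter.univ_mem
    exact ⟨A, h.isTrimSet_trimPoints.2 hA, hxA⟩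

end Completion

section Coarse

variable {W : Type u} [TopologicalSpace W] {Q : Type v} {P : Type w} [POSystem Q]
  [POSystem P] {Y : Q → Set W} {α : Q → P}

/-- The unions of the elements of a partition along the fibres of a map of labels. -/
def fibreUnion (α : Q → P) (Y : Q → Set W) (p : P) : Set W := ⋃ q ∈ α ⁻¹' {p}, Y q

theorem mem_fibreUnion {p : P} {x : W} : x ∈ fibreUnion α Y p ↔ ∃ q, α q = p ∧ x ∈ Y q := by
  simp [fibreUnion]

theorem subset_fibreUnion (q : Q) : Y q ⊆ fibreUnion α Y (α q) :=
  fun _ hx => mem_fibreUnion.2 ⟨q, rfl, hx⟩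

theorem typeOf_fibreUnion (A : Set W) : typeOf (fibreUnion α Y) A = α '' typeOf Y A := by
  ext p
  constructor
  · rintro ⟨x, hx, hxp⟩
    obtain ⟨q, rfl, hxq⟩ := mem_fibreUnion.1 hxp
    exact ⟨q, ⟨x, hx, hxq⟩, rfl⟩
  · rintro ⟨q, ⟨x, hx, hxq⟩, rfl⟩
    exact ⟨x, hx, subset_fibreUnion q hxq⟩

/-- Morphisms carry `up q` onto `up (α q)`. If `α q` is discrete, no label of the same fibre lies
strictly above `q`, so `A` gains no further points in the coarser class. -/
theorem IsTrimSet.fibreUnion {q : Q} {A : Set W} (h : IsTrimSet Y q A) (hα : IsMorphism α) :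
    IsTrimSet (fibreUnion α Y) (α q) A := by
  refine isTrimSet_of h.isCompactOpen ?_ fun hd => ?_
  · rw [typeOf_fibreUnion, h.typeOf_eq, hα.image_up]
  · have key : ∀ x ∈ A, x ∈ _root_.fibreUnion α Y (α q) → x ∈ Y q := by
      intro x hx hxq
      obtain ⟨r, hr, hxr⟩ := mem_fibreUnion.1 hxq
      rcases h.le hx hxr with hlt | rfl
      · exact absurd (lt_of_lt_of_le (hα.lt hlt) (Or.inr hr)) hd
      · exact hxr
    intro x hx hxq y hy hyq
    exact h.eq_of_mem (fun hlt => hd (hα.lt hlt)) hx (key x hx hxq) hy (key y hy hyq)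

theorem IsCleanPartition.fibreUnion (h : IsCleanPartition Y) (hα : IsMorphism α)
    (hs : Function.Surjective α) : IsCleanPartition (fibreUnion α Y) where
  isPPartition := by
    refine isPPartition_of (fun p => ?_) (fun p q x hp hq => ?_) fun p q x hx => ?_
    · obtain ⟨q, rfl⟩ := hs p
      exact (h.isPPartition.nonempty q).mono (subset_fibreUnion q)
    · obtain ⟨p', rfl, hp'⟩ := mem_fibreUnion.1 hp
      obtain ⟨q', rfl, hq'⟩ := mem_fibreUnion.1 hq
      rw [h.isPPartition.eq_of_mem hp' hq']
    · obtain ⟨q, rfl, hxq⟩ := mem_fibreUnion.1 hx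
      constructor
      · intro hxp
        obtain ⟨A, hA, hxA⟩ := h.clean q x hxq
        obtain ⟨z, ⟨hzA, hzp⟩, hzx⟩ := accPt_iff_nhds.1 hxp A (hA.isCompactOpen.mem_nhds hxA)
        obtain ⟨r, rfl, hzr⟩ := mem_fibreUnion.1 hzp
        refine hα.lt ?_
        rcases hA.le hzA hzr with hlt | rfl
        · exact hlt
        · by_contra hd
          exact hzx (hA.eq_of_mem hd hzA hzr hxA hxq)
      · intro hqp
        obtain ⟨r, hr, rfl⟩ := hα.exists_lt hqp
        exact derivedSet_mono _ _ (subset_fibreUnion r)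
          ((h.isPPartition.mem_derivedSet_iff hxq).2 hr)
  base x U hU := by
    obtain ⟨q, A, hA, hxA⟩ := h.base x U hU
    exact ⟨α q, A, hA.fibreUnion hα, hxA⟩
  clean p x hx := by
    obtain ⟨q, rfl, hxq⟩ := mem_fibreUnion.1 hx
    obtain ⟨A, hA, hxA⟩ := h.clean q x hxq
    exact ⟨A, hA.fibreUnion hα, hxA⟩

/-- A morphism from the extended PO system of a bounded trim partition gives rise to a coarser
bounded trim partition. -/
theorem IsBoundedTrimExtPartition.exists_coarser [T2Space W] {G : ExtPOSystem Q}
    {E : ExtPOSystem P} (hY : IsBoundedTrimExtPartition G Y) (h : ExtPOSystem.Below G E) :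
    ∃ Z : P → Set W, IsBoundedTrimExtPartition E Z ∧ ∃ α, RegularlyRefinesVia Y Z α := by
  obtain ⟨α, hs, hα, hL, hsize⟩ := h
  have hU : IsCleanPartition (fibreUnion α Y) := hY.isTrim.isClean.fibreUnion hα hs
  have hYZ : ∀ q, Y q ⊆ trimPoints (fibreUnion α Y) (α q) := fun q =>
    (subset_fibreUnion q).trans (hU.subset_trimPoints _)
  have hUL : ∀ p ∈ E.L, fibreUnion α Y p ⊆ ⋃ q ∈ G.L, Y q := by
    intro p hp
    rw [hL] at hp
    exact biUnion_mono hp fun _ _ => Subset.rfl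
  have hZ := hU.isTrimPartition_trimPoints
  refine ⟨trimPoints (fibreUnion α Y), ⟨hZ, fun p => ⟨fun hp => ?_, fun hp => ?_⟩,
    fun p hp => ?_, ?_⟩, α, hYZ, hY.isTrim.base, hZ.base, fun p A hA => ?_⟩
  · rw [hL]
    rintro q rfl
    rw [← hY.compact_iff]
    exact hp.closure_of_subset ((hYZ q).trans subset_closure)
  · exact hY.bounded.closure_of_subset
      ((trimPoints_subset_closure p).trans (closure_mono (hUL p hp)))
  -- Discrete classes are not enlarged by the completion, so the count is that of the fibre union.
  · rw [hU.trimPoints_eq hp.2]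
    obtain ⟨hfin, hsum⟩ := hsize p hp
    exact (size_eq_sum hY hfin (ExtPOSystem.fibre_subset_Lmd G E α hα hL p hp)).2 hsum
  · exact hY.bounded.closure_of_subset (iUnion₂_subset fun p hp =>
      (trimPoints_subset_closure p).trans (closure_mono (hUL p hp)))
  · rw [← typeOf_fibreUnion, (hU.isTrimSet_trimPoints.1 hA).typeOf_eq]
    exact mem_up_self p

end Coarse

/-! ### Homeomorphisms between compact open sets -/

section SameType

variable {W : Type u} [TopologicalSpace W] [T2Space W]

/-- The sets `A` and `B` are homeomorphic. -/
abbrev SameType (A B : Set W) : Prop := Nonempty (↥A ≃ₜ ↥B)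

theorem SameType.refl (A : Set W) : SameType A A := ⟨Homeomorph.refl _⟩

theorem SameType.symm {A B : Set W} : SameType A B → SameType B A := fun ⟨h⟩ => ⟨h.symm⟩

theorem SameType.trans {A B C : Set W} : SameType A B → SameType B C → SameType A C :=
  fun ⟨h⟩ ⟨k⟩ => ⟨h.trans k⟩

theorem SameType.nonempty {A B : Set W} (h : SameType A B) (hA : A.Nonempty) : B.Nonempty := by
  obtain ⟨e⟩ := h
  obtain ⟨x, hx⟩ := hA
  exact ⟨e ⟨x, hx⟩, (e ⟨x, hx⟩).2⟩

/-- `B` is absorbed by `A`. -/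
abbrev AbsorbsSet (A B : Set W) : Prop := Nonempty ((↥A ⊕ ↥B) ≃ₜ ↥A)

theorem AbsorbsSet.congr {A A' B B' : Set W} (hA : SameType A A') (hB : SameType B B')
    (h : AbsorbsSet A B) : AbsorbsSet A' B' := by
  obtain ⟨a⟩ := hA
  obtain ⟨b⟩ := hB
  obtain ⟨e⟩ := h
  exact ⟨((a.symm.sumCongr b.symm).trans e).trans a⟩

theorem nonempty_sum_homeomorph_union {A B : Set W} (hA : IsCompactOpen A)
    (hB : IsCompactOpen B) (h : Disjoint A B) : Nonempty ((↥A ⊕ ↥B) ≃ₜ ↥(A ∪ B)) := by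
  have := isCompact_iff_compactSpace.1 hA.1
  have := isCompact_iff_compactSpace.1 hB.1
  classical
  have hc : Continuous (Equiv.Set.union h).symm :=
    (continuous_sum_dom.2 ⟨continuous_subtype_val.subtype_mk _,
      continuous_subtype_val.subtype_mk _⟩ : Continuous (Sum.elim
        (fun x : A => (⟨x, Or.inl x.2⟩ : ↥(A ∪ B))) fun x : B => ⟨x, Or.inr x.2⟩)).congr (by
      rintro (x | x) <;> rfl)
  exact ⟨hc.homeoOfEquivCompactToT2⟩

/-- The image in `B` of a subset of `A` under a homeomorphism from `A` to `B`. -/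
def transport {A B : Set W} (e : ↥A ≃ₜ ↥B) (C : Set W) : Set W :=
  (fun x : A => (e x : W)) '' (Subtype.val ⁻¹' C)

variable {A B C : Set W} {e : ↥A ≃ₜ ↥B}

theorem mem_transport {x : A} : (e x : W) ∈ transport e C ↔ ↑x ∈ C := by
  constructor
  · rintro ⟨y, hy, hyx⟩
    rwa [← e.injective (Subtype.ext hyx)]
  · exact fun hx => ⟨x, hx, rfl⟩

theorem transport_subset : transport e C ⊆ B := by
  rintro _ ⟨x, -, rfl⟩
  exact (e x).2

theorem transport_sdiff : transport e (A \ C) = B \ transport e C := by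
  ext y
  constructor
  · rintro ⟨x, hx, rfl⟩
    exact ⟨(e x).2, fun h => hx.2 (mem_transport.1 h)⟩
  · rintro ⟨hy, hyC⟩
    obtain ⟨x, hx⟩ := e.surjective ⟨y, hy⟩
    have hxy : (e x : W) = y := congrArg Subtype.val hx
    rw [← hxy] at hyC ⊢
    exact mem_transport.2 ⟨x.2, fun h => hyC (mem_transport.2 h)⟩

theorem sameType_transport (hC : C ⊆ A) : SameType C (transport e C) := by
  have h1 : IsEmbedding fun x : A => (e x : W) := IsEmbedding.subtypeVal.comp e.isEmbedding
  have h2 : C = Subtype.val '' (Subtype.val ⁻¹' C : Set A) := by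
    rw [image_preimage_eq_inter_range, Subtype.range_val, inter_eq_left.2 hC]
  exact ⟨((Homeomorph.setCongr h2).trans
    (IsEmbedding.subtypeVal.homeomorphImage _).symm).trans (h1.homeomorphImage _)⟩

theorem isCompactOpen_transport (hB : IsOpen B) (hC : IsCompactOpen C) (hCA : C ⊆ A) :
    IsCompactOpen (transport e C) := by
  have h1 : IsOpenEmbedding fun x : A => (e x : W) :=
    hB.isOpenEmbedding_subtypeVal.comp e.isOpenEmbedding
  refine ⟨?_, h1.isOpenMap _ (hC.2.preimage continuous_subtype_val)⟩
  refine IsCompact.image ?_ h1.continuous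
  rw [Topology.IsInducing.subtypeVal.isCompact_iff, image_preimage_eq_inter_range,
    Subtype.range_val, inter_eq_left.2 hCA]
  exact hC.1

theorem AbsorbsSet.exists_decomposition (hA : IsCompactOpen A) (hB : IsCompactOpen B)
    (h : AbsorbsSet A B) : ∃ A' B', IsCompactOpen A' ∧ IsCompactOpen B' ∧ Disjoint A' B' ∧
      A' ∪ B' = A ∧ SameType A' A ∧ SameType B' B := by
  obtain ⟨e⟩ := h
  have hcA := isCompact_iff_compactSpace.1 hA.1
  have hcB := isCompact_iff_compactSpace.1 hB.1
  have h1 : IsOpenEmbedding fun x : A => (e (Sum.inl x) : W) :=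
    hA.2.isOpenEmbedding_subtypeVal.comp (e.isOpenEmbedding.comp .inl)
  have h2 : IsOpenEmbedding fun x : B => (e (Sum.inr x) : W) :=
    hA.2.isOpenEmbedding_subtypeVal.comp (e.isOpenEmbedding.comp .inr)
  refine ⟨range fun x : A => (e (Sum.inl x) : W), range fun x : B => (e (Sum.inr x) : W),
    ⟨isCompact_range h1.continuous, h1.isOpen_range⟩,
    ⟨isCompact_range h2.continuous, h2.isOpen_range⟩, ?_, ?_,
    ⟨h1.isEmbedding.toHomeomorph.symm⟩, ⟨h2.isEmbedding.toHomeomorph.symm⟩⟩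
  · rw [Set.disjoint_left]
    rintro _ ⟨x, rfl⟩ ⟨y, hy⟩
    exact nomatch e.injective (Subtype.ext hy)
  · ext y
    constructor
    · rintro (⟨x, rfl⟩ | ⟨x, rfl⟩) <;> exact (e _).2
    · intro hy
      obtain ⟨x | x, hx⟩ := e.surjective ⟨y, hy⟩
      · exact Or.inl ⟨x, congrArg Subtype.val hx⟩
      · exact Or.inr ⟨x, congrArg Subtype.val hx⟩

end SameType

/-! ### Absorption by shifting along a convergent sequence -/

section Hotel

variable {W : Type u} [TopologicalSpace W] [T2Space W]

/-- A sequence of disjoint compact open sets converging to `z`. -/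
structure ConvergesTo (B : ℕ → Set W) (z : W) : Prop where
  isCompactOpen : ∀ n, IsCompactOpen (B n)
  disjoint : ∀ m n, m ≠ n → Disjoint (B m) (B n)
  tendsto : ∀ U ∈ 𝓝 z, ∃ n, ∀ m, n ≤ m → B m ⊆ U

open Classical in
/-- The map which shifts each `B n` to `B (n + 1)`. -/
noncomputable def shift (B : ℕ → Set W) (e : ∀ n, ↥(B n) ≃ₜ ↥(B (n + 1))) (x : W) : W :=
  if h : ∃ n, x ∈ B n then e h.choose ⟨x, h.choose_spec⟩ else x

variable {B : ℕ → Set W} {z : W} {e : ∀ n, ↥(B n) ≃ₜ ↥(B (n + 1))}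

theorem ConvergesTo.index_eq (h : ConvergesTo B z) {m n : ℕ} {x : W} (hm : x ∈ B m)
    (hn : x ∈ B n) : m = n := by
  by_contra hne
  exact disjoint_left.1 (h.disjoint m n hne) hm hn

theorem ConvergesTo.shift_of_mem (h : ConvergesTo B z) {n : ℕ} {x : W} (hx : x ∈ B n) :
    shift B e x = e n ⟨x, hx⟩ := by
  have hex : ∃ n, x ∈ B n := ⟨n, hx⟩
  rw [shift, dif_pos hex]
  have hn : hex.choose = n := h.index_eq hex.choose_spec hx
  have key : ∀ m (hm : x ∈ B m), m = n → (e m ⟨x, hm⟩ : W) = e n ⟨x, hx⟩ := by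
    rintro m hm rfl
    rfl
  exact key _ _ hn

theorem shift_of_notMem {x : W} (hx : ∀ n, x ∉ B n) : shift B e x = x :=
  dif_neg (not_exists.2 hx)

theorem ConvergesTo.shift_mem (h : ConvergesTo B z) {n : ℕ} {x : W} (hx : x ∈ B n) :
    shift B e x ∈ B (n + 1) := by
  rw [h.shift_of_mem hx]
  exact Subtype.prop _

/-- Only points outside all `B n` need care. Finitely many `B n` can be avoided; the later ones stay
near `z` after shifting, and away from `z` they miss a neighbourhood of the point. -/
theorem ConvergesTo.continuous_shift (h : ConvergesTo B z) : Continuous (shift B e) := by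
  rw [continuous_iff_continuousAt]
  intro x
  by_cases hx : ∃ n, x ∈ B n
  · obtain ⟨n, hn⟩ := hx
    have hc : ContinuousOn (shift B e) (B n) := by
      rw [continuousOn_iff_continuous_domRestrict]
      refine (continuous_subtype_val.comp (e n).continuous).congr fun y => ?_
      exact (h.shift_of_mem y.2).symm
    exact hc.continuousAt ((h.isCompactOpen n).mem_nhds hn)
  · rw [not_exists] at hx
    rw [ContinuousAt, shift_of_notMem hx, Filter.tendsto_def]
    intro N hN
    obtain ⟨n, M, hM, hn⟩ : ∃ n, ∃ M ∈ 𝓝 x, ∀ m, n ≤ m → ∀ y ∈ M, y ∈ B m →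
        shift B e y ∈ N := by
      by_cases hxz : x = z
      · obtain ⟨n, hn⟩ := h.tendsto N (hxz ▸ hN)
        exact ⟨n, univ, Filter.univ_mem, fun m hm y _ hy =>
          hn (m + 1) (by omega) (h.shift_mem hy)⟩
      · obtain ⟨M, U, hM, hU, hMU⟩ := t2_separation_nhds hxz
        obtain ⟨n, hn⟩ := h.tendsto U hU
        exact ⟨n, M, hM, fun m hm y hyM hy => (disjoint_left.1 hMU hyM (hn m hm hy)).elim⟩
    have hfin : (⋂ m ∈ Finset.range n, (B m)ᶜ) ∈ 𝓝 x :=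
      (Filter.biInter_finset_mem _).2 fun m _ => (h.isCompactOpen m).isClosed.compl_mem_nhds (hx m)
    filter_upwards [hN, hM, hfin] with y hyN hyM hyB
    by_cases hy : ∃ m, y ∈ B m
    · obtain ⟨m, hm⟩ := hy
      refine hn m ?_ y hyM hm
      by_contra hlt
      exact mem_iInter₂.1 hyB m (Finset.mem_range.2 (not_le.1 hlt)) hm
    · rw [mem_preimage, shift_of_notMem (not_exists.1 hy)]
      exact hyN

theorem ConvergesTo.injective_shift (h : ConvergesTo B z) : Function.Injective (shift B e) := by
  intro x y hxy
  by_cases hx : ∃ n, x ∈ B n <;> by_cases hy : ∃ n, y ∈ B n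
  · obtain ⟨m, hm⟩ := hx
    obtain ⟨n, hn⟩ := hy
    have h1 : shift B e x ∈ B (m + 1) := h.shift_mem hm
    have h2 : shift B e y ∈ B (n + 1) := h.shift_mem hn
    obtain rfl : m = n := Nat.succ_injective (h.index_eq h1 (hxy ▸ h2))
    rw [h.shift_of_mem hm, h.shift_of_mem hn] at hxy
    exact congrArg Subtype.val ((e m).injective (Subtype.ext hxy))
  · obtain ⟨m, hm⟩ := hx
    have h1 : shift B e x ∈ B (m + 1) := h.shift_mem hm
    rw [hxy, shift_of_notMem (not_exists.1 hy)] at h1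
    exact (hy ⟨_, h1⟩).elim
  · obtain ⟨m, hm⟩ := hy
    have h1 : shift B e y ∈ B (m + 1) := h.shift_mem hm
    rw [← hxy, shift_of_notMem (not_exists.1 hx)] at h1
    exact (hx ⟨_, h1⟩).elim
  · rwa [shift_of_notMem (not_exists.1 hx), shift_of_notMem (not_exists.1 hy)] at hxy

theorem ConvergesTo.shift_notMem (h : ConvergesTo B z) (x : W) : shift B e x ∉ B 0 := by
  intro hx
  by_cases hxB : ∃ n, x ∈ B n
  · obtain ⟨n, hn⟩ := hxB
    exact nomatch h.index_eq hx (h.shift_mem hn)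
  · rw [shift_of_notMem (not_exists.1 hxB)] at hx
    exact hxB ⟨0, hx⟩

/-- The shift maps `A` bijectively onto `A \ B 0`, which leaves `B 0` free for the second summand.
-/
theorem ConvergesTo.absorbs (h : ConvergesTo B z) (e : ∀ n, ↥(B n) ≃ₜ ↥(B (n + 1))) {A : Set W}
    (hA : IsCompactOpen A) (hBA : ∀ n, B n ⊆ A) : AbsorbsSet A (B 0) := by
  have := isCompact_iff_compactSpace.1 hA.1
  have := isCompact_iff_compactSpace.1 (h.isCompactOpen 0).1
  have hsA : ∀ x ∈ A, shift B e x ∈ A := by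
    intro x hx
    by_cases hxB : ∃ n, x ∈ B n
    · obtain ⟨n, hn⟩ := hxB
      exact hBA _ (h.shift_mem hn)
    · rwa [shift_of_notMem (not_exists.1 hxB)]
  let F : ↥A ⊕ ↥(B 0) → ↥A :=
    Sum.elim (fun x => ⟨shift B e x, hsA x x.2⟩) fun x => ⟨x, hBA 0 x.2⟩
  have hF : Continuous F := continuous_sum_dom.2
    ⟨(h.continuous_shift.comp continuous_subtype_val).subtype_mk _,
      continuous_subtype_val.subtype_mk _⟩
  have hbij : Function.Bijective F := by
    constructor
    · rintro (x | x) (y | y) hxy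
      · exact congrArg _ (Subtype.ext (h.injective_shift (congrArg Subtype.val hxy)))
      · exact (h.shift_notMem x.1 ((congrArg Subtype.val hxy : shift B e x = y) ▸ y.2)).elim
      · exact (h.shift_notMem y.1 ((congrArg Subtype.val hxy : (x : W) = shift B e y) ▸ x.2)).elim
      · exact congrArg _ (Subtype.ext (congrArg (Subtype.val : A → W) hxy))
    · rintro ⟨x, hx⟩
      by_cases hxB : ∃ n, x ∈ B n
      · obtain ⟨_ | n, hn⟩ := hxB
        · exact ⟨Sum.inr ⟨x, hn⟩, rfl⟩
        · refine ⟨Sum.inl ⟨(e n).symm ⟨x, hn⟩, hBA n (Subtype.prop _)⟩, Subtype.ext ?_⟩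
          refine (h.shift_of_mem ((e n).symm ⟨x, hn⟩).2).trans ?_
          simp
      · exact ⟨Sum.inl ⟨x, hx⟩, Subtype.ext (shift_of_notMem (not_exists.1 hxB))⟩
  exact ⟨hF.homeoOfEquivCompactToT2 (f := Equiv.ofBijective F hbij)⟩

/-- A compact open set absorbs `B` if copies of `B` accumulate at one of its points. -/
theorem absorbs_of_accumulate [FirstCountableTopology W] {A B : Set W} (hA : IsCompactOpen A)
    {z : W} (hz : z ∈ A)
    (h : ∀ U ∈ 𝓝 z, ∃ C, IsCompactOpen C ∧ C ⊆ U ∧ z ∉ C ∧ SameType C B) : AbsorbsSet A B := by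
  obtain ⟨U, hU⟩ := (𝓝 z).exists_antitone_basis
  choose! c hc hcU hzc hcB using h
  -- `V n` is what remains of `A` after removal of the first `n` copies. None of these contains `z`,
  -- so `V n` is still a neighbourhood of `z` and the next copy can be chosen inside it.
  let V : ℕ → Set W := fun n => Nat.rec A (fun n V => V \ c (V ∩ U n)) n
  have hV : ∀ n, V n ∈ 𝓝 z := by
    intro n
    induction n with
    | zero => exact hA.mem_nhds hz
    | succ n ih =>
      have h1 : V n ∩ U n ∈ 𝓝 z := Filter.inter_mem ih (hU.mem n)
      exact Filter.inter_mem ih ((hc _ h1).isClosed.compl_mem_nhds (hzc _ h1))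
  have hVU : ∀ n, V n ∩ U n ∈ 𝓝 z := fun n => Filter.inter_mem (hV n) (hU.mem n)
  have hanti : Antitone V := antitone_nat_of_succ_le fun n => sdiff_subset
  have hcV : ∀ n, c (V n ∩ U n) ⊆ V n := fun n => (hcU _ (hVU n)).trans inter_subset_left
  have hlt : ∀ m n, m < n → Disjoint (c (V m ∩ U m)) (c (V n ∩ U n)) := by
    intro m n hmn
    refine disjoint_left.2 fun x hx hx' => ?_
    have h1 : x ∈ V (m + 1) := hanti hmn (hcV n hx')
    exact h1.2 hx
  have hconv : ConvergesTo (fun n => c (V n ∩ U n)) z := by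
    refine ⟨fun n => hc _ (hVU n), fun m n hmn => ?_, fun N hN => ?_⟩
    · rcases lt_or_gt_of_ne hmn with hmn | hmn
      · exact hlt m n hmn
      · exact (hlt n m hmn).symm
    · obtain ⟨n, -, hn⟩ := hU.1.mem_iff.1 hN
      exact ⟨n, fun m hm => ((hcU _ (hVU m)).trans inter_subset_right).trans
        ((hU.2 hm).trans hn)⟩
  have e : ∀ n, Nonempty (↥(c (V n ∩ U n)) ≃ₜ ↥(c (V (n + 1) ∩ U (n + 1)))) := fun n =>
    (hcB _ (hVU n)).trans (hcB _ (hVU (n + 1))).symm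
  exact (hconv.absorbs (fun n => (e n).some) hA fun n => (hcV n).trans (hanti n.zero_le)).congr
    (SameType.refl A) (hcB _ (hVU 0))

end Hotel

/-! ### The canonical partition -/

section Canonical

variable {W : Type u} [TopologicalSpace W] [T2Space W] {A B C : Set W}

theorem IsPI.isCompactOpen (h : IsPI A) : IsCompactOpen A := ⟨h.1, h.2.1⟩

theorem IsPI.of_sameType (hA : IsPI A) (hB : IsCompactOpen B) (h : SameType A B) : IsPI B := by
  refine ⟨hB.1, hB.2, h.nonempty hA.2.2.1, fun C hC hCo hCB => ?_⟩
  obtain ⟨e⟩ := h.symm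
  have h1 := isCompactOpen_transport (e := e) hA.2.1 ⟨hC, hCo⟩ hCB
  have h2 : SameType (B \ C) (A \ transport e C) :=
    transport_sdiff (e := e) (C := C) ▸ sameType_transport (e := e) sdiff_subset
  rcases hA.2.2.2 _ h1.1 h1.2 transport_subset with h3 | h3
  · exact Or.inl (((sameType_transport hCB).trans h3).trans h)
  · exact Or.inr ((h2.trans h3).trans h)

/-- If `B` is not a copy of `A`, then `A \ B` is, and `A` is the disjoint sum of this copy and `B`.
-/
theorem IsPI.sameType_or_absorbsSet (hA : IsPI A) (hB : IsCompactOpen B) (hBA : B ⊆ A) :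
    SameType A B ∨ AbsorbsSet A B := by
  rcases hA.2.2.2 B hB.1 hB.2 hBA with h | h
  · exact Or.inl (SameType.symm h)
  · right
    obtain ⟨e⟩ := nonempty_sum_homeomorph_union (hA.isCompactOpen.diff hB) hB disjoint_sdiff_left
    rw [sdiff_union_of_subset hBA] at e
    obtain ⟨f⟩ := h
    exact ⟨(f.symm.sumCongr (Homeomorph.refl B)).trans e⟩

theorem StructureDiagram.mk_eq_mk {A B : {A : Set W // IsPI A}} :
    StructureDiagram.mk A = StructureDiagram.mk B ↔ SameType A.1 B.1 := Quotient.eq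

theorem StructureDiagram.exists_mk (p : StructureDiagram W) :
    ∃ A : {A : Set W // IsPI A}, StructureDiagram.mk A = p := Quotient.exists_rep p

theorem StructureDiagram.mk_le_mk_of_subset {A B : {A : Set W // IsPI A}} (h : B.1 ⊆ A.1) :
    Le (StructureDiagram.mk A) (StructureDiagram.mk B) := by
  rcases A.2.sameType_or_absorbsSet B.2.isCompactOpen h with h | h
  · exact Or.inr (StructureDiagram.mk_eq_mk.2 h)
  · exact Or.inl h

theorem mem_canonicalPart_mk {A : {A : Set W // IsPI A}} {x : W} :
    x ∈ canonicalPart W (StructureDiagram.mk A) ↔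
      ∀ U ∈ 𝓝 x, ∃ B, IsCompactOpen B ∧ SameType B A.1 ∧ x ∈ B ∧ B ⊆ U := by
  refine forall_congr' fun U => imp_congr_right fun _ => ?_
  constructor
  · rintro ⟨B, hB, hxB⟩
    exact ⟨B.1, B.2.isCompactOpen, StructureDiagram.mk_eq_mk.1 hB, hxB⟩
  · rintro ⟨B, hB, hBA, hxB⟩
    exact ⟨⟨B, A.2.of_sameType hB hBA.symm⟩, StructureDiagram.mk_eq_mk.2 hBA, hxB⟩

theorem canonicalPart.apply_mem {p : StructureDiagram W} (hA : IsOpen A) (hB : IsOpen B)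
    (e : ↥A ≃ₜ ↥B) {x : A} (hx : ↑x ∈ canonicalPart W p) : ↑(e x) ∈ canonicalPart W p := by
  obtain ⟨D, rfl⟩ := p.exists_mk
  rw [mem_canonicalPart_mk] at hx ⊢
  intro U hU
  have hV : Subtype.val '' ((fun x : A => (e x : W)) ⁻¹' U) ∈ 𝓝 (x : W) :=
    hA.isOpenMap_subtype_val.image_mem_nhds
      ((continuous_subtype_val.comp e.continuous).continuousAt.preimage_mem_nhds hU)
  obtain ⟨C, hC, hCD, hxC, hCV⟩ := hx _ hV
  have hCA : C ⊆ A := hCV.trans (by rintro _ ⟨y, -, rfl⟩; exact y.2)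
  refine ⟨transport e C, isCompactOpen_transport hB hC hCA,
    (sameType_transport hCA).symm.trans hCD, mem_transport.2 hxC, ?_⟩
  rintro _ ⟨y, hy, rfl⟩
  obtain ⟨z, hz, hzy⟩ := hCV hy
  rw [← Subtype.ext hzy]
  exact hz

theorem canonicalPart.exists_mem_sameType {p : StructureDiagram W} (hA : IsOpen A)
    (hB : IsOpen B) (h : SameType A B) (hx : p ∈ typeOf (canonicalPart W) A) :
    p ∈ typeOf (canonicalPart W) B := by
  obtain ⟨e⟩ := h
  obtain ⟨x, hx, hxp⟩ := hx
  exact ⟨e ⟨x, hx⟩, Subtype.prop _, canonicalPart.apply_mem hA hB e (x := ⟨x, hx⟩) hxp⟩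

theorem canonicalPart.le_of_mem {A : {A : Set W // IsPI A}} {p : StructureDiagram W}
    (h : p ∈ typeOf (canonicalPart W) A.1) : Le (StructureDiagram.mk A) p := by
  obtain ⟨x, hx, hxp⟩ := h
  obtain ⟨B, rfl, -, hBA⟩ := hxp A.1 (A.2.isCompactOpen.mem_nhds hx)
  exact StructureDiagram.mk_le_mk_of_subset hBA

theorem canonicalPart.eq_of_mem {p q : StructureDiagram W} {x : W}
    (hp : x ∈ canonicalPart W p) (hq : x ∈ canonicalPart W q) : p = q := by
  have key : ∀ p q, x ∈ canonicalPart W p → x ∈ canonicalPart W q → Le p q := by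
    intro p q hp hq
    obtain ⟨A, rfl, hxA, -⟩ := hp univ Filter.univ_mem
    exact canonicalPart.le_of_mem ⟨x, hxA, hq⟩
  exact (key p q hp hq).antisymm (key q p hq hp)

theorem exists_compactOpen_subset [LocallyCompactSpace W] [TotallyDisconnectedSpace W] {x : W}
    {U : Set W} (hU : U ∈ 𝓝 x) : ∃ C, IsCompactOpen C ∧ x ∈ C ∧ C ⊆ U := by
  obtain ⟨K, hK, hKU, hKc⟩ := local_compact_nhds hU
  obtain ⟨C, hC, hxC, hCK⟩ := loc_compact_Haus_tot_disc_of_zero_dim.mem_nhds_iff.1 hK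
  exact ⟨C, ⟨hKc.of_isClosed_subset hC.1 hCK, hC.2⟩, hxC, hCK.trans hKU⟩

variable [LocallyCompactSpace W] [TotallyDisconnectedSpace W] [SecondCountableTopology W]

/-- Every pseudo-indecomposable set contains a point all of whose neighbourhoods contain smaller
copies of the set that contain the point. -/
theorem IsPI.mem_typeOf (hA : IsPI A) :
    StructureDiagram.mk ⟨A, hA⟩ ∈ typeOf (canonicalPart W) A := by
  obtain ⟨E, hE, hE'⟩ := exists_enumeration (countable_compactOpen W)
  let St := {C : Set W // IsCompactOpen C ∧ SameType C A}
  -- Of the two parts into which `E n` cuts a copy of `A`, one is again a copy. Iteration gives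
  -- nested copies deciding every compact open set, and they shrink to the desired point.
  have step : ∀ (C : St) (n : ℕ), ∃ D : St, D.1 ⊆ C.1 ∧ (D.1 ⊆ E n ∨ Disjoint D.1 (E n)) := by
    rintro ⟨C, hC, hCA⟩ n
    have h1 := hC.inter (hE n)
    rcases (hA.of_sameType hC hCA.symm).2.2.2 _ h1.1 h1.2 inter_subset_left with h | h
    · exact ⟨⟨C ∩ E n, h1, SameType.trans h hCA⟩, inter_subset_left, Or.inl inter_subset_right⟩
    · refine ⟨⟨C \ (C ∩ E n), hC.diff h1, SameType.trans h hCA⟩, sdiff_subset, Or.inr ?_⟩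
      exact disjoint_left.2 fun x hx hx' => hx.2 ⟨hx.1, hx'⟩
  choose next hnext hdec using step
  let Q : ℕ → St := fun n =>
    Nat.rec ⟨A, hA.isCompactOpen, SameType.refl A⟩ (fun n C => next C n) n
  obtain ⟨x, hx⟩ : (⋂ n, (Q n).1).Nonempty :=
    IsCompact.nonempty_iInter_of_sequence_nonempty_isCompact_isClosed (fun n => (Q n).1)
      (fun n => hnext _ n) (fun n => (Q n).2.2.symm.nonempty hA.2.2.1) (Q 0).2.1.1
      fun n => (Q n).2.1.isClosed
  rw [mem_iInter] at hx
  refine ⟨x, hx 0, mem_canonicalPart_mk.2 fun U hU => ?_⟩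
  obtain ⟨C, hC, hxC, hCU⟩ := exists_compactOpen_subset hU
  obtain ⟨n, rfl⟩ := hE' C hC
  have hn : (Q (n + 1)).1 ⊆ E n :=
    (hdec (Q n) n).resolve_right fun h => disjoint_left.1 h (hx (n + 1)) hxC
  exact ⟨(Q (n + 1)).1, (Q (n + 1)).2.1, (Q (n + 1)).2.2, hx (n + 1), hn.trans hCU⟩

theorem IsPI.mem_typeOf_of_sameType (hA : IsPI A) (hB : IsCompactOpen B) (h : SameType A B) :
    StructureDiagram.mk ⟨A, hA⟩ ∈ typeOf (canonicalPart W) B :=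
  canonicalPart.exists_mem_sameType hA.2.1 hB.2 h hA.mem_typeOf

/-- Near `x` there are points of class `p` other than `x`, hence copies of a PI set of class `p`
that avoid `x`; accumulation at `x` yields absorption. -/
theorem canonicalPart.lt_of_mem_derivedSet {p q : StructureDiagram W} {x : W}
    (hq : x ∈ canonicalPart W q) (hx : x ∈ derivedSet (canonicalPart W p)) : q < p := by
  obtain ⟨A, rfl, hxA, -⟩ := hq univ Filter.univ_mem
  obtain ⟨B, rfl⟩ := p.exists_mk
  refine absorbs_of_accumulate A.2.isCompactOpen hxA fun U hU => ?_
  obtain ⟨y, ⟨hyU, hyp⟩, hyx⟩ := accPt_iff_nhds.1 hx (interior U) (interior_mem_nhds.2 hU)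
  obtain ⟨C, hC, hCB, -, hCU⟩ := mem_canonicalPart_mk.1 hyp _
    ((isOpen_interior.sdiff (isClosed_singleton (x := x))).mem_nhds ⟨hyU, hyx⟩)
  exact ⟨C, hC, (hCU.trans sdiff_subset).trans interior_subset, fun hxC => (hCU hxC).2 rfl, hCB⟩

theorem canonicalPart.mem_derivedSet_of_lt {p q : StructureDiagram W} {x : W}
    (hq : x ∈ canonicalPart W q) (hqp : q < p) : x ∈ derivedSet (canonicalPart W p) := by
  obtain ⟨⟨B, hB⟩, rfl⟩ := p.exists_mk
  rw [mem_derivedSet, accPt_iff_nhds]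
  intro U hU
  obtain ⟨⟨A, hA⟩, rfl, hxA, hAU⟩ := hq U hU
  -- Splitting twice gives two disjoint copies of `B` inside `A`. At least one misses `x`, and it
  -- contains a point with the label of `B`.
  obtain ⟨A₁, B₁, hA₁, hB₁, hd₁, hu₁, hAA₁, hBB₁⟩ :=
    AbsorbsSet.exists_decomposition hA.isCompactOpen hB.isCompactOpen hqp
  obtain ⟨A₂, B₂, hA₂, hB₂, hd₂, hu₂, hAA₂, hBB₂⟩ :=
    (AbsorbsSet.congr hAA₁.symm (SameType.refl B) hqp).exists_decomposition hA₁ hB.isCompactOpen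
  have hB₁A : B₁ ⊆ A := hu₁ ▸ subset_union_right
  have hB₂A₁ : B₂ ⊆ A₁ := hu₂ ▸ subset_union_right
  have hA₁A : A₁ ⊆ A := hu₁ ▸ subset_union_left
  by_cases hxB : x ∈ B₁
  · obtain ⟨y, hy, hyp⟩ := hB.mem_typeOf_of_sameType hB₂ hBB₂.symm
    exact ⟨y, ⟨hAU (hA₁A (hB₂A₁ hy)), hyp⟩,
      fun hyx => disjoint_left.1 hd₁ (hB₂A₁ hy) (hyx ▸ hxB)⟩
  · obtain ⟨y, hy, hyp⟩ := hB.mem_typeOf_of_sameType hB₁ hBB₁.symm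
    exact ⟨y, ⟨hAU (hB₁A hy), hyp⟩, fun hyx => hxB (hyx ▸ hy)⟩

theorem isPPartition_canonicalPart : IsPPartition (canonicalPart W) := by
  refine isPPartition_of (fun p => ?_) (fun p q x => canonicalPart.eq_of_mem) fun p q x hx =>
    ⟨canonicalPart.lt_of_mem_derivedSet hx, canonicalPart.mem_derivedSet_of_lt hx⟩
  obtain ⟨⟨A, hA⟩, rfl⟩ := p.exists_mk
  obtain ⟨x, -, hx⟩ := hA.mem_typeOf
  exact ⟨x, hx⟩

/-- Pseudo-indecomposable sets are trim with respect to the canonical partition. -/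
theorem IsPI.isTrimSet (hA : IsPI A) :
    IsTrimSet (canonicalPart W) (StructureDiagram.mk ⟨A, hA⟩) A := by
  refine isTrimSet_of hA.isCompactOpen (Subset.antisymm (fun p hp => ?_) fun p hp => ?_) ?_
  · exact canonicalPart.le_of_mem (A := ⟨A, hA⟩) hp
  · exact isPPartition_canonicalPart.mem_typeOf_of_le hA.2.1 hA.mem_typeOf hp
  · intro hd x hx hxp y hy hyp
    by_contra hne
    refine hd (canonicalPart.lt_of_mem_derivedSet hxp ?_)
    rw [mem_derivedSet, accPt_iff_nhds]
    intro U hU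
    -- A small copy of `A` near `x` contains images of both `x` and `y`. At most one of these is
    -- `x`, so `x` is a limit of its own class, contrary to discreteness.
    obtain ⟨B, hB, ⟨e⟩, -, hBU⟩ := mem_canonicalPart_mk.1 hxp U hU
    have h1 := canonicalPart.apply_mem hA.2.1 hB.2 e.symm (x := ⟨x, hx⟩) hxp
    have h2 := canonicalPart.apply_mem hA.2.1 hB.2 e.symm (x := ⟨y, hy⟩) hyp
    by_cases hxe : (e.symm ⟨x, hx⟩ : W) = x
    · refine ⟨_, ⟨hBU (Subtype.prop _), h2⟩, fun hye => hne ?_⟩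
      have := e.symm.injective (Subtype.ext (hxe.trans hye.symm))
      exact congrArg Subtype.val this
    · exact ⟨_, ⟨hBU (Subtype.prop _), h1⟩, hxe⟩

theorem sameType_union_sUnion {S : Set (Set W)} (hS : S.Finite) (hA : IsCompactOpen A)
    (hdis : S.PairwiseDisjoint id) (h : ∀ B ∈ S, IsCompactOpen B ∧ Disjoint A B ∧ AbsorbsSet A B) :
    SameType (A ∪ ⋃₀ S) A := by
  induction S, hS using Set.Finite.induction_on with
  | empty =>
    rw [sUnion_empty, union_empty]
    exact SameType.refl A
  | @insert B S hBS hS ih =>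
    have h1 : SameType (A ∪ ⋃₀ S) A := ih (hdis.subset (subset_insert _ _)) fun C hC =>
      h C (mem_insert_of_mem _ hC)
    obtain ⟨hB, hAB, habs⟩ := h B (mem_insert _ _)
    have hScomp : IsCompactOpen (A ∪ ⋃₀ S) := by
      refine hA.union ⟨hS.isCompact_sUnion fun C hC => ?_, isOpen_sUnion fun C hC => ?_⟩
      · exact (h C (mem_insert_of_mem _ hC)).1.1
      · exact (h C (mem_insert_of_mem _ hC)).1.2
    have hd : Disjoint (A ∪ ⋃₀ S) B := by
      rw [disjoint_union_left, disjoint_sUnion_left]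
      refine ⟨hAB, fun C hC => hdis (mem_insert_of_mem _ hC) (mem_insert _ _) ?_⟩
      rintro rfl
      exact hBS hC
    obtain ⟨e⟩ := nonempty_sum_homeomorph_union hScomp hB hd
    obtain ⟨f⟩ := AbsorbsSet.congr h1.symm (SameType.refl B) habs
    rw [sUnion_insert, union_comm B, ← union_assoc]
    exact SameType.trans ⟨e.symm.trans f⟩ h1

/-- Trim sets of the canonical partition of a primitive space are pseudo-indecomposable. -/
theorem IsTrimSet.exists_isPI (hW : IsPrimitive W) {p : StructureDiagram W}
    (h : IsTrimSet (canonicalPart W) p A) : ∃ hA : IsPI A, StructureDiagram.mk ⟨A, hA⟩ = p := by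
  obtain ⟨S, hfin, hPI, hdis, rfl⟩ := hW A h.1 h.2.1
  obtain ⟨x, ⟨B, hBS, hxB⟩, hxp⟩ := h.nonempty
  have hB := hPI B hBS
  have hBp : StructureDiagram.mk ⟨B, hB⟩ = p := by
    refine (canonicalPart.le_of_mem ⟨x, hxB, hxp⟩).antisymm ?_
    have := typeOf_mono (subset_sUnion_of_mem hBS) hB.mem_typeOf
    rwa [h.typeOf_eq] at this
  -- The piece `B` containing a point labelled `p` absorbs the other pieces, so the whole set is a
  -- copy of `B`.
  have key : SameType (B ∪ ⋃₀ (S \ {B})) B := by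
    refine sameType_union_sUnion (hfin.subset sdiff_subset) hB.isCompactOpen
      (hdis.subset sdiff_subset) ?_
    rintro C ⟨hCS, hCB⟩
    have hC := hPI C hCS
    have hBC : Disjoint B C := hdis hBS hCS (Ne.symm hCB)
    refine ⟨hC.isCompactOpen, hBC, ?_⟩
    have h1 : StructureDiagram.mk ⟨B, hB⟩ < StructureDiagram.mk ⟨C, hC⟩ := by
      obtain ⟨y, hyC, hy⟩ := hC.mem_typeOf
      have h2 := h.le (subset_sUnion_of_mem hCS hyC) hy
      rw [hBp]
      -- If another piece also has class `p`, the trim set has two points labelled `p`, so `p` is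
      -- not discrete and `p < p`.
      rcases h2 with h2 | h2
      · exact h2
      · rw [← h2] at hy ⊢
        by_contra hd
        have hxy := h.eq_of_mem hd (subset_sUnion_of_mem hBS hxB) hxp
          (subset_sUnion_of_mem hCS hyC) hy
        exact disjoint_left.1 hBC hxB (hxy ▸ hyC)
    exact h1
  have hu : B ∪ ⋃₀ (S \ {B}) = ⋃₀ S := by
    rw [← sUnion_insert, insert_sdiff_singleton, insert_eq_of_mem hBS]
  rw [hu] at key
  refine ⟨hB.of_sameType h.isCompactOpen key.symm, ?_⟩
  exact (StructureDiagram.mk_eq_mk.2 key).trans hBp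

/-- The canonical partition of a primitive space is a trim partition. -/
theorem isTrimPartition_canonicalPart (hW : IsPrimitive W) :
    IsTrimPartition (canonicalPart W) where
  isPPartition := isPPartition_canonicalPart
  base x U hU := by
    obtain ⟨C, hC, hxC, hCU⟩ := exists_compactOpen_subset hU
    obtain ⟨S, -, hPI, -, rfl⟩ := hW C hC.1 hC.2
    obtain ⟨B, hBS, hxB⟩ := hxC
    exact ⟨_, B, (hPI B hBS).isTrimSet, hxB, (subset_sUnion_of_mem hBS).trans hCU⟩
  full p _ x hx U hU := by
    obtain ⟨A, hA, hxA⟩ := hx U hU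
    obtain ⟨hPI, hp⟩ := hA.exists_isPI hW
    exact ⟨⟨A, hPI⟩, hp, hxA⟩
  clean p x hx := by
    obtain ⟨⟨A, hA⟩, rfl, hxA, -⟩ := hx univ Filter.univ_mem
    exact ⟨A, hA.isTrimSet, hxA⟩

variable {Q : Type v} [POSystem Q] {Y : Q → Set W}

theorem IsTrimPartition.sameType (hY : IsTrimPartition Y) {q : Q} (hA : IsTrimSet Y q A)
    (hB : IsTrimSet Y q B) : SameType A B := by
  obtain ⟨e, -⟩ := (hA.trimEquiv hB).exists_homeomorph (countable_compactOpen W)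
    (countable_compactOpen W) hY hY
  exact ⟨e⟩

/-- A point of `A ∩ Y q` lies in `B` or in `A \ B`; that part is again `q`-trim, and trim sets with
the same label are homeomorphic. -/
theorem IsTrimPartition.isPI (hY : IsTrimPartition Y) {q : Q} (hA : IsTrimSet Y q A) :
    IsPI A := by
  refine ⟨hA.1, hA.2.1, hA.nonempty.mono inter_subset_left, fun B hB hBo hBA => ?_⟩
  obtain ⟨x, hxA, hxq⟩ := hA.nonempty
  by_cases hxB : x ∈ B
  · exact Or.inl (hY.sameType
      (hY.isPPartition.isTrimSet_of_subset hA ⟨hB, hBo⟩ hBA hxB hxq) hA)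
  · exact Or.inr (hY.sameType (hY.isPPartition.isTrimSet_of_subset hA
      (hA.isCompactOpen.diff ⟨hB, hBo⟩) sdiff_subset ⟨hxA, hxB⟩ hxq) hA)

/-- Every trim partition of a primitive space regularly refines the canonical partition. -/
theorem IsTrimPartition.regularlyRefines_canonicalPart (hY : IsTrimPartition Y)
    (hW : IsPrimitive W) : ∃ α, RegularlyRefinesVia Y (canonicalPart W) α := by
  have hex : ∀ q, ∃ A, IsTrimSet Y q A := fun q => by
    obtain ⟨x, hx⟩ := hY.isPPartition.nonempty q
    obtain ⟨A, hA, -⟩ := hY.clean q x hx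
    exact ⟨A, hA⟩
  choose A hA using hex
  have hsub : ∀ q, Y q ⊆ canonicalPart W (StructureDiagram.mk ⟨A q, hY.isPI (hA q)⟩) := by
    intro q x hx
    rw [mem_canonicalPart_mk]
    intro U hU
    obtain ⟨B, hB, hxB, hBU⟩ := hY.isClean.exists_trimSet hx hU
    exact ⟨B, hB.isCompactOpen, hY.sameType hB (hA q), hxB, hBU⟩
  refine ⟨fun q => StructureDiagram.mk ⟨A q, hY.isPI (hA q)⟩, hsub, hY.base,
    (isTrimPartition_canonicalPart hW).base, fun p C hC => ?_⟩
  obtain ⟨x, hxC, hxp⟩ := hC.nonempty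
  -- The class of `B` is below `p` because `B` contains a point labelled `p`, and above `p` because
  -- `B` lies in the `p`-trim set `C`.
  obtain ⟨q, B, hB, hxB, hBC⟩ := hY.base x C (hC.isCompactOpen.mem_nhds hxC)
  have hBq : StructureDiagram.mk ⟨B, hY.isPI hB⟩ = StructureDiagram.mk ⟨A q, hY.isPI (hA q)⟩ :=
    StructureDiagram.mk_eq_mk.2 (hY.sameType hB (hA q))
  refine ⟨q, typeOf_mono hBC hB.nonempty, ?_⟩
  change StructureDiagram.mk ⟨A q, hY.isPI (hA q)⟩ = p
  rw [← hBq]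
  refine (canonicalPart.le_of_mem ⟨x, hxB, hxp⟩).antisymm ?_
  have := typeOf_mono hBC (hY.isPI hB).mem_typeOf
  rwa [hC.typeOf_eq] at this

end Canonical

/-! ### The main theorem -/

section Main

variable {W : Type u} [TopologicalSpace W] [T2Space W]

namespace BoundedTrimPartition

/-- The extended PO system of a bounded trim partition. -/
noncomputable def extPOSystem (Y : BoundedTrimPartition W) : ExtPOSystem Y.carrier :=
  Y.isBoundedTrim.isTrim.ext

theorem isBoundedTrimExtPartition (Y : BoundedTrimPartition W) :
    IsBoundedTrimExtPartition Y.extPOSystem Y.part :=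
  Y.isBoundedTrim.isBoundedTrimExtPartition

/-- The class in `𝒫(W)` of a bounded trim partition. -/
noncomputable def toExtClass (Y : BoundedTrimPartition W) : ExtClasses W :=
  ExtClasses.mk Y.extPOSystem ⟨Y.part, Y.isBoundedTrimExtPartition⟩

theorem toExtClass_eq {Y Z : BoundedTrimPartition W} (h : Y ≈ Z) :
    Y.toExtClass = Z.toExtClass := by
  obtain ⟨g, σ, hσ, hg⟩ := h
  exact Subtype.ext (Quotient.sound
    ⟨σ, Y.isBoundedTrimExtPartition.isExtIso Z.isBoundedTrimExtPartition g hσ hg⟩)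

theorem extClass_eq_of_isBoundedTrimExtPartition (Y : BoundedTrimPartition W)
    {E : ExtPOSystem Y.carrier} (h : IsBoundedTrimExtPartition E Y.part) :
    extClass Y.extPOSystem = extClass E :=
  Quotient.sound ⟨Equiv.refl _, Y.isBoundedTrimExtPartition.isExtIso h (Homeomorph.refl W)
    (fun _ _ => Iff.rfl) fun _ => image_id _⟩

end BoundedTrimPartition

/-- The map `θ`. -/
noncomputable def TrimClasses.toExtClasses : TrimClasses W → ExtClasses W :=
  Quotient.lift BoundedTrimPartition.toExtClass fun _ _ => BoundedTrimPartition.toExtClass_eq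

theorem ExtClasses.prec_iff {P Q : Type u} [POSystem P] [POSystem Q] {G : ExtPOSystem Q}
    {E : ExtPOSystem P} {d e : ExtClasses W} (hG : extClass G = d.1) (hE : extClass E = e.1) :
    d.Prec e ↔ ExtPOSystem.Below G E := by
  constructor
  · rintro ⟨G', E', hG', hE', h⟩
    exact ((below_of_extClass_eq (hG.trans hG'.symm)).trans h).trans
      (below_of_extClass_eq (hE'.trans hE.symm))
  · exact fun h => ⟨⟨Q, G⟩, ⟨P, E⟩, hG, hE, h⟩

theorem ExtClasses.isPreorder_prec : IsPreorder (ExtClasses W) ExtClasses.Prec where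
  refl d := by
    obtain ⟨d, F, rfl, hX⟩ := d
    exact ⟨F, F, rfl, rfl, below_of_extClass_eq rfl⟩
  trans c d e := by
    rintro ⟨F, G, hF, hG, hFG⟩ ⟨G', H, hG', hH, hGH⟩
    exact ⟨F, H, hF, hH, (hFG.trans (below_of_extClass_eq (hG.trans hG'.symm))).trans hGH⟩

variable [LocallyCompactSpace W] [SecondCountableTopology W]

theorem TrimClasses.mk_eq_mk_of_isExtIso {Y Z : BoundedTrimPartition W}
    {E : ExtPOSystem Z.carrier} (hE : IsBoundedTrimExtPartition E Z.part)
    (h : extClass Y.extPOSystem = extClass E) : TrimClasses.mk Y = TrimClasses.mk Z := by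
  obtain ⟨σ, hσ⟩ := Quotient.exact h
  obtain ⟨g, hg⟩ := Y.isBoundedTrimExtPartition.exists_homeomorph (countable_compactOpen W)
    (countable_compactOpen W) (hE.relabel hσ)
  exact Quotient.sound ⟨g, σ, hσ.1, hg⟩

theorem TrimClasses.bijective_toExtClasses :
    Function.Bijective (TrimClasses.toExtClasses (W := W)) := by
  constructor
  · intro s t
    induction s, t using Quotient.inductionOn₂ with
    | _ Y Z =>
      intro h
      exact TrimClasses.mk_eq_mk_of_isExtIso Z.isBoundedTrimExtPartition (congrArg Subtype.val h)
  · rintro ⟨_, F, rfl, X, hX⟩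
    let Y : BoundedTrimPartition W := ⟨F.carrier, X, hX.isBoundedTrimPartition⟩
    exact ⟨TrimClasses.mk Y, Subtype.ext (Y.extClass_eq_of_isBoundedTrimExtPartition hX)⟩

theorem TrimClasses.prec_toExtClasses_iff (s t : TrimClasses W) :
    s.toExtClasses.Prec t.toExtClasses ↔ s.Prec t := by
  constructor
  · induction s, t using Quotient.inductionOn₂ with
    | _ Y Z =>
      intro h
      have hb : ExtPOSystem.Below Y.extPOSystem Z.extPOSystem :=
        (ExtClasses.prec_iff rfl rfl).1 h
      obtain ⟨X, hX, α, hα⟩ := Y.isBoundedTrimExtPartition.exists_coarser hb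
      let Z' : BoundedTrimPartition W := ⟨Z.carrier, X, hX.isBoundedTrimPartition⟩
      -- The partition refined by `Y` need not be that of `Z`, but it has the same extended PO
      -- system and so, by uniqueness, represents the same class.
      refine ⟨Y, Z', rfl, ?_, α, hα⟩
      exact (TrimClasses.mk_eq_mk_of_isExtIso (Z := Z') hX rfl).symm
  · rintro ⟨Y, Z, rfl, rfl, α, hα⟩
    exact (ExtClasses.prec_iff rfl rfl).2
      (hα.below Y.isBoundedTrimExtPartition Z.isBoundedTrimExtPartition)

/-- Two refinements of classes need not share a middle representative, so transitivity is
transferred from extended PO systems, where it is composition of morphisms. -/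
theorem TrimClasses.isPreorder_prec : IsPreorder (TrimClasses W) TrimClasses.Prec where
  refl s := (TrimClasses.prec_toExtClasses_iff s s).1 (ExtClasses.isPreorder_prec.refl _)
  trans r s t h k := by
    rw [← TrimClasses.prec_toExtClasses_iff] at h k ⊢
    exact ExtClasses.isPreorder_prec.trans _ _ _ h k

end Main

theorem mainTheorem1 (W : Type u) [TopologicalSpace W] [T2Space W] [LocallyCompactSpace W]
    [TotallyDisconnectedSpace W] [SecondCountableTopology W] (hW : IsBoundedStoneSpace W) :
    IsPreorder (TrimClasses W) TrimClasses.Prec ∧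
    IsPreorder (ExtClasses W) ExtClasses.Prec ∧
    ∃ θ : TrimClasses W ≃ ExtClasses W,
      (∀ s t : TrimClasses W, (θ s).Prec (θ t) ↔ s.Prec t) ∧
      (∀ Y : BoundedTrimPartition W, ∃ (E : ExtPOSystem Y.carrier)
        (hE : IsBoundedTrimExtPartition E Y.part),
        θ (TrimClasses.mk Y) = ExtClasses.mk E ⟨Y.part, hE⟩) ∧
      ∃ (hX : IsBoundedTrimPartition (canonicalPart W)) (E : ExtPOSystem (StructureDiagram W))
        (hE : IsBoundedTrimExtPartition E (canonicalPart W)),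
        θ (TrimClasses.mk ⟨StructureDiagram W, canonicalPart W, hX⟩) =
          ExtClasses.mk E ⟨canonicalPart W, hE⟩ ∧
        (∀ t : TrimClasses W,
          t.Prec (TrimClasses.mk ⟨StructureDiagram W, canonicalPart W, hX⟩)) ∧
        (∀ e : ExtClasses W, e.Prec (ExtClasses.mk E ⟨canonicalPart W, hE⟩)) := by
  have hX : IsBoundedTrimPartition (canonicalPart W) :=
    ⟨isTrimPartition_canonicalPart hW.1, hW.2⟩
  let X : BoundedTrimPartition W := ⟨StructureDiagram W, canonicalPart W, hX⟩
  have hle : ∀ t : TrimClasses W, t.Prec (TrimClasses.mk X) := by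
    intro t
    induction t using Quotient.inductionOn with
    | _ Y => exact ⟨Y, X, rfl, rfl, Y.isBoundedTrim.isTrim.regularlyRefines_canonicalPart hW.1⟩
  refine ⟨TrimClasses.isPreorder_prec, ExtClasses.isPreorder_prec,
    Equiv.ofBijective _ TrimClasses.bijective_toExtClasses, TrimClasses.prec_toExtClasses_iff,
    fun Y => ⟨Y.extPOSystem, Y.isBoundedTrimExtPartition, rfl⟩,
    hX, X.extPOSystem, X.isBoundedTrimExtPartition, rfl, hle, fun e => ?_⟩
  obtain ⟨s, rfl⟩ := TrimClasses.bijective_toExtClasses.surjective e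
  exact (TrimClasses.prec_toExtClasses_iff s (TrimClasses.mk X)).2 (hle s)
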